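/- Let $\rho_1,\rho_2,\gamma,b,k,k_0,k_1,k_2,l,m_1,m_2,\alpha_1,\alpha_2>0$ be constants. Consider on $\mathbb{R}\times(0,\infty)$ the thermoelastic Bresse system of Type I, $$\begin{aligned} &\rho_1\varphi_{tt}-k(\varphi_x-\psi-l\omega)_x-k_0l(\omega_x-l\varphi)+l\gamma\theta_1=0,\\ &\rho_2\psi_{tt}-b\psi_{xx}-k(\varphi_x-\psi-l\omega)+\gamma\theta_{2x}=0,\\ &\rho_1\omega_{tt}-k_0(\omega_x-l\varphi)_x-kl(\varphi_x-\psi-l\omega)+\gamma\theta_{1x}=0,\\ &\theta_{1t}-k_1\theta_{1xx}+m_1(\omega_x-l\varphi)_t=0,\\ &\theta_{2t}-k_2\theta_{2xx}+m_2\psi_{xt}=0, \end{aligned}$$ and the system of Type III, in which $\theta_1,\theta_2$ are replaced by $\theta_{1t},\theta_{2t}$ in the first three equations and the last two equations are $$\theta_{1tt}-k_1\theta_{1xx}-\alpha_1\theta_{1xxt}+m_1(\omega_x-l\varphi)_t=0,\qquad \theta_{2tt}-k_2\theta_{2xx}-\alpha_2\theta_{2xxt}+m_2\psi_{xt}=0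 .$$ The associated vector solutions are $$V_1=\Big(\rho_1^{1/2}\varphi_t,\ \rho_2^{1/2}\psi_t,\ \rho_1^{1/2}\omega_t,\ (\tfrac{\gamma}{m_1})^{1/2}\theta_1,\ (\tfrac{\gamma}{m_2})^{1/2}\theta_2,\ b^{1/2}\psi_x,\ k^{1/2}(\varphi_x-\psi-l\omega),\ k_0^{1/2}(\omega_x-l\varphi)\Big)$$ for Type I and $$V_2=\Big(\rho_1^{1/2}\varphi_t,\ \rho_2^{1/2}\psi_t,\ \rho_1^{1/2}\omega_t,\ (\tfrac{\gamma}{m_1})^{1/2}\theta_{1t},\ (\tfrac{k_1\gamma}{m_1})^{1/2}\theta_{1x},\ (\tfrac{\gamma}{m_2})^{1/2}\theta_{2t},\ (\tfrac{k_2\gamma}{m_2})^{1/2}\theta_{2x},\ b^{1/2}\psi_x,\ k^{1/2}(\varphi_x-\psi-l\omega),\ k_0^{1/2}(\omega_x-l\varphi)\Big)$$ for Type III. Solutions are understood in the weak sense (test functions in $C_c^\infty(\mathbb{R})$ in the space variable) with $V_j\in C([0,\infty);L^2(\mathbb{R}))$, and $V_j^0=V_j(0)$ is the vector of initial data. **Theorem.**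 Let $s\ge 0$ be an integer. There are constants $C_1,C_2>0$, depending only on the coefficients and on $s$, such that for $j=1,2$ every solution with $V_j^0\in H^s(\mathbb{R})\cap L^1(\mathbb{R})$ satisfies $V_j(t)\in H^s(\mathbb{R})$ for all $t\ge0$, and for all integers $p,q\ge 0$ with $p+q\le s$ and all $t\ge 0$: 1. if $\frac{\rho_1}{\rho_2}=\frac{k}{b}$ and $k=k_0$, then $$\|\partial_x^pV_j(t)\|_{2}\le C_1(1+t)^{-\frac18-\frac p4}\|V_j^0\|_{1}+C_2(1+t)^{-\frac q4}\|\partial_x^{p+q}V_j^0\|_{2};$$ 2. if $\frac{\rho_1}{\rho_2}\ne\frac{k}{b}$ or $k\ne k_0$, then $$\|\partial_x^pV_j(t)\|_{2}\le C_1(1+t)^{-\frac18-\frac p4}\|V_j^0\|_{1}+C_2(1+t)^{-\frac q6}\|\partial_x^{p+q}V_j^0\|_{2}.$$ -/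

import Mathlib

open MeasureTheory Filter Topology Set
open scoped ENNReal

noncomputable section

namespace Bresse

/-- The physical coefficients of the thermoelastic Bresse systems, all of them positive.
(`α₁`, `α₂` occur only in the system of Type III.) -/
structure Coeffs where
  ρ₁ : ℝ
  ρ₂ : ℝ
  γ : ℝ
  b : ℝ
  k : ℝ
  k₀ : ℝ
  k₁ : ℝ
  k₂ : ℝ
  l : ℝ
  m₁ : ℝ
  m₂ : ℝ
  α₁ : ℝ
  α₂ : ℝ
  ρ₁_pos : 0 < ρ₁
  ρ₂_pos : 0 < ρ₂
  γ_pos : 0 < γ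
  b_pos : 0 < b
  k_pos : 0 < k
  k₀_pos : 0 < k₀
  k₁_pos : 0 < k₁
  k₂_pos : 0 < k₂
  l_pos : 0 < l
  m₁_pos : 0 < m₁
  m₂_pos : 0 < m₂
  α₁_pos : 0 < α₁
  α₂_pos : 0 < α₂

/-- The wave speeds agree: `ρ₁ / ρ₂ = k / b` and `k = k₀`. -/
def Coeffs.EqualSpeeds (c : Coeffs) : Prop :=
  c.ρ₁ / c.ρ₂ = c.k / c.b ∧ c.k = c.k₀

/-- Real test functions on the line: smooth with compact support. -/
def IsTest (χ : ℝ → ℝ) : Prop :=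
  ContDiff ℝ (⊤ : ℕ∞) χ ∧ HasCompactSupport χ

section Sobolev

variable {E : Type*} [NormedAddCommGroup E] [NormedSpace ℝ E]

/-- `g` is the weak derivative of order `n` of `f` on the real line. -/
def HasWeakDeriv (n : ℕ) (f g : ℝ → E) : Prop :=
  LocallyIntegrable f volume ∧ LocallyIntegrable g volume ∧
    ∀ χ : ℝ → ℝ, IsTest χ →
      ∫ x, iteratedDeriv n χ x • f x = (-1 : ℝ) ^ n • ∫ x, χ x • g x

/-- The Sobolev space `H^s(ℝ)` of integer order: all weak derivatives of order at most `s`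
(including order `0`) exist and belong to `L²`. -/
def MemHs (s : ℕ) (f : ℝ → E) : Prop :=
  ∀ j ≤ s, ∃ g : ℝ → E, HasWeakDeriv j f g ∧ MemLp g 2 volume

/-- `V ∈ C([0,∞); L²(ℝ))`, where `V t x` is the value at time `t` and position `x`. -/
def IsContinuousL2 (V : ℝ → ℝ → E) : Prop :=
  (∀ t, 0 ≤ t → MemLp (V t) 2 volume) ∧
    ∀ t, 0 ≤ t → Tendsto (fun τ => eLpNorm (V τ - V t) 2 volume) (𝓝[Ici 0] t) (𝓝 0)

end Sobolev

/-- The equation `m_t = f₀ + (f₁)_x + (f₂)_xx` on `ℝ × [0,∞)` in the weak sense: for each test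
function `χ` of the space variable, `t ↦ ∫ m(t,x) χ(x) dx` is differentiable on `[0,∞)` with
derivative `∫ (f₀ χ - f₁ χ' + f₂ χ'') dx`. Functions are written with time first. -/
def WeakEvol (m f₀ f₁ f₂ : ℝ → ℝ → ℝ) : Prop :=
  ∀ χ : ℝ → ℝ, IsTest χ → ∀ t : ℝ, 0 ≤ t →
    HasDerivWithinAt (fun τ => ∫ x, m τ x * χ x)
      (∫ x, (f₀ t x * χ x - f₁ t x * deriv χ x + f₂ t x * iteratedDeriv 2 χ x)) (Ici 0) t

/-- `g = f_t` in the weak sense on `ℝ × [0,∞)`. -/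
def HasWeakTimeDeriv (f g : ℝ → ℝ → ℝ) : Prop :=
  WeakEvol f g 0 0

/-- `g = f_x` in the weak sense, at every time `t ≥ 0`. -/
def HasWeakSpaceDeriv (f g : ℝ → ℝ → ℝ) : Prop :=
  ∀ t, 0 ≤ t → HasWeakDeriv 1 (f t) (g t)

/-- The displacements `φ, ψ, ω` together with (what will be required to be) their time
derivatives `φt, ψt, ωt` and space derivatives `φx, ψx, ωx`. The first argument is time. -/
structure Motion where
  φ : ℝ → ℝ → ℝ
  ψ : ℝ → ℝ → ℝ
  ω : ℝ → ℝ → ℝ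
  φt : ℝ → ℝ → ℝ
  ψt : ℝ → ℝ → ℝ
  ωt : ℝ → ℝ → ℝ
  φx : ℝ → ℝ → ℝ
  ψx : ℝ → ℝ → ℝ
  ωx : ℝ → ℝ → ℝ

namespace Motion

/-- The named derivatives are the weak derivatives of `φ, ψ, ω`. -/
structure Compatible (u : Motion) : Prop where
  φ_time : HasWeakTimeDeriv u.φ u.φt
  ψ_time : HasWeakTimeDeriv u.ψ u.ψt
  ω_time : HasWeakTimeDeriv u.ω u.ωt
  φ_space : HasWeakSpaceDeriv u.φ u.φx
  ψ_space : HasWeakSpaceDeriv u.ψ u.ψx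
  ω_space : HasWeakSpaceDeriv u.ω u.ωx

/-- `φ_x - ψ - l ω`. -/
def shear (c : Coeffs) (u : Motion) : ℝ → ℝ → ℝ :=
  fun t x => u.φx t x - u.ψ t x - c.l * u.ω t x

/-- `ω_x - l φ`. -/
def axial (c : Coeffs) (u : Motion) : ℝ → ℝ → ℝ :=
  fun t x => u.ωx t x - c.l * u.φ t x

/-- The three equations of motion, driven by temperatures `T₁, T₂`:
`ρ₁ φ_tt - k (φ_x - ψ - lω)_x - k₀ l (ω_x - lφ) + l γ T₁ = 0`,
`ρ₂ ψ_tt - b ψ_xx - k (φ_x - ψ - lω) + γ (T₂)_x = 0`,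
`ρ₁ ω_tt - k₀ (ω_x - lφ)_x - k l (φ_x - ψ - lω) + γ (T₁)_x = 0`. -/
structure Equations (c : Coeffs) (u : Motion) (T₁ T₂ : ℝ → ℝ → ℝ) : Prop where
  vertical : WeakEvol (fun t x => c.ρ₁ * u.φt t x)
    (fun t x => c.k₀ * c.l * u.axial c t x - c.l * c.γ * T₁ t x)
    (fun t x => c.k * u.shear c t x) 0
  rotation : WeakEvol (fun t x => c.ρ₂ * u.ψt t x)
    (fun t x => c.k * u.shear c t x)
    (fun t x => c.b * u.ψx t x - c.γ * T₂ t x) 0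
  longitudinal : WeakEvol (fun t x => c.ρ₁ * u.ωt t x)
    (fun t x => c.k * c.l * u.shear c t x)
    (fun t x => c.k₀ * u.axial c t x - c.γ * T₁ t x) 0

end Motion

/-- The vector solution of the system of Type I. -/
def V₁ (c : Coeffs) (u : Motion) (θ₁ θ₂ : ℝ → ℝ → ℝ) (t x : ℝ) : EuclideanSpace ℝ (Fin 8) :=
  !₂[√c.ρ₁ * u.φt t x, √c.ρ₂ * u.ψt t x, √c.ρ₁ * u.ωt t x,
    √(c.γ / c.m₁) * θ₁ t x, √(c.γ / c.m₂) * θ₂ t x,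
    √c.b * u.ψx t x, √c.k * u.shear c t x, √c.k₀ * u.axial c t x]

/-- Weak finite-energy solutions on `[0,∞)` of the thermoelastic Bresse system of Type I; the heat
equations are
`θ₁_t - k₁ θ₁_xx + m₁ (ω_x - lφ)_t = 0` and `θ₂_t - k₂ θ₂_xx + m₂ ψ_xt = 0`. -/
structure IsSolutionI (c : Coeffs) (u : Motion) (θ₁ θ₂ : ℝ → ℝ → ℝ) : Prop where
  compatible : u.Compatible
  continuous_L2 : IsContinuousL2 (V₁ c u θ₁ θ₂)
  motion : u.Equations c θ₁ θ₂
  heat₁ : WeakEvol (fun t x => θ₁ t x + c.m₁ * u.axial c t x) 0 0 (fun t x => c.k₁ * θ₁ t x)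
  heat₂ : WeakEvol (fun t x => θ₂ t x + c.m₂ * u.ψx t x) 0 0 (fun t x => c.k₂ * θ₂ t x)

/-- The thermal variables of Type III: `θ₁, θ₂` with their derivatives in time and space. -/
structure Thermal where
  θ₁ : ℝ → ℝ → ℝ
  θ₂ : ℝ → ℝ → ℝ
  θ₁t : ℝ → ℝ → ℝ
  θ₂t : ℝ → ℝ → ℝ
  θ₁x : ℝ → ℝ → ℝ
  θ₂x : ℝ → ℝ → ℝ

/-- The named derivatives are the weak derivatives of `θ₁, θ₂`. -/
structure Thermal.Compatible (h : Thermal) : Prop where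
  θ₁_time : HasWeakTimeDeriv h.θ₁ h.θ₁t
  θ₂_time : HasWeakTimeDeriv h.θ₂ h.θ₂t
  θ₁_space : HasWeakSpaceDeriv h.θ₁ h.θ₁x
  θ₂_space : HasWeakSpaceDeriv h.θ₂ h.θ₂x

/-- The vector solution of the system of Type III. -/
def V₂ (c : Coeffs) (u : Motion) (h : Thermal) (t x : ℝ) : EuclideanSpace ℝ (Fin 10) :=
  !₂[√c.ρ₁ * u.φt t x, √c.ρ₂ * u.ψt t x, √c.ρ₁ * u.ωt t x,
    √(c.γ / c.m₁) * h.θ₁t t x, √(c.k₁ * c.γ / c.m₁) * h.θ₁x t x,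
    √(c.γ / c.m₂) * h.θ₂t t x, √(c.k₂ * c.γ / c.m₂) * h.θ₂x t x,
    √c.b * u.ψx t x, √c.k * u.shear c t x, √c.k₀ * u.axial c t x]

/-- Weak finite-energy solutions on `[0,∞)` of the thermoelastic Bresse system of Type III; the
equations of motion are driven by `θ₁_t, θ₂_t` and the heat equations are
`θ₁_tt - k₁ θ₁_xx - α₁ θ₁_xxt + m₁ (ω_x - lφ)_t = 0`,
`θ₂_tt - k₂ θ₂_xx - α₂ θ₂_xxt + m₂ ψ_xt = 0`. -/
structure IsSolutionIII (c : Coeffs) (u : Motion) (h : Thermal) : Prop where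
  compatible : u.Compatible
  thermal_compatible : h.Compatible
  continuous_L2 : IsContinuousL2 (V₂ c u h)
  motion : u.Equations c h.θ₁t h.θ₂t
  heat₁ : WeakEvol (fun t x => h.θ₁t t x + c.m₁ * u.axial c t x) 0 0
    (fun t x => c.k₁ * h.θ₁ t x + c.α₁ * h.θ₁t t x)
  heat₂ : WeakEvol (fun t x => h.θ₂t t x + c.m₂ * u.ψx t x) 0 0
    (fun t x => c.k₂ * h.θ₂ t x + c.α₂ * h.θ₂t t x)

/-- For all `t ≥ 0` the function `V(t)` belongs to `H^s`, and for all `j + n ≤ s`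
`‖∂ₓʲ V(t)‖₂ ≤ C₁ (1+t)^(-1/8-j/4) ‖V(0)‖₁ + C₂ (1+t)^(-n/r) ‖∂ₓʲ⁺ⁿ V(0)‖₂`
(`Dt`, `D0` being the weak derivatives in question, which are unique almost everywhere). -/
def DecayEstimate {d : ℕ} (s : ℕ) (C₁ C₂ r : ℝ) (V : ℝ → ℝ → EuclideanSpace ℝ (Fin d)) : Prop :=
  ∀ t : ℝ, 0 ≤ t → MemHs s (V t) ∧
    ∀ j n : ℕ, j + n ≤ s → ∀ Dt D0 : ℝ → EuclideanSpace ℝ (Fin d),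
      HasWeakDeriv j (V t) Dt → HasWeakDeriv (j + n) (V 0) D0 →
        eLpNorm Dt 2 volume ≤
          ENNReal.ofReal (C₁ * (1 + t) ^ (-(1 / 8 : ℝ) - (j : ℝ) / 4)) * eLpNorm (V 0) 1 volume +
          ENNReal.ofReal (C₂ * (1 + t) ^ (-((n : ℝ) / r))) * eLpNorm D0 2 volume

end Bresse

end

/-! On the Fourier side a weak solution is V̂(t,ξ) = exp(tA(ξ)) V̂(0,ξ), where A(ξ) is the matrix
symbol (`FTV_eq_exp`). Everything therefore rests on one pointwise bound, `Pencil.SymbolBound`: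
‖exp(tA(ξ))‖² ≤ 3 exp(-c ξ⁴(1+ξ²)⁻⁴ t), with c > 0 depending only on the coefficients.

The bound comes from a hidden decoupling. Put κ = 2πξ and n² = κ² + l². The map (u₁, u₃) ↦ (W, P),
with W = (iκu₃ - lu₁)/n and P = (iκu₁ - lu₃)/n, is unitary. It splits the system into an axial block
(η, W, τ₁, s₁), where η is the axial strain and W its velocity, and a rotational block (v, P, u₂, z,
τ₂, s₂) of Timoshenko type (`FourierODE.axial`, `FourierODE.rot`, `fourierEnergy_eq`). Each block
has its own heat equation. Type I is the case without fluxes s; in Type III the fluxes are √k₁ θ₁ₓ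
and √k₂ θ₂ₓ.

In each block the energy identity dissipates only κτ. Small multiples of bilinear corrections
recover the remaining variables one after another, with weights given by powers of r = κ/n and h =
1/n. Powers of a single small ε order the multiples so that every cross term is absorbed
(`exists_small_rotational`, `exists_small_axial`). The weakest control is r²h² on v and P, so the
rate is r⁴h⁴ = κ⁴/n⁸ (`rot_decay`, `axial_decay`). The bound z receives comes from ρ₁P + nρ₂u, whose
time derivative does not contain v; thus no relation between the wave speeds enters.

The rate behaves like ξ⁴ near 0 and like ξ⁻⁴ at infinity. Low frequencies, with V̂(0) bounded by the
L¹ norm, contribute the integral of |ξ|²ᵖ exp(-cξ⁴t), of order t^(-1/4-p/2). High frequencies trade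
2q powers of |ξ| for (1+t)^(-q/2). Square roots give the exponents 1/8 + p/4 and q/4
(`decay_of_symbolBound`). The exponent q/4 is thus obtained for all coefficients, and the q/6
estimate is a weaker consequence (`DecayEstimate.mono`). -/

namespace Bresse

noncomputable section

open scoped FourierTransform SchwartzMap ComplexConjugate

/-! ### Test functions and their Fourier transforms -/

theorem IsTest.iteratedDeriv {χ : ℝ → ℝ} (h : IsTest χ) (n : ℕ) : IsTest (iteratedDeriv n χ) := by
  refine ⟨?_, ?_⟩
  · rw [iteratedDeriv_eq_iterate]
    exact h.1.iterate_deriv n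
  · rw [iteratedDeriv_eq_iterate]
    induction n with
    | zero => exact h.2
    | succ k ih => rw [Function.iterate_succ_apply']; exact ih.deriv

theorem IsTest.deriv {χ : ℝ → ℝ} (h : IsTest χ) : IsTest (deriv χ) := by
  simpa using h.iteratedDeriv 1

theorem IsTest.continuous {χ : ℝ → ℝ} (h : IsTest χ) : Continuous χ := h.1.continuous

theorem IsTest.comp_sub {χ : ℝ → ℝ} (h : IsTest χ) (y : ℝ) : IsTest (fun x => χ (x - y)) :=
  ⟨h.1.comp (contDiff_id.sub contDiff_const),
    h.2.comp_homeomorph (Homeomorph.subRight y)⟩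

theorem IsTest.comp_mul {χ : ℝ → ℝ} (h : IsTest χ) {a : ℝ} (ha : a ≠ 0) :
    IsTest (fun x => χ (a * x)) :=
  ⟨h.1.comp (contDiff_const.mul contDiff_id), h.2.comp_homeomorph (Homeomorph.mulLeft₀ a ha)⟩

theorem IsTest.memLp {χ : ℝ → ℝ} (h : IsTest χ) (p : ℝ≥0∞) : MemLp χ p volume :=
  h.continuous.memLp_of_hasCompactSupport h.2

/-- A test function, complexified, as a Schwartz function. -/
def IsTest.schwartz {χ : ℝ → ℝ} (h : IsTest χ) : 𝓢(ℝ, ℂ) :=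
  HasCompactSupport.toSchwartzMap (f := fun x => (χ x : ℂ)) (h.2.comp_left Complex.ofReal_zero)
    (Complex.ofRealCLM.contDiff.comp h.1)

@[simp] theorem IsTest.schwartz_apply {χ : ℝ → ℝ} (h : IsTest χ) (x : ℝ) :
    h.schwartz x = (χ x : ℂ) := rfl

/-- The inverse Fourier transform of a test function. -/
def IsTest.inv {χ : ℝ → ℝ} (h : IsTest χ) : 𝓢(ℝ, ℂ) := 𝓕⁻ h.schwartz

/-- Reality of `χ` turns the conjugate of its transform into its inverse transform. Hence the
sesquilinear L² pairing becomes a plain integral against `h.inv`. -/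
theorem IsTest.conj_fourier {χ : ℝ → ℝ} (h : IsTest χ) (ξ : ℝ) :
    conj ((𝓕 h.schwartz) ξ) = h.inv ξ := by
  rw [IsTest.inv, SchwartzMap.fourier_coe, SchwartzMap.fourierInv_coe, Real.fourier_eq',
    Real.fourierInv_eq', ← integral_conj]
  refine integral_congr_ae (.of_forall fun x => ?_)
  simp [← Complex.exp_conj, Complex.conj_ofNat]

theorem IsTest.inv_apply {χ : ℝ → ℝ} (h : IsTest χ) (ξ : ℝ) :
    h.inv ξ = 𝓕 (fun x => (χ x : ℂ)) (-ξ) := by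
  rw [IsTest.inv, SchwartzMap.fourierInv_coe, Real.fourierInv_eq_fourier_neg]
  rfl

theorem IsTest.inv_iteratedDeriv {χ : ℝ → ℝ} (h : IsTest χ) (n : ℕ) (ξ : ℝ) :
    (h.iteratedDeriv n).inv ξ = (-(2 * Real.pi * Complex.I * ξ)) ^ n * h.inv ξ := by
  have e : ∀ n, (fun x => ((_root_.iteratedDeriv n χ x : ℝ) : ℂ))
      = _root_.iteratedDeriv n (fun x => (χ x : ℂ)) := by
    intro n
    induction n with
    | zero => simp
    | succ k ih =>
      rw [iteratedDeriv_succ, iteratedDeriv_succ, ← ih]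
      ext x
      have hd : DifferentiableAt ℝ (_root_.iteratedDeriv k χ) x :=
        ((h.iteratedDeriv k).1.differentiable (by simp)).differentiableAt
      exact (hd.hasDerivAt.ofReal_comp).deriv.symm
  rw [IsTest.inv_apply, IsTest.inv_apply, e, Real.fourier_iteratedDeriv (N := ⊤) (n := n)]
  · simp
  · exact Complex.ofRealCLM.contDiff.comp h.1
  · intro m _
    rw [← e]
    exact (memLp_one_iff_integrable.1 ((h.iteratedDeriv m).memLp 1)).ofReal
  · exact le_top

theorem IsTest.inv_comp_sub {χ : ℝ → ℝ} (h : IsTest χ) (y ξ : ℝ) :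
    (h.comp_sub y).inv ξ = Complex.exp (2 * Real.pi * Complex.I * (y * ξ)) * h.inv ξ := by
  rw [IsTest.inv, IsTest.inv, SchwartzMap.fourierInv_coe, SchwartzMap.fourierInv_coe,
    Real.fourierInv_eq', Real.fourierInv_eq', ← integral_const_mul,
    ← integral_add_right_eq_self _ y]
  refine integral_congr_ae (.of_forall fun x => ?_)
  simp only [IsTest.schwartz_apply, smul_eq_mul, add_sub_cancel_right, ← mul_assoc]
  rw [← Complex.exp_add]
  congr 2
  simp
  ring

theorem IsTest.inv_comp_mul {χ : ℝ → ℝ} (h : IsTest χ) {a : ℝ} (ha : 0 < a) (ξ : ℝ) :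
    (h.comp_mul ha.ne').inv ξ = (a : ℂ)⁻¹ * h.inv (ξ / a) := by
  rw [IsTest.inv, IsTest.inv, SchwartzMap.fourierInv_coe, SchwartzMap.fourierInv_coe,
    Real.fourierInv_eq', Real.fourierInv_eq']
  have := Measure.integral_comp_mul_left (fun x : ℝ =>
    Complex.exp (2 * Real.pi * inner ℝ x (ξ / a) * Complex.I) • h.schwartz x) a
  rw [abs_of_pos (inv_pos.2 ha)] at this
  simp only [Complex.ofReal_mul, Complex.ofReal_ofNat] at this ⊢
  rw [← Complex.ofReal_inv, ← Complex.real_smul, ← this]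
  refine integral_congr_ae (.of_forall fun x => ?_)
  simp only [IsTest.schwartz_apply, smul_eq_mul]
  congr 3
  simp
  have : (a : ℂ) ≠ 0 := by exact_mod_cast ha.ne'
  field_simp

/-- Some test function has nonzero integral against every small frequency. -/
theorem exists_isTest_inv_ne_zero : ∃ (χ : ℝ → ℝ) (h : IsTest χ), h.inv 0 ≠ 0 := by
  let f : ContDiffBump (0 : ℝ) := ⟨1, 2, one_pos, one_lt_two⟩
  have hf : IsTest f := ⟨f.contDiff, f.hasCompactSupport⟩
  refine ⟨f, hf, ?_⟩
  rw [IsTest.inv, SchwartzMap.fourierInv_coe, Real.fourierInv_eq']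
  simp only [IsTest.schwartz_apply, inner_zero_right, mul_zero, Complex.ofReal_zero, zero_mul,
    Complex.exp_zero, one_smul]
  rw [integral_complex_ofReal]
  exact_mod_cast f.integral_pos.ne'

/-! ### Uniqueness on the Fourier side -/

theorem integral_fourier_mul_eq {f g : ℝ → ℂ} (hf : Integrable f) (hg : Integrable g) :
    ∫ ξ, 𝓕 f ξ * g ξ = ∫ x, f x * 𝓕 g x := by
  simpa using! VectorFourier.integral_fourierIntegral_smul_eq_flip (L := innerₗ ℝ)
    Real.continuous_fourierChar continuous_inner hf hg

/-- Injectivity of the transform on L¹: by the multiplication formula, the integral of k against any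
test function χ equals that of the transform of k against the inverse transform of χ. -/
theorem ae_eq_zero_of_fourier_eq_zero {k : ℝ → ℂ} (hk : Integrable k) (h : ∀ y, 𝓕 k y = 0) :
    ∀ᵐ x, k x = 0 := by
  refine ae_eq_zero_of_integral_contDiff_smul_eq_zero hk.locallyIntegrable fun g hg hg' => ?_
  have ht : IsTest g := ⟨hg, hg'⟩
  have := integral_fourier_mul_eq hk (g := (𝓕⁻ ht.schwartz : 𝓢(ℝ, ℂ)))
    (SchwartzMap.integrable _)
  rw [← SchwartzMap.fourier_coe, FourierTransform.fourier_fourierInv_eq] at this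
  simp only [h, zero_mul, integral_zero, IsTest.schwartz_apply] at this
  rw [this]
  refine integral_congr_ae (.of_forall fun x => ?_)
  simp [mul_comm]

/-- A function which is annihilated by the Fourier transforms of all test functions vanishes. -/
theorem ae_eq_zero_of_test {q : ℝ → ℂ}
    (hint : ∀ (χ : ℝ → ℝ) (h : IsTest χ), Integrable (fun ξ => h.inv ξ * q ξ))
    (hzero : ∀ (χ : ℝ → ℝ) (h : IsTest χ), ∫ ξ, h.inv ξ * q ξ = 0) :
    ∀ᵐ ξ, q ξ = 0 := by
  -- Translating `χ` modulates `h.inv`, so the hypothesis says that the integrable function `h.inv *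
  -- q` has vanishing Fourier transform. No integrability of `q` alone is available, which rules out
  -- a density argument.
  have key : ∀ (χ : ℝ → ℝ) (h : IsTest χ), ∀ᵐ ξ, h.inv ξ * q ξ = 0 := by
    intro χ h
    refine ae_eq_zero_of_fourier_eq_zero (hint χ h) fun y => ?_
    rw [Real.fourier_eq', ← hzero _ (h.comp_sub (-y))]
    refine integral_congr_ae (.of_forall fun ξ => ?_)
    change _ = (h.comp_sub (-y)).inv ξ * q ξ
    rw [h.inv_comp_sub]
    simp only [smul_eq_mul, ← mul_assoc]
    congr 3
    simp
    ring
  obtain ⟨χ, h, h0⟩ := exists_isTest_inv_ne_zero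
  -- Dilating `χ` by `n + 1` spreads out its inverse transform. At any fixed frequency some dilate
  -- is nonzero and can be divided out; countably many dilates keep the exceptional set null.
  have hall := ae_all_iff.2 fun n : ℕ =>
    key _ (h.comp_mul (show ((n : ℝ) + 1) ≠ 0 by positivity))
  filter_upwards [hall] with ξ hξ
  have hlim : Tendsto (fun n : ℕ => h.inv (ξ / ((n : ℝ) + 1))) atTop (𝓝 (h.inv 0)) := by
    refine (h.inv.continuous.tendsto 0).comp ?_
    exact tendsto_const_nhds.div_atTop
      (tendsto_atTop_add_const_right _ _ tendsto_natCast_atTop_atTop)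
  obtain ⟨n, hn⟩ := (hlim.eventually_ne h0).exists
  have hn1 : (0 : ℝ) < (n : ℝ) + 1 := by positivity
  have := hξ n
  rw [h.inv_comp_mul hn1] at this
  rcases mul_eq_zero.1 this with h1 | h1
  · rcases mul_eq_zero.1 h1 with h2 | h2
    · exact absurd h2 (by exact_mod_cast (inv_ne_zero hn1.ne'))
    · exact absurd h2 hn
  · exact h1

/-! ### The Fourier transform of a real square-integrable function -/

theorem memLp_ofReal {f : ℝ → ℝ} {p : ℝ≥0∞} (hf : MemLp f p volume) :
    MemLp (fun x => (f x : ℂ)) p volume := hf.ofReal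

open Classical in
/-- The Fourier transform in `L²` of a real function (zero outside `L²`). -/
def FT (f : ℝ → ℝ) : Lp ℂ 2 (volume : Measure ℝ) :=
  if hf : MemLp f 2 volume then 𝓕 (memLp_ofReal hf).toLp else 0

theorem FT_eq {f : ℝ → ℝ} (hf : MemLp f 2 volume) :
    FT f = 𝓕 (memLp_ofReal hf).toLp := dif_pos hf

theorem FT_sub {f g : ℝ → ℝ} (hf : MemLp f 2 volume) (hg : MemLp g 2 volume) :
    FT (f - g) = FT f - FT g := by
  rw [FT_eq hf, FT_eq hg, FT_eq (hf.sub hg)]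
  refine Eq.trans ?_ (map_sub (Lp.fourierTransformₗᵢ ℝ ℂ) (memLp_ofReal hf).toLp
    (memLp_ofReal hg).toLp)
  rw [← MemLp.toLp_sub]
  refine congrArg (Lp.fourierTransformₗᵢ ℝ ℂ) (MemLp.toLp_congr _ _ (.of_forall fun x => ?_))
  simp

theorem enorm_FT {f : ℝ → ℝ} (hf : MemLp f 2 volume) : ‖FT f‖ₑ = eLpNorm f 2 volume := by
  rw [FT_eq hf, ← ofReal_norm, Lp.norm_fourier_eq, ofReal_norm, Lp.enorm_def,
    eLpNorm_congr_ae (MemLp.coeFn_toLp _)]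
  refine eLpNorm_congr_norm_ae (.of_forall fun x => ?_)
  simp

theorem inner_eq_integral (G : Lp ℂ 2 (volume : Measure ℝ)) {χ : ℝ → ℝ} (h : IsTest χ) :
    inner ℂ (h.schwartz.toLp 2) G = ∫ x, (χ x : ℂ) * G x := by
  rw [L2.inner_def]
  refine integral_congr_ae ?_
  filter_upwards [h.schwartz.coeFn_toLp 2] with x hx
  simp [hx, mul_comm]

theorem inner_eq_integral_inv (G : Lp ℂ 2 (volume : Measure ℝ)) {χ : ℝ → ℝ} (h : IsTest χ) :
    inner ℂ (h.schwartz.toLp 2) G = ∫ ξ, h.inv ξ * (𝓕 G : Lp ℂ 2 volume) ξ := by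
  rw [← Lp.inner_fourier_eq, SchwartzMap.toLp_fourier_eq, L2.inner_def]
  refine integral_congr_ae ?_
  filter_upwards [(𝓕 h.schwartz).coeFn_toLp 2] with x hx
  rw [hx, ← h.conj_fourier]
  simp [mul_comm]

/-- Parseval's identity against a test function. -/
theorem integral_mul_test {f : ℝ → ℝ} (hf : MemLp f 2 volume) {χ : ℝ → ℝ} (h : IsTest χ) :
    ((∫ x, f x * χ x : ℝ) : ℂ) = ∫ ξ, h.inv ξ * FT f ξ := by
  rw [FT_eq hf, ← inner_eq_integral_inv, inner_eq_integral, ← integral_complex_ofReal]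
  refine integral_congr_ae ?_
  filter_upwards [(memLp_ofReal hf).coeFn_toLp] with x hx
  rw [hx]
  push_cast
  ring

theorem integrable_inv_mul {χ : ℝ → ℝ} (h : IsTest χ) {q : ℝ → ℂ} (hq : MemLp q 2 volume) :
    Integrable (fun ξ => h.inv ξ * q ξ) :=
  (h.inv.memLp 2).integrable_mul hq

end

end Bresse

namespace Bresse

noncomputable section

open scoped FourierTransform SchwartzMap ComplexConjugate

/-! ### Weak derivatives and integrable functions on the Fourier side -/

/-- The symbol of `∂ₓ`. -/
def dsym (ξ : ℝ) : ℂ := 2 * Real.pi * Complex.I * ξ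

theorem continuous_dsym : Continuous dsym := by
  unfold dsym; fun_prop

theorem norm_dsym (ξ : ℝ) : ‖dsym ξ‖ = 2 * Real.pi * |ξ| := by
  simp [dsym, abs_of_pos Real.pi_pos]

theorem IsTest.inv_mul_dsym_pow {χ : ℝ → ℝ} (h : IsTest χ) (n : ℕ) (ξ : ℝ) :
    h.inv ξ * dsym ξ ^ n = (-1) ^ n * (h.iteratedDeriv n).inv ξ := by
  rw [h.inv_iteratedDeriv, dsym, ← mul_assoc, ← mul_pow, neg_one_mul, neg_neg, mul_comm]

theorem integral_inv_mul_dsym_pow {f : ℝ → ℝ} (hf : MemLp f 2 volume) {χ : ℝ → ℝ}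
    (h : IsTest χ) (n : ℕ) :
    ∫ ξ, h.inv ξ * (dsym ξ ^ n * FT f ξ) =
      (-1) ^ n * ((∫ x, f x * iteratedDeriv n χ x : ℝ) : ℂ) := by
  rw [integral_mul_test hf (h.iteratedDeriv n), ← integral_const_mul]
  refine integral_congr_ae (.of_forall fun ξ => ?_)
  simp only [← mul_assoc, h.inv_mul_dsym_pow]

theorem integrable_inv_mul_dsym_pow (G : Lp ℂ 2 (volume : Measure ℝ)) {χ : ℝ → ℝ}
    (h : IsTest χ) (n : ℕ) : Integrable (fun ξ => h.inv ξ * (dsym ξ ^ n * G ξ)) := by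
  have := (integrable_inv_mul (h.iteratedDeriv n) (Lp.memLp G)).const_mul ((-1 : ℂ) ^ n)
  refine this.congr (.of_forall fun ξ => ?_)
  simp only [← mul_assoc, h.inv_mul_dsym_pow]

/-- Both sides have the same integral against every `hχ.inv`, by Parseval and by moving the
derivatives onto the test function. The right side is not known to be in L² beforehand, so
uniqueness is needed in the form `ae_eq_zero_of_test`. -/
theorem FT_of_weak_deriv {n : ℕ} {f g : ℝ → ℝ} (hf : MemLp f 2 volume) (hg : MemLp g 2 volume)
    (h : ∀ χ : ℝ → ℝ, IsTest χ →
      ∫ x, iteratedDeriv n χ x * f x = (-1 : ℝ) ^ n * ∫ x, χ x * g x) :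
    ∀ᵐ ξ, FT g ξ = dsym ξ ^ n * FT f ξ := by
  have := ae_eq_zero_of_test (q := fun ξ => FT g ξ - dsym ξ ^ n * FT f ξ)
    (fun χ hχ => by
      refine ((integrable_inv_mul hχ (Lp.memLp (FT g))).sub
        (integrable_inv_mul_dsym_pow (FT f) hχ n)).congr (.of_forall fun ξ => ?_)
      simp [mul_sub])
    (fun χ hχ => by
      simp only [mul_sub]
      rw [integral_sub (integrable_inv_mul hχ (Lp.memLp _))
        (integrable_inv_mul_dsym_pow (FT f) hχ n), integral_inv_mul_dsym_pow hf,
        ← integral_mul_test hg hχ]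
      have := h χ hχ
      simp only [mul_comm (f _), mul_comm (g _), this]
      push_cast
      rw [← mul_assoc, ← mul_pow]
      simp)
  filter_upwards [this] with ξ hξ using sub_eq_zero.1 hξ

theorem exists_weak_deriv {n : ℕ} {f : ℝ → ℝ} (hf : MemLp f 2 volume)
    (h : MemLp (fun ξ => dsym ξ ^ n * FT f ξ) 2 volume) :
    ∃ g : ℝ → ℝ, MemLp g 2 volume ∧ ∀ χ : ℝ → ℝ, IsTest χ →
      ∫ x, iteratedDeriv n χ x * f x = (-1 : ℝ) ^ n * ∫ x, χ x * g x := by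
  let G : Lp ℂ 2 (volume : Measure ℝ) := 𝓕⁻ h.toLp
  have hG : 𝓕 G = h.toLp := FourierTransform.fourier_fourierInv_eq _
  -- `G` is the complex candidate for the derivative. Since `f` and the test functions are real, its
  -- real part satisfies the same tested identities, and no proof that `G` is real is required.
  refine ⟨fun x => (G x).re, (Lp.memLp G).re, fun χ hχ => ?_⟩
  have h1 : ∫ x, (χ x : ℂ) * G x = (-1) ^ n * ((∫ x, f x * iteratedDeriv n χ x : ℝ) : ℂ) := by
    rw [← inner_eq_integral G hχ, inner_eq_integral_inv, hG, ← integral_inv_mul_dsym_pow hf]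
    refine integral_congr_ae ?_
    filter_upwards [h.coeFn_toLp] with ξ hξ
    rw [hξ]
  have h2 : ∫ x, χ x * (G x).re = (∫ x, (χ x : ℂ) * G x).re := by
    have hint : Integrable (fun x => (χ x : ℂ) * G x) :=
      (memLp_ofReal (hχ.memLp 2)).integrable_mul (Lp.memLp G)
    have := integral_re hint
    simpa using this
  rw [h2, h1]
  have : ((-1 : ℂ) ^ n * ((∫ x, f x * iteratedDeriv n χ x : ℝ) : ℂ)) =
      (((-1 : ℝ) ^ n * ∫ x, f x * iteratedDeriv n χ x : ℝ) : ℂ) := by push_cast; rfl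
  rw [this, Complex.ofReal_re, ← mul_assoc, ← mul_pow]
  simp [mul_comm]

/-- The L² transform and the integral formula agree because both satisfy Parseval against test
functions. This is what lets the L¹ norm of the data bound V̂(0,ξ) pointwise. -/
theorem FT_of_integrable {f : ℝ → ℝ} (hf : MemLp f 2 volume) (hf1 : Integrable f) :
    ∀ᵐ ξ, FT f ξ = 𝓕 (fun x => (f x : ℂ)) ξ := by
  have hc : Continuous (𝓕 (fun x => (f x : ℂ))) :=
    VectorFourier.fourierIntegral_continuous Real.continuous_fourierChar continuous_inner
      hf1.ofReal
  have hb : ∀ ξ, ‖𝓕 (fun x => (f x : ℂ)) ξ‖ ≤ ∫ x, ‖(f x : ℂ)‖ := fun ξ =>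
    VectorFourier.norm_fourierIntegral_le_integral_norm _ _ _ _ _
  have hi : ∀ (χ : ℝ → ℝ) (hχ : IsTest χ),
      Integrable (fun ξ => hχ.inv ξ * 𝓕 (fun x => (f x : ℂ)) ξ) := fun χ hχ =>
    hχ.inv.integrable.mul_bdd hc.aestronglyMeasurable (.of_forall hb)
  have := ae_eq_zero_of_test (q := fun ξ => FT f ξ - 𝓕 (fun x => (f x : ℂ)) ξ)
    (fun χ hχ => by
      refine ((integrable_inv_mul hχ (Lp.memLp (FT f))).sub (hi χ hχ)).congr
        (.of_forall fun ξ => ?_)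
      simp [mul_sub])
    (fun χ hχ => by
      simp only [mul_sub]
      rw [integral_sub (integrable_inv_mul hχ (Lp.memLp _)) (hi χ hχ),
        ← integral_mul_test hf hχ]
      rw [sub_eq_zero, ← integral_complex_ofReal]
      have e := integral_fourier_mul_eq hf1.ofReal (g := hχ.inv) hχ.inv.integrable
      rw [← SchwartzMap.fourier_coe hχ.inv, IsTest.inv,
        FourierTransform.fourier_fourierInv_eq] at e
      refine Eq.trans (integral_congr_ae (.of_forall fun x => ?_))
        (e.symm.trans (integral_congr_ae (.of_forall fun x => ?_)))
      · simp
      · exact mul_comm _ _)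
  filter_upwards [this] with ξ hξ using sub_eq_zero.1 hξ

theorem enorm_FT_le {f : ℝ → ℝ} (hf : MemLp f 2 volume) (hf1 : MemLp f 1 volume) :
    ∀ᵐ ξ, ‖FT f ξ‖ₑ ≤ eLpNorm f 1 volume := by
  have hf1' := memLp_one_iff_integrable.1 hf1
  filter_upwards [FT_of_integrable hf hf1'] with ξ hξ
  rw [hξ, eLpNorm_one_eq_lintegral_enorm]
  refine (enorm_integral_le_lintegral_enorm _).trans (lintegral_mono fun x => ?_)
  simp only [Circle.smul_def, ← ofReal_norm, norm_smul, Circle.norm_coe, one_mul,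
    Complex.norm_real, le_refl]

end

end Bresse

namespace Bresse

noncomputable section

/-! ### Multiplication operators on `L²` -/

/-- `L²(ℝ; ℂ)`. -/
abbrev L2C : Type := Lp ℂ 2 (volume : Measure ℝ)

open Classical in
/-- Multiplication by a bounded function (zero for an unbounded one). -/
def mulOp (m : ℝ → ℂ) : L2C →L[ℂ] L2C :=
  if h : MemLp m ∞ volume then
    (ContinuousLinearMap.mul ℂ ℂ).holderL (volume : Measure ℝ) ∞ 2 2 h.toLp
  else 0

theorem coeFn_mulOp {m : ℝ → ℂ} (hm : MemLp m ∞ volume) (f : L2C) :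
    ∀ᵐ ξ, mulOp m f ξ = m ξ * f ξ := by
  rw [mulOp, dif_pos hm]
  filter_upwards [(ContinuousLinearMap.mul ℂ ℂ).coeFn_holder (r := 2) hm.toLp f, hm.coeFn_toLp]
    with ξ h1 h2
  rw [h2] at h1
  exact h1

theorem mulOp_mulOp {m m' m'' : ℝ → ℂ} (hm : MemLp m ∞ volume) (hm' : MemLp m' ∞ volume)
    (hm'' : MemLp m'' ∞ volume) (h : ∀ ξ, m ξ * m' ξ = m'' ξ) (f : L2C) :
    mulOp m (mulOp m' f) = mulOp m'' f := by
  refine Lp.ext ?_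
  filter_upwards [coeFn_mulOp hm (mulOp m' f), coeFn_mulOp hm' f, coeFn_mulOp hm'' f]
    with ξ h1 h2 h3
  rw [h1, h2, h3, ← h, mul_assoc]

variable {d : ℕ}

/-- The operator on `L²(ℝ; ℂ)ᵈ` given by a matrix of bounded multipliers. -/
def matOp (m : Fin d → Fin d → ℝ → ℂ) : (Fin d → L2C) →L[ℂ] (Fin d → L2C) :=
  ContinuousLinearMap.pi fun a => ∑ b, (mulOp (m a b)).comp (ContinuousLinearMap.proj b)

theorem matOp_apply (m : Fin d → Fin d → ℝ → ℂ) (y : Fin d → L2C) (a : Fin d) :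
    matOp m y a = ∑ b, mulOp (m a b) (y b) := by
  simp [matOp]

/-- The operator on `ℂᵈ` given by a matrix. -/
def matAct (m : Fin d → Fin d → ℂ) : (Fin d → ℂ) →L[ℂ] (Fin d → ℂ) :=
  ContinuousLinearMap.pi fun a => ∑ b, m a b • (ContinuousLinearMap.proj b)

theorem matAct_apply (m : Fin d → Fin d → ℂ) (y : Fin d → ℂ) (a : Fin d) :
    matAct m y a = ∑ b, m a b * y b := by
  simp [matAct]

theorem coeFn_sum {ι : Type*} (s : Finset ι) (f : ι → L2C) :
    ∀ᵐ ξ, (∑ i ∈ s, f i : L2C) ξ = ∑ i ∈ s, f i ξ := by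
  classical
  induction s using Finset.induction_on with
  | empty =>
    filter_upwards [Lp.coeFn_zero ℂ 2 (volume : Measure ℝ)] with ξ h
    simp
  | insert i s hi ih =>
    rw [Finset.sum_insert hi]
    filter_upwards [ih, Lp.coeFn_add (f i) (∑ i ∈ s, f i)] with ξ h1 h2
    rw [h2, Finset.sum_insert hi, Pi.add_apply, h1]

theorem coeFn_matOp {m : Fin d → Fin d → ℝ → ℂ} (hm : ∀ a b, MemLp (m a b) ∞ volume)
    (y : Fin d → L2C) :
    ∀ᵐ ξ, (fun a => matOp m y a ξ) = matAct (fun a b => m a b ξ) (fun b => y b ξ) := by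
  have h1 : ∀ᵐ ξ, ∀ a b, mulOp (m a b) (y b) ξ = m a b ξ * y b ξ :=
    ae_all_iff.2 fun a => ae_all_iff.2 fun b => coeFn_mulOp (hm a b) (y b)
  have h2 : ∀ᵐ ξ, ∀ a, (∑ b, mulOp (m a b) (y b) : L2C) ξ = ∑ b, mulOp (m a b) (y b) ξ :=
    ae_all_iff.2 fun a => coeFn_sum _ _
  filter_upwards [h1, h2] with ξ h1 h2
  ext a
  rw [matOp_apply, h2, matAct_apply]
  simp only [h1]

theorem coeFn_matOp_pow {m : Fin d → Fin d → ℝ → ℂ} (hm : ∀ a b, MemLp (m a b) ∞ volume)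
    (y : Fin d → L2C) (n : ℕ) :
    ∀ᵐ ξ, (fun a => (matOp m ^ n) y a ξ) =
      (matAct (fun a b => m a b ξ) ^ n) (fun b => y b ξ) := by
  induction n with
  | zero => simp
  | succ n ih =>
    filter_upwards [ih, coeFn_matOp hm ((matOp m ^ n) y)] with ξ h1 h2
    rw [pow_succ', pow_succ']
    exact h2.trans (congrArg _ h1)

/-- Powers of a matrix of multipliers act frequency by frequency, hence so do the partial sums of
the exponential series. Their L² limit is then identified with the pointwise limit. -/
theorem coeFn_exp_matOp {m : Fin d → Fin d → ℝ → ℂ} (hm : ∀ a b, MemLp (m a b) ∞ volume)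
    (y : Fin d → L2C) (t : ℝ) :
    ∀ᵐ ξ, (fun a => NormedSpace.exp (t • matOp m) y a ξ) =
      NormedSpace.exp (t • matAct (fun a b => m a b ξ)) (fun b => y b ξ) := by
  let c : ℕ → ℂ := fun n => (n.factorial : ℂ)⁻¹ * (t : ℂ) ^ n
  have key : ∀ {E : Type} [NormedAddCommGroup E] [NormedSpace ℂ E] [CompleteSpace E]
      (T : E →L[ℂ] E) (x : E), Tendsto (fun N => ∑ n ∈ Finset.range N, c n • (T ^ n) x) atTop
        (𝓝 (NormedSpace.exp (t • T) x)) := by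
    intro E _ _ _ T x
    have h1 := (NormedSpace.exp_series_hasSum_exp' (𝕂 := ℂ) (t • T)).tendsto_sum_nat
    have h2 := ((ContinuousLinearMap.apply ℂ E x).continuous.tendsto _).comp h1
    refine (h2.congr fun N => ?_)
    simp only [Function.comp_apply, ContinuousLinearMap.apply_apply,
      _root_.sum_apply, _root_.smul_apply]
    refine Finset.sum_congr rfl fun n _ => ?_
    rw [smul_pow, _root_.smul_apply, ← Complex.coe_smul, smul_smul]
    simp [c]
  rw [← eventually_congr (.of_forall fun _ => funext_iff.symm)]
  refine ae_all_iff.2 fun a => ?_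
  have hL : Tendsto (fun N => (∑ n ∈ Finset.range N, c n • (matOp m ^ n) y) a) atTop
      (𝓝 (NormedSpace.exp (t • matOp m) y a)) := ((continuous_apply a).tendsto _).comp (key _ _)
  -- Convergence in L² gives almost everywhere convergence only along a subsequence. This suffices,
  -- as the exponential series at each fixed frequency converges in full.
  obtain ⟨ns, hns, hae⟩ := (tendstoInMeasure_of_tendsto_Lp hL).exists_seq_tendsto_ae
  have hsum : ∀ᵐ ξ, ∀ N, ((∑ n ∈ Finset.range N, c n • (matOp m ^ n) y) a : L2C) ξ =
      (∑ n ∈ Finset.range N, c n • (matAct (fun a b => m a b ξ) ^ n) (fun b => y b ξ)) a := by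
    refine ae_all_iff.2 fun N => ?_
    have h1 : ∀ᵐ ξ, ∀ n, (fun a => (matOp m ^ n) y a ξ) =
      (matAct (fun a b => m a b ξ) ^ n) (fun b => y b ξ) := ae_all_iff.2 (coeFn_matOp_pow hm y)
    have h2 : ∀ᵐ ξ, ∀ n, (c n • (matOp m ^ n) y a : L2C) ξ = c n * (matOp m ^ n) y a ξ := by
      refine ae_all_iff.2 fun n => ?_
      filter_upwards [Lp.coeFn_smul (c n) ((matOp m ^ n) y a)] with ξ h
      simpa using h
    filter_upwards [h1, h2, coeFn_sum (Finset.range N) (fun n => c n • (matOp m ^ n) y a)]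
      with ξ h1 h2 h3
    simp only [Finset.sum_apply, Pi.smul_apply]
    rw [h3]
    refine Finset.sum_congr rfl fun n _ => ?_
    rw [h2, smul_eq_mul]
    exact congrArg _ (congrFun (h1 n) a)
  filter_upwards [hae, hsum] with ξ h1 h2
  refine tendsto_nhds_unique h1 ?_
  simp only [h2]
  exact ((continuous_apply a).tendsto _).comp ((key _ _).comp hns.tendsto_atTop)

end

end Bresse

namespace Bresse

noncomputable section

open scoped FourierTransform SchwartzMap

/-! ### Constant-coefficient evolution systems -/

variable {d : ℕ}

/-- Coefficients of the system `V_t = A₀ V + A₁ V_x + A₂ V_xx`. -/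
structure Pencil (d : ℕ) where
  A₀ : Fin d → Fin d → ℝ
  A₁ : Fin d → Fin d → ℝ
  A₂ : Fin d → Fin d → ℝ

/-- The Fourier symbol of the system. -/
def Pencil.symbol (A : Pencil d) (ξ : ℝ) (a b : Fin d) : ℂ :=
  A.A₀ a b + A.A₁ a b * dsym ξ + A.A₂ a b * dsym ξ ^ 2

/-- Weak solutions of `V_t = A₀ V + A₁ V_x + A₂ V_xx` on `[0,∞)`. -/
def Pencil.IsWeakSolution (A : Pencil d) (V : ℝ → ℝ → EuclideanSpace ℝ (Fin d)) : Prop :=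
  ∀ (a : Fin d) (χ : ℝ → ℝ), IsTest χ → ∀ t : ℝ, 0 ≤ t →
    HasDerivWithinAt (fun τ => ∫ x, V τ x a * χ x)
      (∑ b, (A.A₀ a b * (∫ x, V t x b * χ x) - A.A₁ a b * (∫ x, V t x b * deriv χ x)
        + A.A₂ a b * (∫ x, V t x b * iteratedDeriv 2 χ x))) (Ici 0) t

theorem memLp_apply {f : ℝ → EuclideanSpace ℝ (Fin d)} {p : ℝ≥0∞} (hf : MemLp f p volume)
    (a : Fin d) : MemLp (fun x => f x a) p volume :=
  hf.of_le ((EuclideanSpace.proj (𝕜 := ℝ) a).continuous.comp_aestronglyMeasurable hf.1)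
    (.of_forall fun x => PiLp.norm_apply_le (f x) a)

theorem eLpNorm_apply_le (f : ℝ → EuclideanSpace ℝ (Fin d)) (p : ℝ≥0∞) (a : Fin d) :
    eLpNorm (fun x => f x a) p volume ≤ eLpNorm f p volume :=
  eLpNorm_mono fun x => PiLp.norm_apply_le (f x) a

/-- The Fourier transform of the components of `V(t)`, frozen at time `0` for negative times. -/
def FTV (V : ℝ → ℝ → EuclideanSpace ℝ (Fin d)) (t : ℝ) (a : Fin d) : L2C :=
  FT (fun x => V (max t 0) x a)

/-- The transform is an L² isometry, so continuity of `V` in time carries over; freezing at time 0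
extends it from [0,∞) to the whole line. -/
theorem continuous_FTV {V : ℝ → ℝ → EuclideanSpace ℝ (Fin d)} (hV : IsContinuousL2 V)
    (a : Fin d) : Continuous (fun t => FTV V t a) := by
  have hc : ContinuousOn (fun t => FT (fun x => V t x a)) (Ici 0) := by
    intro t ht
    rw [ContinuousWithinAt, tendsto_iff_edist_tendsto_0]
    refine tendsto_of_tendsto_of_tendsto_of_le_of_le' tendsto_const_nhds (hV.2 t ht)
      (.of_forall fun _ => bot_le) ?_
    filter_upwards [self_mem_nhdsWithin] with τ hτ
    rw [edist_eq_enorm_sub, ← FT_sub (memLp_apply (hV.1 τ hτ) a) (memLp_apply (hV.1 t ht) a),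
      enorm_FT ((memLp_apply (hV.1 τ hτ) a).sub (memLp_apply (hV.1 t ht) a))]
    exact eLpNorm_apply_le (V τ - V t) 2 a
  exact hc.comp_continuous (continuous_id.max continuous_const) fun t => mem_Ici.2 (le_max_right _ _)

/-- Pairing with a test function on the Fourier side, as a continuous functional. -/
def IsTest.pair {χ : ℝ → ℝ} (h : IsTest χ) : L2C →L[ℂ] ℂ :=
  innerSL ℂ ((𝓕 h.schwartz).toLp 2)

theorem IsTest.pair_apply {χ : ℝ → ℝ} (h : IsTest χ) (G : L2C) :
    h.pair G = ∫ ξ, h.inv ξ * G ξ := by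
  rw [IsTest.pair, innerSL_apply_apply, L2.inner_def]
  refine integral_congr_ae ?_
  filter_upwards [(𝓕 h.schwartz).coeFn_toLp 2] with x hx
  rw [hx, ← h.conj_fourier]
  simp [mul_comm]

theorem IsTest.sub {χ η : ℝ → ℝ} (h : IsTest χ) (h' : IsTest η) :
    IsTest (fun x => χ x - η x) := ⟨h.1.sub h'.1, h.2.sub h'.2⟩

theorem IsTest.inv_sub {χ η : ℝ → ℝ} (h : IsTest χ) (h' : IsTest η) (ξ : ℝ) :
    (h.sub h').inv ξ = h.inv ξ - h'.inv ξ := by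
  have : (h.sub h').schwartz = h.schwartz - h'.schwartz := by
    ext x; simp
  rw [IsTest.inv, IsTest.inv, IsTest.inv, this]
  have := map_sub (FourierTransform.fourierInvCLM ℂ 𝓢(ℝ, ℂ)) h.schwartz h'.schwartz
  rw [FourierTransform.fourierInvCLM_apply] at this
  rw [this]
  rfl

/-! ### Reduction to bounded multipliers by an elliptic weight -/

/-- The weight `1 / (1 + 4π²ξ²)`. -/
def wgt (ξ : ℝ) : ℂ := (1 - dsym ξ ^ 2)⁻¹

theorem one_sub_dsym_sq (ξ : ℝ) :
    (1 : ℂ) - dsym ξ ^ 2 = ((1 + (2 * Real.pi * ξ) ^ 2 : ℝ) : ℂ) := by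
  simp only [dsym, mul_pow, Complex.I_sq]; push_cast; ring

theorem one_sub_dsym_sq_ne (ξ : ℝ) : (1 : ℂ) - dsym ξ ^ 2 ≠ 0 := by
  rw [one_sub_dsym_sq]; exact_mod_cast (by positivity)

theorem continuous_wgt : Continuous wgt :=
  (continuous_const.sub (continuous_dsym.pow 2)).inv₀ one_sub_dsym_sq_ne

theorem norm_wgt_mul_dsym_pow_le (n : ℕ) (hn : n ≤ 2) (ξ : ℝ) : ‖wgt ξ * dsym ξ ^ n‖ ≤ 1 := by
  rw [wgt, one_sub_dsym_sq, norm_mul, norm_inv, norm_pow, norm_dsym, Complex.norm_real,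
    Real.norm_eq_abs, abs_of_pos (by positivity), inv_mul_le_iff₀ (by positivity), mul_one]
  have h : (2 * Real.pi * |ξ|) ^ 2 = (2 * Real.pi * ξ) ^ 2 := by
    rw [mul_pow, mul_pow, sq_abs]; ring
  have h0 : 0 ≤ 2 * Real.pi * |ξ| := by positivity
  rw [← h]
  generalize 2 * Real.pi * |ξ| = r at h0
  interval_cases n
  · nlinarith
  · nlinarith
  · nlinarith

theorem memLp_wgt_mul (n : ℕ) (hn : n ≤ 2) : MemLp (fun ξ => wgt ξ * dsym ξ ^ n) ∞ volume :=
  memLp_top_of_bound (continuous_wgt.mul (continuous_dsym.pow n)).aestronglyMeasurable 1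
    (.of_forall (norm_wgt_mul_dsym_pow_le n hn))

theorem memLp_wgt : MemLp wgt ∞ volume := by simpa using memLp_wgt_mul 0 (by norm_num)

/-- The symbol is a polynomial of degree at most 2 in ξ, so division by 1 + 4π²ξ² makes it a bounded
multiplier. -/
theorem memLp_wgt_symbol (A : Pencil d) (a b : Fin d) :
    MemLp (fun ξ => wgt ξ * A.symbol ξ a b) ∞ volume := by
  have := (((memLp_wgt_mul 0 (by norm_num)).const_mul (A.A₀ a b : ℂ)).add
    ((memLp_wgt_mul 1 (by norm_num)).const_mul (A.A₁ a b : ℂ))).add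
    ((memLp_wgt_mul 2 le_rfl).const_mul (A.A₂ a b : ℂ))
  refine this.congr_norm
    ((continuous_wgt.mul ?_).aestronglyMeasurable) (.of_forall fun ξ => ?_)
  · unfold Pencil.symbol
    have := continuous_dsym
    fun_prop
  · simp only [Pi.add_apply, Pencil.symbol]
    congr 1
    ring

/-- The test function `χ - χ''`. -/
theorem IsTest.elliptic {χ : ℝ → ℝ} (h : IsTest χ) :
    IsTest (fun x => χ x - _root_.iteratedDeriv 2 χ x) := h.sub (h.iteratedDeriv 2)

theorem IsTest.inv_elliptic {χ : ℝ → ℝ} (h : IsTest χ) (ξ : ℝ) :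
    h.elliptic.inv ξ = h.inv ξ * (1 - dsym ξ ^ 2) := by
  have := h.inv_mul_dsym_pow 2 ξ
  simp only [even_two, Even.neg_pow, one_pow, one_mul] at this
  rw [mul_sub, this, mul_one]
  exact h.inv_sub (h.iteratedDeriv 2) ξ

theorem eq_zero_of_pair_elliptic {h : L2C}
    (hz : ∀ (χ : ℝ → ℝ) (hχ : IsTest χ), hχ.elliptic.pair h = 0) : h = 0 := by
  have := ae_eq_zero_of_test (q := fun ξ => (1 - dsym ξ ^ 2) * h ξ)
    (fun χ hχ => by
      refine (integrable_inv_mul hχ.elliptic (Lp.memLp h)).congr (.of_forall fun ξ => ?_)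
      simp only [hχ.inv_elliptic, mul_assoc])
    (fun χ hχ => by
      rw [← hz χ hχ, IsTest.pair_apply]
      simp only [hχ.inv_elliptic, mul_assoc])
  refine Lp.ext ?_
  filter_upwards [this, Lp.coeFn_zero ℂ 2 (volume : Measure ℝ)] with ξ h1 h2
  rw [h2]
  exact (mul_eq_zero.1 h1).resolve_left (one_sub_dsym_sq_ne ξ)

/-- Testing with χ - χ'' multiplies the inverse transform of χ by `1 - dsym ξ ^ 2`, which cancels
the weight. In this way the weighted L² identity is read off from the weak formulation with χ. -/
theorem pair_elliptic_mulOp {χ : ℝ → ℝ} (hχ : IsTest χ) {m : ℝ → ℂ}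
    (hm : MemLp (fun ξ => wgt ξ * m ξ) ∞ volume) (G : L2C) :
    hχ.elliptic.pair (mulOp (fun ξ => wgt ξ * m ξ) G) = ∫ ξ, hχ.inv ξ * (m ξ * G ξ) := by
  rw [IsTest.pair_apply]
  refine integral_congr_ae ?_
  filter_upwards [coeFn_mulOp hm G] with ξ h
  rw [h, hχ.inv_elliptic, wgt]
  have := one_sub_dsym_sq_ne ξ
  field_simp

theorem pair_elliptic_mulOp_symbol {χ : ℝ → ℝ} (hχ : IsTest χ) (A : Pencil d) (a b : Fin d)
    {f : ℝ → ℝ} (hf : MemLp f 2 volume) :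
    hχ.elliptic.pair (mulOp (fun ξ => wgt ξ * A.symbol ξ a b) (FT f)) =
      ((A.A₀ a b * (∫ x, f x * χ x) - A.A₁ a b * (∫ x, f x * deriv χ x)
        + A.A₂ a b * (∫ x, f x * iteratedDeriv 2 χ x) : ℝ) : ℂ) := by
  rw [pair_elliptic_mulOp hχ (memLp_wgt_symbol A a b)]
  have e0 := integral_inv_mul_dsym_pow hf hχ 0
  have e1 := integral_inv_mul_dsym_pow hf hχ 1
  have e2 := integral_inv_mul_dsym_pow hf hχ 2
  have i0 := integrable_inv_mul_dsym_pow (FT f) hχ 0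
  have i1 := integrable_inv_mul_dsym_pow (FT f) hχ 1
  have i2 := integrable_inv_mul_dsym_pow (FT f) hχ 2
  have : ∀ ξ, hχ.inv ξ * (A.symbol ξ a b * FT f ξ) =
      (A.A₀ a b : ℂ) * (hχ.inv ξ * (dsym ξ ^ 0 * FT f ξ)) +
      (A.A₁ a b : ℂ) * (hχ.inv ξ * (dsym ξ ^ 1 * FT f ξ)) +
      (A.A₂ a b : ℂ) * (hχ.inv ξ * (dsym ξ ^ 2 * FT f ξ)) := fun ξ => by
    rw [Pencil.symbol]; ring
  simp only [this]
  have i01 : Integrable fun ξ => (A.A₀ a b : ℂ) * (hχ.inv ξ * (dsym ξ ^ 0 * FT f ξ)) +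
      (A.A₁ a b : ℂ) * (hχ.inv ξ * (dsym ξ ^ 1 * FT f ξ)) :=
    (i0.const_mul _).add (i1.const_mul _)
  rw [integral_add i01 (i2.const_mul _),
    integral_add (i0.const_mul _) (i1.const_mul _), integral_const_mul, integral_const_mul,
    integral_const_mul, e0, e1, e2]
  simp only [iteratedDeriv_zero, iteratedDeriv_one]
  push_cast
  ring

/-- The weak equation as an integral equation in L². The unweighted right side need not be in L², so
both sides carry the weight. The identity is checked by pairing with χ - χ'', where it is the
fundamental theorem of calculus for the tested equation. -/
theorem mulOp_wgt_FTV {A : Pencil d} {V : ℝ → ℝ → EuclideanSpace ℝ (Fin d)}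
    (hV : IsContinuousL2 V) (hA : A.IsWeakSolution V) (a : Fin d) {t : ℝ} (ht : 0 ≤ t) :
    mulOp wgt (FTV V t a) = mulOp wgt (FTV V 0 a) +
      ∫ s in (0 : ℝ)..t, ∑ b, mulOp (fun ξ => wgt ξ * A.symbol ξ a b) (FTV V s b) := by
  have hcont : Continuous fun s => ∑ b, mulOp (fun ξ => wgt ξ * A.symbol ξ a b) (FTV V s b) :=
    continuous_finsetSum _ fun b _ => (ContinuousLinearMap.continuous _).comp
      (continuous_FTV hV b)
  rw [← sub_eq_zero]
  refine eq_zero_of_pair_elliptic fun χ hχ => ?_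
  rw [map_sub, map_add, ← ContinuousLinearMap.intervalIntegral_comp_comm _
    (hcont.intervalIntegrable _ _)]
  have hw : (fun ξ => wgt ξ * 1) = wgt := by ext; simp
  have hp : ∀ s, 0 ≤ s → hχ.elliptic.pair (mulOp wgt (FTV V s a)) =
      ((∫ x, V s x a * χ x : ℝ) : ℂ) := fun s hs => by
    have := pair_elliptic_mulOp hχ (m := fun _ => 1) (by rw [hw]; exact memLp_wgt) (FTV V s a)
    rw [hw] at this
    rw [this, FTV, max_eq_left hs, integral_mul_test (memLp_apply (hV.1 s hs) a) hχ]
    simp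
  have hder : ∀ s, 0 ≤ s → HasDerivWithinAt
      (fun τ => hχ.elliptic.pair (mulOp wgt (FTV V τ a)))
      (hχ.elliptic.pair (∑ b, mulOp (fun ξ => wgt ξ * A.symbol ξ a b) (FTV V s b))) (Ici 0) s := by
    intro s hs
    have h1 := (hA a χ hχ s hs).ofReal_comp
    have h2 := h1.congr (fun τ hτ => hp τ hτ) (hp s hs)
    refine h2.congr_deriv ?_
    rw [map_sum]
    push_cast
    refine Finset.sum_congr rfl fun b _ => ?_
    rw [FTV, max_eq_left hs, pair_elliptic_mulOp_symbol hχ A a b (memLp_apply (hV.1 s hs) b)]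
    push_cast
    rfl
  rw [intervalIntegral.integral_eq_sub_of_hasDeriv_right_of_le ht
    (fun s hs => ((hder s hs.1).continuousWithinAt.mono Icc_subset_Ici_self))
    (fun s hs => (hder s hs.1.le).mono fun x hx => hs.1.le.trans (le_of_lt hx))
    ((hχ.elliptic.pair.continuous.comp hcont).intervalIntegrable _ _)]
  ring

/-! ### Frequency truncation and the exponential formula -/

/-- The symbol, cut off to frequencies in `[-R, R]`. -/
def Pencil.cutSymbol (A : Pencil d) (R : ℝ) (a b : Fin d) (ξ : ℝ) : ℂ :=
  (Icc (-R) R).indicator (fun ξ => A.symbol ξ a b) ξ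

theorem continuous_symbol (A : Pencil d) (a b : Fin d) : Continuous fun ξ => A.symbol ξ a b := by
  unfold Pencil.symbol
  have := continuous_dsym
  fun_prop

theorem memLp_indicator_of_continuous {m : ℝ → ℂ} (hm : Continuous m) (R : ℝ) :
    MemLp ((Icc (-R) R).indicator m) ∞ volume := by
  obtain ⟨C, hC⟩ := isCompact_Icc.exists_bound_of_continuousOn (hm.continuousOn (s := Icc (-R) R))
  refine memLp_top_of_bound (hm.aestronglyMeasurable.indicator measurableSet_Icc) (max C 0)
    (.of_forall fun ξ => ?_)
  by_cases h : ξ ∈ Icc (-R) R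
  · rw [indicator_of_mem h]; exact (hC ξ h).trans (le_max_left _ _)
  · rw [indicator_of_notMem h, norm_zero]; exact le_max_right _ _

/-- The sharp frequency cut-off. -/
def cut (R : ℝ) : ℝ → ℂ := (Icc (-R) R).indicator 1

theorem memLp_cut (R : ℝ) : MemLp (cut R) ∞ volume :=
  memLp_indicator_of_continuous continuous_one R

theorem memLp_cutSymbol (A : Pencil d) (R : ℝ) (a b : Fin d) :
    MemLp (A.cutSymbol R a b) ∞ volume :=
  memLp_indicator_of_continuous (continuous_symbol A a b) R

/-- The frequency-truncated solution. -/
def cutFTV (V : ℝ → ℝ → EuclideanSpace ℝ (Fin d)) (R t : ℝ) (a : Fin d) : L2C :=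
  mulOp (cut R) (FTV V t a)

theorem continuous_cutFTV {V : ℝ → ℝ → EuclideanSpace ℝ (Fin d)} (hV : IsContinuousL2 V)
    (R : ℝ) : Continuous (cutFTV V R) :=
  continuous_pi fun a => (ContinuousLinearMap.continuous _).comp (continuous_FTV hV a)

theorem cutFTV_eq {A : Pencil d} {V : ℝ → ℝ → EuclideanSpace ℝ (Fin d)}
    (hV : IsContinuousL2 V) (hA : A.IsWeakSolution V) (R : ℝ) {t : ℝ} (ht : 0 ≤ t) :
    cutFTV V R t = cutFTV V R 0 + ∫ s in (0 : ℝ)..t, matOp (A.cutSymbol R) (cutFTV V R s) := by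
  have hcont : ∀ a, Continuous
      fun s => ∑ b, mulOp (fun ξ => wgt ξ * A.symbol ξ a b) (FTV V s b) := fun a =>
    continuous_finsetSum _ fun b _ => (ContinuousLinearMap.continuous _).comp
      (continuous_FTV hV b)
  have hcont' : Continuous fun s => matOp (A.cutSymbol R) (cutFTV V R s) :=
    (ContinuousLinearMap.continuous _).comp (continuous_cutFTV hV R)
  -- On the window [-R, R] the function `w` inverts the weight, and it is bounded there. Applying it
  -- to the weighted equation leaves an evolution equation with a bounded generator.
  let w : ℝ → ℂ := (Icc (-R) R).indicator (fun ξ => 1 - dsym ξ ^ 2)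
  have hw : MemLp w ∞ volume :=
    memLp_indicator_of_continuous (continuous_const.sub (continuous_dsym.pow 2)) R
  ext1 a
  have h := congrArg (mulOp w) (mulOp_wgt_FTV hV hA a ht)
  have h1 : ∀ G, mulOp w (mulOp wgt G) = mulOp (cut R) G := fun G => by
    refine mulOp_mulOp hw memLp_wgt (memLp_cut R) (fun ξ => ?_) G
    by_cases hξ : ξ ∈ Icc (-R) R
    · simp only [w, cut, indicator_of_mem hξ, wgt, Pi.one_apply]
      exact mul_inv_cancel₀ (one_sub_dsym_sq_ne ξ)
    · simp only [w, cut, indicator_of_notMem hξ, zero_mul]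
  have h2 : ∀ b G, mulOp w (mulOp (fun ξ => wgt ξ * A.symbol ξ a b) G) =
      mulOp (A.cutSymbol R a b) (mulOp (cut R) G) := fun b G => by
    rw [mulOp_mulOp (memLp_cutSymbol A R a b) (memLp_cut R) (memLp_cutSymbol A R a b)]
    · refine mulOp_mulOp hw (memLp_wgt_symbol A a b) (memLp_cutSymbol A R a b) (fun ξ => ?_) G
      by_cases hξ : ξ ∈ Icc (-R) R
      · simp only [w, Pencil.cutSymbol, indicator_of_mem hξ, wgt]
        exact mul_inv_cancel_left₀ (one_sub_dsym_sq_ne ξ) _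
      · simp only [w, Pencil.cutSymbol, indicator_of_notMem hξ, zero_mul]
    · intro ξ
      by_cases hξ : ξ ∈ Icc (-R) R
      · simp [Pencil.cutSymbol, cut, indicator_of_mem hξ]
      · simp [Pencil.cutSymbol, indicator_of_notMem hξ]
  rw [map_add, h1, h1, ← ContinuousLinearMap.intervalIntegral_comp_comm _
    ((hcont a).intervalIntegrable _ _)] at h
  have h3 := ContinuousLinearMap.intervalIntegral_comp_comm
    (ContinuousLinearMap.proj (R := ℂ) (φ := fun _ : Fin d => L2C) a)
    (hcont'.intervalIntegrable (μ := volume) 0 t)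
  simp only [ContinuousLinearMap.proj_apply] at h3
  rw [Pi.add_apply, ← h3]
  refine h.trans (congrArg _ (intervalIntegral.integral_congr fun s _ => ?_))
  simp only [map_sum, h2, matOp_apply]
  rfl

/-- The truncated equation is a linear ODE in a Banach space with a Lipschitz vector field, so its
solution is unique. Right derivatives are used because the integral equation is known only for
nonnegative times. -/
theorem cutFTV_eq_exp {A : Pencil d} {V : ℝ → ℝ → EuclideanSpace ℝ (Fin d)}
    (hV : IsContinuousL2 V) (hA : A.IsWeakSolution V) (R : ℝ) {t : ℝ} (ht : 0 ≤ t) :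
    cutFTV V R t = NormedSpace.exp (t • matOp (A.cutSymbol R)) (cutFTV V R 0) := by
  set T := matOp (A.cutSymbol R)
  have hcont' : Continuous fun s => T (cutFTV V R s) :=
    (ContinuousLinearMap.continuous _).comp (continuous_cutFTV hV R)
  have h1 : ∀ s ∈ Ico (0 : ℝ) t, HasDerivWithinAt (cutFTV V R) (T (cutFTV V R s)) (Ici s) s := by
    intro s hs
    have h0 := ((hcont'.integral_hasStrictDerivAt 0 s).hasDerivAt.const_add
      (cutFTV V R 0)).hasDerivWithinAt (s := Ici s)
    exact h0.congr (fun τ hτ => cutFTV_eq hV hA R (hs.1.trans hτ)) (cutFTV_eq hV hA R hs.1)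
  have h2 : ∀ s, HasDerivAt (fun s : ℝ => NormedSpace.exp (s • T) (cutFTV V R 0))
      (T (NormedSpace.exp (s • T) (cutFTV V R 0))) s := by
    intro s
    exact (((ContinuousLinearMap.apply ℂ (Fin d → L2C) (cutFTV V R 0)).restrictScalars
      ℝ).hasFDerivAt.comp_hasDerivAt s (hasDerivAt_exp_smul_const' T s))
  have := ODE_solution_unique (v := fun _ => T) (K := ‖T‖₊) (a := 0) (b := t)
    (fun _ => T.lipschitz) (continuous_cutFTV hV R).continuousOn h1
    (fun s _ => (h2 s).continuousAt.continuousWithinAt) (fun s _ => (h2 s).hasDerivWithinAt)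
    (by rw [zero_smul, NormedSpace.exp_zero]; rfl)
  exact this ⟨ht, le_rfl⟩

/-- Weak solutions are given by the exponential of the symbol on the Fourier side. -/
theorem FTV_eq_exp {A : Pencil d} {V : ℝ → ℝ → EuclideanSpace ℝ (Fin d)}
    (hV : IsContinuousL2 V) (hA : A.IsWeakSolution V) {t : ℝ} (ht : 0 ≤ t) :
    ∀ᵐ ξ, (fun a => FTV V t a ξ) =
      NormedSpace.exp (t • matAct (A.symbol ξ)) (fun a => FTV V 0 a ξ) := by
  have h : ∀ᵐ ξ, ∀ n : ℕ, (fun a => cutFTV V n t a ξ) =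
      NormedSpace.exp (t • matAct (fun a b => A.cutSymbol n a b ξ)) (fun a => cutFTV V n 0 a ξ) :=
    ae_all_iff.2 fun n => by
      rw [cutFTV_eq_exp hV hA n ht]
      exact coeFn_exp_matOp (memLp_cutSymbol A n) _ _
  have hc : ∀ s, ∀ᵐ ξ, ∀ n : ℕ, ∀ a, cutFTV V n s a ξ = cut n ξ * FTV V s a ξ := fun s =>
    ae_all_iff.2 fun n => ae_all_iff.2 fun a => coeFn_mulOp (memLp_cut n) _
  filter_upwards [h, hc t, hc 0] with ξ h ht h0
  -- Almost every frequency satisfies the formulas for all integer windows; a window containing ξ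
  -- makes both cut-offs disappear at ξ.
  obtain ⟨n, hn⟩ := exists_nat_ge |ξ|
  have hmem : ξ ∈ Icc (-(n : ℝ)) n := abs_le.1 hn
  have := h n
  simp only [ht, h0, cut, Pencil.cutSymbol, indicator_of_mem hmem, Pi.one_apply, one_mul] at this
  exact this

end

end Bresse

namespace Bresse

noncomputable section

/-! ### Elementary estimates for the decay rate `ξ⁴ / (1 + ξ²)⁴` -/

/-- The decay rate at frequency `ξ`. -/
def rate (ξ : ℝ) : ℝ := ξ ^ 4 / (1 + ξ ^ 2) ^ 4

theorem rate_nonneg (ξ : ℝ) : 0 ≤ rate ξ := by unfold rate; positivity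

theorem rate_low {ξ : ℝ} (h : |ξ| ≤ 1) : |ξ| ^ 4 / 16 ≤ rate ξ := by
  have h2 : ξ ^ 2 ≤ 1 := by rw [← sq_abs]; exact pow_le_one₀ (abs_nonneg _) h
  have e : |ξ| ^ 4 = ξ ^ 4 := Even.pow_abs ⟨2, rfl⟩ ξ
  rw [rate, e]
  have h4 : (1 + ξ ^ 2) ^ 4 ≤ 16 := by
    calc (1 + ξ ^ 2) ^ 4 ≤ 2 ^ 4 := by gcongr; linarith
      _ = 16 := by norm_num
  gcongr

theorem rate_high {ξ : ℝ} (h : 1 ≤ |ξ|) : 1 / (16 * ξ ^ 4) ≤ rate ξ := by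
  have h2 : 1 ≤ ξ ^ 2 := by rw [← sq_abs]; exact one_le_pow₀ h
  have h0 : 0 < ξ ^ 4 := by nlinarith
  rw [rate, div_le_div_iff₀ (by positivity) (by positivity), one_mul]
  calc (1 + ξ ^ 2) ^ 4 ≤ (2 * ξ ^ 2) ^ 4 := by gcongr; linarith
    _ = ξ ^ 4 * (16 * ξ ^ 4) := by ring

/-- One term of the exponential series bounds v²ⁿ by a multiple of exp(bv²), and vⁿ ≤ 1 + v²ⁿ. -/
theorem exists_pow_le_exp {b : ℝ} (hb : 0 < b) (n : ℕ) :
    ∃ C > 0, ∀ v : ℝ, 0 ≤ v → v ^ n * Real.exp (-(b * v ^ 2)) ≤ C := by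
  refine ⟨1 + n.factorial / b ^ n, by positivity, fun v hv => ?_⟩
  have h1 := Real.pow_div_factorial_le_exp (x := b * v ^ 2) (by positivity) n
  have h2 : v ^ n ≤ 1 + v ^ (2 * n) := by
    rw [mul_comm, pow_mul]; nlinarith [sq_nonneg (v ^ n - 1)]
  rw [Real.exp_neg, ← div_eq_mul_inv, div_le_iff₀ (Real.exp_pos _)]
  have h3 : v ^ (2 * n) ≤ n.factorial / b ^ n * Real.exp (b * v ^ 2) := by
    rw [div_mul_eq_mul_div, le_div_iff₀ (by positivity)]
    rw [div_le_iff₀ (by positivity), mul_pow, ← pow_mul] at h1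
    linarith
  have h4 : 1 ≤ Real.exp (b * v ^ 2) := Real.one_le_exp (by positivity)
  nlinarith

/-- For |ξ| ≥ 1 the rate is at least 1/(16ξ⁴), so the exponential is essentially a Gaussian in v =
√(1+T)/ξ². A Gaussian is bounded by a multiple of v⁻ⁿ: this is the trade of regularity for decay. -/
theorem exists_high_bound {c : ℝ} (hc : 0 < c) (n : ℕ) :
    ∃ C > 0, ∀ ξ T : ℝ, 1 ≤ |ξ| → 0 ≤ T →
      Real.exp (-(c * rate ξ * T)) ≤ C * (1 + T) ^ (-((n : ℝ) / 2)) * |ξ| ^ (2 * n) := by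
  obtain ⟨C, hC, h⟩ := exists_pow_le_exp (b := c / 16) (by positivity) n
  refine ⟨Real.exp (c / 16) * C, by positivity, fun ξ T hξ hT => ?_⟩
  have hξ0 : 0 < |ξ| := one_pos.trans_le hξ
  have hT1 : 0 < 1 + T := by linarith
  have hv := h (√(1 + T) / |ξ| ^ 2) (by positivity)
  rw [div_pow _ _ 2, Real.sq_sqrt hT1.le, ← pow_mul] at hv
  norm_num at hv
  have he : |ξ| ^ 4 = ξ ^ 4 := Even.pow_abs ⟨2, rfl⟩ ξ
  -- The factor `exp (c / 16)` pays for replacing `T` by `1 + T`, as 1/|ξ|⁴ ≤ 1 here.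
  have h1 : Real.exp (-(c * rate ξ * T)) ≤
      Real.exp (c / 16) * Real.exp (-(c / 16 * ((1 + T) / |ξ| ^ 4))) := by
    rw [← Real.exp_add, Real.exp_le_exp]
    have hr := rate_high hξ
    rw [← he] at hr
    have hx : 1 / |ξ| ^ 4 ≤ 1 := by
      rw [div_le_one (by positivity)]; exact one_le_pow₀ hξ
    have e1 : 1 / (16 * |ξ| ^ 4) = (1 / |ξ| ^ 4) / 16 := by
      field_simp
    have e2 : (1 + T) / |ξ| ^ 4 = (1 / |ξ| ^ 4) + (1 / |ξ| ^ 4) * T := by ring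
    rw [e1] at hr
    rw [e2]
    generalize 1 / |ξ| ^ 4 = x at *
    have := mul_le_mul_of_nonneg_left (mul_le_mul_of_nonneg_right hr hT) hc.le
    nlinarith
  rw [he] at h1 hv
  have e3 : (1 + T) ^ (-((n : ℝ) / 2)) = (√(1 + T) ^ n)⁻¹ := by
    rw [Real.rpow_neg hT1.le, Real.sqrt_eq_rpow, ← Real.rpow_natCast, ← Real.rpow_mul hT1.le]
    congr 2; ring
  rw [e3]
  have h2 : Real.exp (-(c / 16 * ((1 + T) / ξ ^ 4))) ≤ C * (√(1 + T) ^ n)⁻¹ * |ξ| ^ (2 * n) := by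
    have hs : 0 < √(1 + T) := Real.sqrt_pos.2 hT1
    have hξ2 : 0 < ξ ^ 2 := by rw [← sq_abs]; positivity
    rw [div_pow, div_mul_eq_mul_div, div_le_iff₀ (by positivity)] at hv
    generalize Real.exp (-(c / 16 * ((1 + T) / ξ ^ 4))) = E at hv ⊢
    rw [← div_eq_mul_inv, div_mul_eq_mul_div, le_div_iff₀ (by positivity), pow_mul, sq_abs]
    linarith
  calc _ ≤ _ := h1
    _ ≤ Real.exp (c / 16) * (C * (√(1 + T) ^ n)⁻¹ * |ξ| ^ (2 * n)) := by gcongr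
    _ = _ := by ring

theorem integral_abs_pow_mul_exp {b : ℝ} (hb : 0 < b) (j : ℕ) :
    Integrable (fun ξ : ℝ => |ξ| ^ (2 * j) * Real.exp (-(b * |ξ| ^ 4))) ∧
    ∫ ξ : ℝ, |ξ| ^ (2 * j) * Real.exp (-(b * |ξ| ^ 4)) =
      b ^ (-(1 / 4 : ℝ) - (j : ℝ) / 2) * (1 / 2 * Real.Gamma ((2 * j + 1) / 4)) := by
  have h1 := integral_rpow_mul_exp_neg_mul_rpow (p := 4) (q := 2 * j) (b := b) (by norm_num)
    (by have : (0 : ℝ) ≤ j := Nat.cast_nonneg j; linarith) hb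
  have h2 : ∫ ξ : ℝ, |ξ| ^ (2 * j) * Real.exp (-(b * |ξ| ^ 4)) =
      b ^ (-(1 / 4 : ℝ) - (j : ℝ) / 2) * (1 / 2 * Real.Gamma ((2 * j + 1) / 4)) := by
    rw [integral_comp_abs (f := fun x => x ^ (2 * j) * Real.exp (-(b * x ^ 4)))]
    have e : ∀ x : ℝ, x ^ (2 * j) * Real.exp (-(b * x ^ 4)) =
        x ^ (2 * (j : ℝ)) * Real.exp (-b * x ^ (4 : ℝ)) := by
      intro x
      have e1 : x ^ (2 * (j : ℝ)) = x ^ (2 * j) := by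
        rw [← Real.rpow_natCast]; push_cast; rfl
      have e2 : x ^ (4 : ℝ) = x ^ 4 := by
        rw [← Real.rpow_natCast]; norm_num
      rw [e1, e2, neg_mul]
    simp only [e]
    rw [h1]
    have : -(2 * (j : ℝ) + 1) / 4 = -(1 / 4 : ℝ) - (j : ℝ) / 2 := by ring
    rw [this]; ring
  refine ⟨?_, h2⟩
  -- A non-integrable function has integral 0 by convention, whereas the Gamma formula gives a
  -- positive value. Integrability thus follows from the formula.
  by_contra hi
  rw [integral_undef hi] at h2
  have : 0 < b ^ (-(1 / 4 : ℝ) - (j : ℝ) / 2) * (1 / 2 * Real.Gamma ((2 * j + 1) / 4)) :=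
    mul_pos (Real.rpow_pos_of_pos hb _) (mul_pos (by norm_num)
      (Real.Gamma_pos_of_pos (by positivity)))
  exact this.ne h2

/-- For |ξ| ≤ 1 the rate is at least ξ⁴/16, and scaling ξ by (1+T)^(1/4) in the resulting integral
over the line produces the exponent 1/4 + j/2. The factor `exp (c / 16)` replaces `T` by `1 + T`. -/
theorem exists_low_bound {c : ℝ} (hc : 0 < c) (j : ℕ) :
    ∃ C > 0, ∀ T : ℝ, 0 ≤ T →
      ∫⁻ ξ in {ξ : ℝ | |ξ| ≤ 1}, ENNReal.ofReal (|ξ| ^ (2 * j) * Real.exp (-(c * rate ξ * T))) ≤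
        ENNReal.ofReal (C * (1 + T) ^ (-(1 / 4 : ℝ) - (j : ℝ) / 2)) := by
  have hG : 0 < Real.Gamma ((2 * (j : ℝ) + 1) / 4) := Real.Gamma_pos_of_pos (by positivity)
  refine ⟨Real.exp (c / 16) * ((c / 16) ^ (-(1 / 4 : ℝ) - (j : ℝ) / 2) *
    (1 / 2 * Real.Gamma ((2 * j + 1) / 4))), by positivity, fun T hT => ?_⟩
  have hT1 : 0 < 1 + T := by linarith
  obtain ⟨hi, he⟩ := integral_abs_pow_mul_exp (b := c / 16 * (1 + T)) (by positivity) j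
  calc _ ≤ ∫⁻ ξ in {ξ : ℝ | |ξ| ≤ 1}, ENNReal.ofReal (Real.exp (c / 16) *
        (|ξ| ^ (2 * j) * Real.exp (-(c / 16 * (1 + T) * |ξ| ^ 4)))) := by
        refine setLIntegral_mono' (measurableSet_le measurable_id.abs measurable_const)
          fun ξ hξ => ?_
        refine ENNReal.ofReal_le_ofReal ?_
        rw [mul_left_comm, ← Real.exp_add]
        gcongr
        have h1 := rate_low hξ
        have h2 : |ξ| ^ 4 ≤ 1 := pow_le_one₀ (abs_nonneg _) hξ
        have := mul_le_mul_of_nonneg_left (mul_le_mul_of_nonneg_right h1 hT) hc.le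
        nlinarith
    _ ≤ ∫⁻ ξ, ENNReal.ofReal (Real.exp (c / 16) *
        (|ξ| ^ (2 * j) * Real.exp (-(c / 16 * (1 + T) * |ξ| ^ 4)))) := setLIntegral_le_lintegral _ _
    _ = ENNReal.ofReal (Real.exp (c / 16) *
        ((c / 16 * (1 + T)) ^ (-(1 / 4 : ℝ) - (j : ℝ) / 2) *
          (1 / 2 * Real.Gamma ((2 * j + 1) / 4)))) := by
        rw [← ofReal_integral_eq_lintegral_ofReal (hi.const_mul _)
          (.of_forall fun ξ => by positivity), integral_const_mul, he]
    _ = _ := by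
        rw [Real.mul_rpow (by positivity) hT1.le]
        congr 1; ring

end

end Bresse

namespace Bresse

noncomputable section

variable {d : ℕ}

/-! ### Weak derivatives of vector functions -/

theorem enorm_sq_eq_sum (x : EuclideanSpace ℝ (Fin d)) : ‖x‖ₑ ^ 2 = ∑ a, ‖x a‖ₑ ^ 2 := by
  simp only [← ofReal_norm, ← ENNReal.ofReal_pow (norm_nonneg _)]
  rw [EuclideanSpace.norm_sq_eq, ENNReal.ofReal_sum_of_nonneg fun _ _ => by positivity]

theorem eLpNorm_two_sq {E : Type*} [NormedAddCommGroup E] (f : ℝ → E) :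
    eLpNorm f 2 volume ^ 2 = ∫⁻ x, ‖f x‖ₑ ^ 2 := by
  have := eLpNorm_nnreal_pow_eq_lintegral (f := f) (μ := volume) (p := 2) (by norm_num)
  simpa using this

theorem eLpNorm_two_sq_eq_sum {f : ℝ → EuclideanSpace ℝ (Fin d)} (hf : MemLp f 2 volume) :
    eLpNorm f 2 volume ^ 2 = ∑ a, ‖FT (fun x => f x a)‖ₑ ^ 2 := by
  rw [eLpNorm_two_sq]
  simp only [enorm_sq_eq_sum]
  rw [lintegral_finsetSum' _ fun a _ => ((memLp_apply hf a).1.enorm.pow_const 2)]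
  refine Finset.sum_congr rfl fun a _ => ?_
  rw [enorm_FT (memLp_apply hf a), eLpNorm_two_sq]

theorem enorm_L2C_sq (G : L2C) : ‖G‖ₑ ^ 2 = ∫⁻ ξ, ‖G ξ‖ₑ ^ 2 := by
  rw [Lp.enorm_def, eLpNorm_two_sq]

theorem IsTest.integrable_smul {χ : ℝ → ℝ} (h : IsTest χ) {E : Type*} [NormedAddCommGroup E]
    [NormedSpace ℝ E] {f : ℝ → E} (hf : LocallyIntegrable f volume) :
    Integrable (fun x => χ x • f x) :=
  hf.integrable_smul_left_of_hasCompactSupport h.continuous h.2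

theorem integral_smul_apply {χ : ℝ → ℝ} (h : IsTest χ) {f : ℝ → EuclideanSpace ℝ (Fin d)}
    (hf : LocallyIntegrable f volume) (a : Fin d) :
    (∫ x, χ x • f x) a = ∫ x, χ x * f x a := by
  have := ContinuousLinearMap.integral_comp_comm (EuclideanSpace.proj (𝕜 := ℝ) a)
    (h.integrable_smul hf)
  simpa using this.symm

theorem hasWeakDeriv_iff {n : ℕ} {f g : ℝ → EuclideanSpace ℝ (Fin d)}
    (hf : LocallyIntegrable f volume) (hg : LocallyIntegrable g volume) :
    HasWeakDeriv n f g ↔ ∀ (a : Fin d) (χ : ℝ → ℝ), IsTest χ →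
      ∫ x, iteratedDeriv n χ x * f x a = (-1 : ℝ) ^ n * ∫ x, χ x * g x a := by
  constructor
  · rintro ⟨-, -, h⟩ a χ hχ
    have := congrArg (fun v : EuclideanSpace ℝ (Fin d) => v a) (h χ hχ)
    simpa only [PiLp.smul_apply, integral_smul_apply (hχ.iteratedDeriv n) hf,
      integral_smul_apply hχ hg, smul_eq_mul] using this
  · refine fun h => ⟨hf, hg, fun χ hχ => ?_⟩
    ext a
    simpa only [PiLp.smul_apply, integral_smul_apply (hχ.iteratedDeriv n) hf,
      integral_smul_apply hχ hg, smul_eq_mul] using h a χ hχ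

theorem HasWeakDeriv.unique {E : Type*} [NormedAddCommGroup E] [NormedSpace ℝ E]
    [CompleteSpace E] {n : ℕ} {f g g' : ℝ → E}
    (h : HasWeakDeriv n f g) (h' : HasWeakDeriv n f g') : g =ᵐ[volume] g' := by
  refine ae_eq_of_integral_contDiff_smul_eq h.2.1 h'.2.1 fun χ h1 h2 => ?_
  have := (h.2.2 χ ⟨h1, h2⟩).symm.trans (h'.2.2 χ ⟨h1, h2⟩)
  exact smul_right_injective E (pow_ne_zero n (by norm_num : (-1 : ℝ) ≠ 0)) this

/-- Plancherel, component by component. -/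
theorem eLpNorm_weak_deriv {n : ℕ} {f g : ℝ → EuclideanSpace ℝ (Fin d)} (hf : MemLp f 2 volume)
    (hg : MemLp g 2 volume) (h : HasWeakDeriv n f g) :
    eLpNorm g 2 volume ^ 2 =
      ∫⁻ ξ, ‖dsym ξ‖ₑ ^ (2 * n) * ∑ a, ‖FT (fun x => f x a) ξ‖ₑ ^ 2 := by
  rw [eLpNorm_two_sq_eq_sum hg]
  simp only [Finset.mul_sum]
  rw [lintegral_finsetSum' _ fun a _ => ?_]
  · refine Finset.sum_congr rfl fun a _ => ?_
    rw [enorm_L2C_sq]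
    refine lintegral_congr_ae ?_
    filter_upwards [FT_of_weak_deriv (memLp_apply hf a) (memLp_apply hg a)
      ((hasWeakDeriv_iff h.1 h.2.1).1 h a)] with ξ hξ
    rw [hξ, enorm_mul, mul_pow, enorm_pow, ← pow_mul, mul_comm n 2]
  · exact (continuous_dsym.aestronglyMeasurable.enorm.pow_const _).mul
      ((Lp.aestronglyMeasurable _).enorm.pow_const 2)

/-- The converse of Plancherel's formula: a finite weighted spectral integral produces the
derivative. Through it the H^s regularity of the data persists in time. -/
theorem exists_hasWeakDeriv {n : ℕ} {f : ℝ → EuclideanSpace ℝ (Fin d)} (hf : MemLp f 2 volume)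
    (h : ∫⁻ ξ, ‖dsym ξ‖ₑ ^ (2 * n) * ∑ a, ‖FT (fun x => f x a) ξ‖ₑ ^ 2 < ∞) :
    ∃ g, HasWeakDeriv n f g ∧ MemLp g 2 volume := by
  have hm : ∀ a, MemLp (fun ξ => dsym ξ ^ n * FT (fun x => f x a) ξ) 2 volume := by
    intro a
    refine ⟨(continuous_dsym.pow n).aestronglyMeasurable.mul (Lp.aestronglyMeasurable _), ?_⟩
    have : eLpNorm (fun ξ => dsym ξ ^ n * FT (fun x => f x a) ξ) 2 volume ^ 2 < ∞ := by
      refine lt_of_le_of_lt ?_ h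
      rw [eLpNorm_two_sq]
      refine lintegral_mono fun ξ => ?_
      rw [enorm_mul, mul_pow, enorm_pow, ← pow_mul, mul_comm n 2]
      gcongr
      exact Finset.single_le_sum (f := fun a => ‖FT (fun x => f x a) ξ‖ₑ ^ 2)
        (fun _ _ => bot_le) (Finset.mem_univ a)
    by_contra hne
    rw [not_lt, top_le_iff] at hne
    simp [hne] at this
  choose g hg hgw using fun a => exists_weak_deriv (memLp_apply hf a) (hm a)
  have hgm : MemLp (fun x => WithLp.toLp 2 fun a => g a x : ℝ → EuclideanSpace ℝ (Fin d)) 2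
      volume := by
    have : (fun x => WithLp.toLp 2 fun a => g a x : ℝ → EuclideanSpace ℝ (Fin d)) =
        fun x => ∑ a, g a x • EuclideanSpace.single a (1 : ℝ) := by
      ext x a
      simp [Pi.single_apply]
    rw [this]
    refine memLp_finsetSum _ fun a _ => ?_
    exact (ContinuousLinearMap.toSpanSingleton ℝ (EuclideanSpace.single a (1 : ℝ))).comp_memLp'
      (hg a)
  refine ⟨_, ?_, hgm⟩
  rw [hasWeakDeriv_iff (hf.locallyIntegrable one_le_two) (hgm.locallyIntegrable one_le_two)]
  exact hgw

end

end Bresse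

namespace Bresse

noncomputable section

variable {d : ℕ}

/-! ### Decay of weak solutions from a bound on the symbol -/

/-- Since 1 + t ≥ 1, a smaller exponent gives a larger power. This turns the q/4 estimate into the
q/6 estimate. -/
theorem DecayEstimate.mono {s : ℕ} {C₁ C₂ r D₁ D₂ r' : ℝ} {V : ℝ → ℝ → EuclideanSpace ℝ (Fin d)}
    (h : DecayEstimate s C₁ C₂ r V) (h1 : C₁ ≤ D₁) (h2 : C₂ ≤ D₂) (hD : 0 ≤ D₂) (hr : 0 < r)
    (hrr : r ≤ r') : DecayEstimate s D₁ D₂ r' V := by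
  intro t ht
  refine ⟨(h t ht).1, fun j n hjn Dt D0 hDt hD0 => ((h t ht).2 j n hjn Dt D0 hDt hD0).trans ?_⟩
  have h1t : (1 : ℝ) ≤ 1 + t := by linarith
  gcongr

/-- The squared Euclidean length of the Fourier transform of `V(t)` at a frequency. -/
def spec (V : ℝ → ℝ → EuclideanSpace ℝ (Fin d)) (t ξ : ℝ) : ℝ≥0∞ := ∑ a, ‖FTV V t a ξ‖ₑ ^ 2

/-- `‖exp (t A(ξ))‖² ≤ K exp (-c ξ⁴ (1 + ξ²)⁻⁴ t)`. -/
def Pencil.SymbolBound (A : Pencil d) (K c : ℝ) : Prop :=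
  ∀ ξ t : ℝ, 0 ≤ t → ∀ x : Fin d → ℂ,
    ∑ a, ‖NormedSpace.exp (t • matAct (A.symbol ξ)) x a‖ ^ 2 ≤
      K * Real.exp (-(c * rate ξ * t)) * ∑ a, ‖x a‖ ^ 2

theorem spec_le {A : Pencil d} {K c : ℝ} (hA : A.SymbolBound K c) (hK : 0 ≤ K)
    {V : ℝ → ℝ → EuclideanSpace ℝ (Fin d)} (hV : IsContinuousL2 V) (hw : A.IsWeakSolution V)
    {t : ℝ} (ht : 0 ≤ t) :
    ∀ᵐ ξ, spec V t ξ ≤ ENNReal.ofReal (K * Real.exp (-(c * rate ξ * t))) * spec V 0 ξ := by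
  have key : ∀ x : Fin d → ℂ, ∑ a, ‖x a‖ₑ ^ 2 = ENNReal.ofReal (∑ a, ‖x a‖ ^ 2) := fun x => by
    rw [ENNReal.ofReal_sum_of_nonneg fun _ _ => by positivity]
    simp only [← ofReal_norm, ← ENNReal.ofReal_pow (norm_nonneg _)]
  filter_upwards [FTV_eq_exp hV hw ht] with ξ hξ
  rw [spec, spec, key (fun a => FTV V t a ξ), key (fun a => FTV V 0 a ξ),
    ← ENNReal.ofReal_mul (by positivity)]
  refine ENNReal.ofReal_le_ofReal ?_
  have := hA ξ t ht (fun a => FTV V 0 a ξ)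
  rwa [← hξ] at this

theorem spec_zero_le {V : ℝ → ℝ → EuclideanSpace ℝ (Fin d)} (h2 : MemLp (V 0) 2 volume)
    (h1 : MemLp (V 0) 1 volume) : ∀ᵐ ξ, spec V 0 ξ ≤ d * eLpNorm (V 0) 1 volume ^ 2 := by
  have := ae_all_iff.2 fun a => enorm_FT_le (memLp_apply h2 a) (memLp_apply h1 a)
  filter_upwards [this] with ξ hξ
  calc spec V 0 ξ ≤ ∑ _a : Fin d, eLpNorm (V 0) 1 volume ^ 2 := by
        refine Finset.sum_le_sum fun a _ => ?_
        rw [FTV, max_self]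
        gcongr
        exact (hξ a).trans (eLpNorm_apply_le _ _ a)
    _ = _ := by simp

theorem enorm_dsym_pow (ξ : ℝ) (n : ℕ) :
    ‖dsym ξ‖ₑ ^ n = ENNReal.ofReal ((2 * Real.pi) ^ n * |ξ| ^ n) := by
  rw [← ofReal_norm, norm_dsym, ← ENNReal.ofReal_pow (by positivity), mul_pow]

theorem one_le_two_pi : (1 : ℝ) ≤ 2 * Real.pi := by linarith [Real.pi_gt_three]

theorem FTV_of_nonneg (V : ℝ → ℝ → EuclideanSpace ℝ (Fin d)) {t : ℝ} (ht : 0 ≤ t) (a : Fin d) :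
    FTV V t a = FT (fun x => V t x a) := by rw [FTV, max_eq_left ht]

theorem eLpNorm_weak_deriv_eq_spec {V : ℝ → ℝ → EuclideanSpace ℝ (Fin d)} {t : ℝ} (ht : 0 ≤ t)
    {n : ℕ} {g : ℝ → EuclideanSpace ℝ (Fin d)} (hf : MemLp (V t) 2 volume)
    (hg : MemLp g 2 volume) (h : HasWeakDeriv n (V t) g) :
    eLpNorm g 2 volume ^ 2 = ∫⁻ ξ, ‖dsym ξ‖ₑ ^ (2 * n) * spec V t ξ := by
  rw [eLpNorm_weak_deriv hf hg h]
  simp only [spec, FTV_of_nonneg V ht]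

/-- The weighted spectral integral of the solution, split at `|ξ| = 1`. -/
theorem exists_spec_bound {A : Pencil d} {K c : ℝ} (hA : A.SymbolBound K c) (hK : 0 < K)
    (hc : 0 < c) (j n : ℕ) :
    ∃ B₁ > 0, ∃ B₂ > 0, ∀ V : ℝ → ℝ → EuclideanSpace ℝ (Fin d), IsContinuousL2 V →
      A.IsWeakSolution V → MemLp (V 0) 1 volume → ∀ t, 0 ≤ t →
      ∫⁻ ξ, ‖dsym ξ‖ₑ ^ (2 * j) * spec V t ξ ≤
        ENNReal.ofReal (B₁ * (1 + t) ^ (-(1 / 4 : ℝ) - (j : ℝ) / 2)) * eLpNorm (V 0) 1 volume ^ 2 +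
        ENNReal.ofReal (B₂ * (1 + t) ^ (-((n : ℝ) / 2))) *
          ∫⁻ ξ, ‖dsym ξ‖ₑ ^ (2 * (j + n)) * spec V 0 ξ := by
  obtain ⟨L, hL, hlow⟩ := exists_low_bound hc j
  obtain ⟨H, hH, hhigh⟩ := exists_high_bound hc n
  -- `d + 1` instead of `d` keeps the first constant positive even in dimension 0.
  refine ⟨(2 * Real.pi) ^ (2 * j) * K * L * (d + 1), by positivity, K * H, by positivity,
    fun V hV hw h1 t ht => ?_⟩
  have ht1 : 0 < 1 + t := by linarith
  have hms : MeasurableSet {ξ : ℝ | |ξ| ≤ 1} :=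
    measurableSet_le measurable_id.abs measurable_const
  rw [← lintegral_add_compl _ hms]
  refine add_le_add ?_ ?_
  · calc _ ≤ ∫⁻ ξ in {ξ : ℝ | |ξ| ≤ 1},
          ENNReal.ofReal ((2 * Real.pi) ^ (2 * j) * K * (d + 1)) * eLpNorm (V 0) 1 volume ^ 2 *
            ENNReal.ofReal (|ξ| ^ (2 * j) * Real.exp (-(c * rate ξ * t))) := by
          refine lintegral_mono_ae ?_
          filter_upwards [ae_restrict_of_ae (spec_le hA hK.le hV hw ht),
            ae_restrict_of_ae (spec_zero_le (hV.1 0 le_rfl) h1)] with ξ h2 h3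
          calc _ ≤ ‖dsym ξ‖ₑ ^ (2 * j) * (ENNReal.ofReal (K * Real.exp (-(c * rate ξ * t))) *
                ((d + 1 : ℝ≥0∞) * eLpNorm (V 0) 1 volume ^ 2)) := by
                gcongr
                exact h2.trans (by gcongr; exact h3.trans (by gcongr; exact le_self_add))
            _ = _ := by
                have e : (d + 1 : ℝ≥0∞) = ENNReal.ofReal (d + 1) := by
                  rw [ENNReal.ofReal_add (by positivity) zero_le_one]; simp
                rw [e, enorm_dsym_pow, ← mul_assoc, ← mul_assoc,
                  ← ENNReal.ofReal_mul (by positivity), ← ENNReal.ofReal_mul (by positivity),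
                  mul_right_comm _ (eLpNorm (V 0) 1 volume ^ 2),
                  ← ENNReal.ofReal_mul (by positivity)]
                congr 2
                ring
      _ = ENNReal.ofReal ((2 * Real.pi) ^ (2 * j) * K * (d + 1)) * eLpNorm (V 0) 1 volume ^ 2 *
            ∫⁻ ξ in {ξ : ℝ | |ξ| ≤ 1},
              ENNReal.ofReal (|ξ| ^ (2 * j) * Real.exp (-(c * rate ξ * t))) := by
          refine lintegral_const_mul'' _ (Measurable.aemeasurable ?_)
          unfold rate
          fun_prop
      _ ≤ ENNReal.ofReal ((2 * Real.pi) ^ (2 * j) * K * (d + 1)) * eLpNorm (V 0) 1 volume ^ 2 *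
            ENNReal.ofReal (L * (1 + t) ^ (-(1 / 4 : ℝ) - (j : ℝ) / 2)) := by
          gcongr
          exact hlow t ht
      _ = _ := by
          rw [mul_right_comm, ← ENNReal.ofReal_mul (by positivity)]
          congr 2
          ring
  · calc _ ≤ ∫⁻ ξ in {ξ : ℝ | |ξ| ≤ 1}ᶜ, ENNReal.ofReal (K * H * (1 + t) ^ (-((n : ℝ) / 2))) *
            (‖dsym ξ‖ₑ ^ (2 * (j + n)) * spec V 0 ξ) := by
          refine lintegral_mono_ae ?_
          filter_upwards [ae_restrict_of_ae (spec_le hA hK.le hV hw ht),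
            ae_restrict_mem hms.compl] with ξ h2 h3
          have hξ : 1 ≤ |ξ| := (not_le.1 (notMem_ofPred_iff.1 h3)).le
          calc _ ≤ ‖dsym ξ‖ₑ ^ (2 * j) * (ENNReal.ofReal (K * (H * (1 + t) ^ (-((n : ℝ) / 2)) *
                ((2 * Real.pi) ^ (2 * n) * |ξ| ^ (2 * n)))) * spec V 0 ξ) := by
                refine mul_le_mul_right (h2.trans (mul_le_mul_left
                  (ENNReal.ofReal_le_ofReal ?_) _)) _
                refine mul_le_mul_of_nonneg_left ((hhigh ξ t hξ ht).trans ?_) hK.le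
                refine mul_le_mul_of_nonneg_left ?_ (by positivity)
                -- The powers |ξ|²ⁿ gained from the rate are completed to the symbol of ∂ₓⁿ by the
                -- harmless factor (2π)²ⁿ ≥ 1.
                exact le_mul_of_one_le_left (by positivity) (one_le_pow₀ one_le_two_pi)
            _ = _ := by
                rw [← mul_assoc, ← mul_assoc (ENNReal.ofReal _), enorm_dsym_pow, enorm_dsym_pow,
                  ← ENNReal.ofReal_mul (by positivity), ← ENNReal.ofReal_mul (by positivity)]
                congr 2
                ring
      _ ≤ ∫⁻ ξ, ENNReal.ofReal (K * H * (1 + t) ^ (-((n : ℝ) / 2))) *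
            (‖dsym ξ‖ₑ ^ (2 * (j + n)) * spec V 0 ξ) := setLIntegral_le_lintegral _ _
      _ = _ := lintegral_const_mul' _ _ ENNReal.ofReal_ne_top

/-- The spectral estimate bounds squared norms, which explains the square roots of the constants.
Only finitely many pairs (j, n) have j + n ≤ s, so summing their constants gives constants depending
on `s` alone for a given symbol bound. -/
theorem decay_of_symbolBound {A : Pencil d} {K c : ℝ} (hA : A.SymbolBound K c) (hK : 0 < K)
    (hc : 0 < c) (s : ℕ) :
    ∃ C₁ > 0, ∃ C₂ > 0, ∀ V : ℝ → ℝ → EuclideanSpace ℝ (Fin d), IsContinuousL2 V →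
      A.IsWeakSolution V → MemHs s (V 0) → MemLp (V 0) 1 volume →
        DecayEstimate s C₁ C₂ 4 V := by
  choose B₁ hB₁ B₂ hB₂ hB using fun j n => exists_spec_bound hA hK hc j n
  let R := Finset.range (s + 1) ×ˢ Finset.range (s + 1)
  let S₁ := ∑ p ∈ R, B₁ p.1 p.2
  let S₂ := ∑ p ∈ R, B₂ p.1 p.2
  have hmem : ∀ j n : ℕ, j + n ≤ s → (j, n) ∈ R := fun j n h => by
    simp only [R, Finset.mem_product, Finset.mem_range]; omega
  have hS₁ : ∀ j n, j + n ≤ s → B₁ j n ≤ S₁ := fun j n h =>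
    Finset.single_le_sum (f := fun p : ℕ × ℕ => B₁ p.1 p.2) (fun p _ => (hB₁ _ _).le) (hmem j n h)
  have hS₂ : ∀ j n, j + n ≤ s → B₂ j n ≤ S₂ := fun j n h =>
    Finset.single_le_sum (f := fun p : ℕ × ℕ => B₂ p.1 p.2) (fun p _ => (hB₂ _ _).le) (hmem j n h)
  have hp₁ : 0 < S₁ := (hB₁ 0 0).trans_le (hS₁ 0 0 (Nat.zero_le s))
  have hp₂ : 0 < S₂ := (hB₂ 0 0).trans_le (hS₂ 0 0 (Nat.zero_le s))
  refine ⟨√S₁, Real.sqrt_pos.2 hp₁, √S₂, Real.sqrt_pos.2 hp₂, fun V hV hw hs h1 t ht => ?_⟩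
  have ht1 : 0 < 1 + t := by linarith
  have hfin : ∀ j ≤ s, ∫⁻ ξ, ‖dsym ξ‖ₑ ^ (2 * j) * spec V 0 ξ < ∞ := fun j hj => by
    obtain ⟨g, hg, hg2⟩ := hs j hj
    rw [← eLpNorm_weak_deriv_eq_spec le_rfl (hV.1 0 le_rfl) hg2 hg]
    exact ENNReal.pow_lt_top hg2.2
  have hex : ∀ j ≤ s, ∃ g, HasWeakDeriv j (V t) g ∧ MemLp g 2 volume := fun j hj => by
    refine exists_hasWeakDeriv (hV.1 t ht) ?_
    -- With no derivatives traded, the estimate already shows that the weighted spectral integral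
    -- stays finite.
    have h0 := hB j 0 V hV hw h1 t ht
    simp only [spec, FTV_of_nonneg V ht] at h0
    refine h0.trans_lt (ENNReal.add_lt_top.2 ⟨?_, ?_⟩)
    · exact ENNReal.mul_lt_top ENNReal.ofReal_lt_top (ENNReal.pow_lt_top h1.2)
    · exact ENNReal.mul_lt_top ENNReal.ofReal_lt_top (hfin j hj)
  refine ⟨hex, fun j n hjn Dt D0 hDt hD0 => ?_⟩
  obtain ⟨g, hg, hg2⟩ := hex j (by omega)
  obtain ⟨g0, hg0, hg02⟩ := hs (j + n) hjn
  -- The given derivatives are only locally integrable a priori; uniqueness replaces them by the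
  -- square-integrable ones.
  rw [eLpNorm_congr_ae (hDt.unique hg), eLpNorm_congr_ae (hD0.unique hg0)]
  have h2 := hB j n V hV hw h1 t ht
  rw [← eLpNorm_weak_deriv_eq_spec ht (hV.1 t ht) hg2 hg,
    ← eLpNorm_weak_deriv_eq_spec le_rfl (hV.1 0 le_rfl) hg02 hg0] at h2
  have e : ∀ S p q : ℝ, 0 ≤ S → q = 2 * p → ENNReal.ofReal (S * (1 + t) ^ q) =
      ENNReal.ofReal (√S * (1 + t) ^ p) ^ 2 := fun S p q hS hpq => by
    rw [← ENNReal.ofReal_pow (by positivity), mul_pow, Real.sq_sqrt hS, ← Real.rpow_natCast,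
      ← Real.rpow_mul ht1.le, hpq]
    congr 3
    push_cast
    ring
  have h3 : eLpNorm g 2 volume ^ 2 ≤
      (ENNReal.ofReal (√S₁ * (1 + t) ^ (-(1 / 8 : ℝ) - (j : ℝ) / 4)) * eLpNorm (V 0) 1 volume) ^ 2 +
      (ENNReal.ofReal (√S₂ * (1 + t) ^ (-((n : ℝ) / 4))) * eLpNorm g0 2 volume) ^ 2 := by
    rw [mul_pow, mul_pow, ← e S₁ _ (-(1 / 4 : ℝ) - (j : ℝ) / 2) hp₁.le (by ring),
      ← e S₂ _ (-((n : ℝ) / 2)) hp₂.le (by ring)]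
    refine h2.trans ?_
    have := hS₁ j n hjn
    have := hS₂ j n hjn
    gcongr
  rw [← ENNReal.pow_le_pow_left_iff two_ne_zero]
  refine h3.trans ?_
  generalize ENNReal.ofReal (√S₁ * (1 + t) ^ (-(1 / 8 : ℝ) - (j : ℝ) / 4)) *
    eLpNorm (V 0) 1 volume = X
  generalize ENNReal.ofReal (√S₂ * (1 + t) ^ (-((n : ℝ) / 4))) * eLpNorm g0 2 volume = Y
  rw [add_sq]
  gcongr
  exact le_self_add

end

end Bresse

namespace Bresse

noncomputable section

/-! ### Real bilinear forms on `ℂ` -/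

/-- `Re (f * conj g)`. -/
def rp (f g : ℂ) : ℝ := f.re * g.re + f.im * g.im

/-- `Im (f * conj g)`. -/
def ip (f g : ℂ) : ℝ := f.im * g.re - f.re * g.im

theorem rp_self (f : ℂ) : rp f f = ‖f‖ ^ 2 := by
  rw [← Complex.normSq_eq_norm_sq, Complex.normSq_apply, rp]

theorem abs_rp_le (f g : ℂ) : |rp f g| ≤ ‖f‖ * ‖g‖ := by
  refine abs_le_of_sq_le_sq ?_ (by positivity)
  rw [mul_pow, ← rp_self, ← rp_self, rp, rp, rp]
  nlinarith [sq_nonneg (f.im * g.re - f.re * g.im)]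

theorem abs_ip_le (f g : ℂ) : |ip f g| ≤ ‖f‖ * ‖g‖ := by
  refine abs_le_of_sq_le_sq ?_ (by positivity)
  rw [mul_pow, ← rp_self, ← rp_self, ip, rp, rp]
  nlinarith [sq_nonneg (f.im * g.im + f.re * g.re)]

theorem hasDerivAt_rp {f g : ℝ → ℂ} {f' g' : ℂ} {t : ℝ} (hf : HasDerivAt f f' t)
    (hg : HasDerivAt g g' t) :
    HasDerivAt (fun t => rp (f t) (g t)) (rp f' (g t) + rp (f t) g') t := by
  have f1 := Complex.reCLM.hasFDerivAt.comp_hasDerivAt t hf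
  have f2 := Complex.imCLM.hasFDerivAt.comp_hasDerivAt t hf
  have g1 := Complex.reCLM.hasFDerivAt.comp_hasDerivAt t hg
  have g2 := Complex.imCLM.hasFDerivAt.comp_hasDerivAt t hg
  refine ((f1.mul g1).add (f2.mul g2)).congr_deriv ?_
  simp [Bresse.rp]
  ring

theorem hasDerivAt_ip {f g : ℝ → ℂ} {f' g' : ℂ} {t : ℝ} (hf : HasDerivAt f f' t)
    (hg : HasDerivAt g g' t) :
    HasDerivAt (fun t => ip (f t) (g t)) (ip f' (g t) + ip (f t) g') t := by
  have f1 := Complex.reCLM.hasFDerivAt.comp_hasDerivAt t hf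
  have f2 := Complex.imCLM.hasFDerivAt.comp_hasDerivAt t hf
  have g1 := Complex.reCLM.hasFDerivAt.comp_hasDerivAt t hg
  have g2 := Complex.imCLM.hasFDerivAt.comp_hasDerivAt t hg
  refine ((f2.mul g1).sub (f1.mul g2)).congr_deriv ?_
  simp [Bresse.ip]
  ring

theorem le_exp_of_deriv_le {L L' : ℝ → ℝ} {r : ℝ} (hL : ∀ t, HasDerivAt L (L' t) t)
    (h : ∀ t, L' t ≤ -(r * L t)) {t : ℝ} (ht : 0 ≤ t) : L t ≤ Real.exp (-(r * t)) * L 0 := by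
  have hd : ∀ t, HasDerivAt (fun t => Real.exp (r * t) * L t)
      (Real.exp (r * t) * (r * L t + L' t)) t := fun t => by
    have h1 := ((hasDerivAt_id t).const_mul r).exp
    refine (h1.mul (hL t)).congr_deriv ?_
    simp only [id]
    ring
  have hanti : Antitone (fun t => Real.exp (r * t) * L t) :=
    antitone_of_deriv_nonpos (fun t => (hd t).differentiableAt) fun t => by
      rw [(hd t).deriv]
      exact mul_nonpos_of_nonneg_of_nonpos (Real.exp_pos _).le (by linarith [h t])
  have := hanti ht
  simp only [mul_zero, Real.exp_zero, one_mul] at this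
  rw [Real.exp_neg, inv_mul_eq_div, le_div_iff₀ (Real.exp_pos _), mul_comm]
  exact this

/-- A Lyapunov function comparable to the energy yields exponential decay of the energy. -/
theorem energy_decay {E L L' : ℝ → ℝ} {μ r : ℝ} (hμ : 0 ≤ μ * r)
    (hL : ∀ t, HasDerivAt L (L' t) t)
    (hEL : ∀ t, |L t - E t| ≤ E t / 2) (h : ∀ t, L' t ≤ -(μ * r * E t)) {t : ℝ} (ht : 0 ≤ t) :
    E t ≤ 3 * Real.exp (-(μ / 2 * r * t)) * E 0 := by
  have hb := fun t => abs_le.1 (hEL t)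
  -- L ≤ 3E/2 turns the dissipation into decay of L at rate at least μr/2. The factor 3 in the
  -- conclusion is 2 · 3/2, from E ≤ 2L at time t and L ≤ 3E/2 at time 0.
  have h1 := le_exp_of_deriv_le (r := μ / 2 * r) hL (fun t => (h t).trans (by nlinarith [hb t])) ht
  have h2 := mul_le_mul_of_nonneg_left (show L 0 ≤ 3 / 2 * E 0 by linarith [hb 0])
    (Real.exp_pos (-(μ / 2 * r * t))).le
  linarith [hb t]

/-- The coupling hierarchy for the rotational subsystem. -/
theorem exists_small_rotational {K μ : ℝ} (hK : 0 < K) (hμ : 0 < μ) {ε₀ : ℝ} (hε₀ : 0 < ε₀) :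
    ∃ ε > 0, ε ≤ ε₀ ∧ ε ≤ 1 ∧ ∀ T U S Z V P : ℝ, 0 ≤ T → 0 ≤ U → 0 ≤ S → 0 ≤ Z → 0 ≤ V → 0 ≤ P →
      -(μ * T ^ 2) + ε ^ 22 * (-(μ * U ^ 2) + K * (S * U + T * U + T * Z + T * V + T * T))
        + ε ^ 20 * (-(μ * S ^ 2) + K * (T * S + T * T + T * Z))
        + ε ^ 28 * (-(μ * Z ^ 2) + K * (T * Z + P * U + U * U))
        + ε ^ 30 * (-(μ * V ^ 2) + K * (Z * V + T * V + U * P + U * U))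
        + ε ^ 32 * (-(μ * P ^ 2) + K * (U * P + V * V)) ≤
      -(μ / 2 * ε ^ 32 * (T ^ 2 + U ^ 2 + S ^ 2 + Z ^ 2 + V ^ 2 + P ^ 2)) := by
  -- 34 = 2 · 17: there are 17 cross terms, and together they may consume half of μ.
  refine ⟨min (min ε₀ 1) (μ / (34 * K)), by positivity, (min_le_left _ _).trans (min_le_left _ _),
    (min_le_left _ _).trans (min_le_right _ _), ?_⟩
  have h0 : 0 < min (min ε₀ 1) (μ / (34 * K)) := by positivity
  have h1 : min (min ε₀ 1) (μ / (34 * K)) ≤ 1 := (min_le_left _ _).trans (min_le_right _ _)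
  have h2 : min (min ε₀ 1) (μ / (34 * K)) ≤ μ / (34 * K) := min_le_right _ _
  generalize min (min ε₀ 1) (μ / (34 * K)) = ε at h0 h1 h2
  rw [le_div_iff₀ (by positivity)] at h2
  intro T U S Z V P hT hU hS hZ hV hP
  have hpow : ∀ i, 1 ≤ i → ε ^ i ≤ ε := fun i hi => pow_le_of_le_one h0.le h1 (by omega)
  -- Each variable is scaled by the square root of its own weight. The exponents 0, 22, 20, 28, 30,
  -- 32 are chosen so that, after this scaling, every cross term retains at least one factor ε; each
  -- is then at most ε N.
  let N := T ^ 2 + (ε ^ 11 * U) ^ 2 + (ε ^ 10 * S) ^ 2 + (ε ^ 14 * Z) ^ 2 + (ε ^ 15 * V) ^ 2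
    + (ε ^ 16 * P) ^ 2
  have hN : N = T ^ 2 + (ε ^ 11 * U) ^ 2 + (ε ^ 10 * S) ^ 2 + (ε ^ 14 * Z) ^ 2 + (ε ^ 15 * V) ^ 2
    + (ε ^ 16 * P) ^ 2 := rfl
  have key : ∀ (i : ℕ) (x y : ℝ), 1 ≤ i → x ^ 2 ≤ N → y ^ 2 ≤ N → 0 ≤ x → 0 ≤ y →
      ε ^ i * (x * y) ≤ ε * N := fun i x y hi hx2 hy2 hx hy =>
    mul_le_mul (hpow i hi) (by nlinarith [sq_nonneg (x - y)]) (by positivity) h0.le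
  have p1 := sq_nonneg T
  have p2 := sq_nonneg (ε ^ 11 * U)
  have p3 := sq_nonneg (ε ^ 10 * S)
  have p4 := sq_nonneg (ε ^ 14 * Z)
  have p5 := sq_nonneg (ε ^ 15 * V)
  have p6 := sq_nonneg (ε ^ 16 * P)
  have nT : T ^ 2 ≤ N := by linarith
  have nU : (ε ^ 11 * U) ^ 2 ≤ N := by linarith
  have nS : (ε ^ 10 * S) ^ 2 ≤ N := by linarith
  have nZ : (ε ^ 14 * Z) ^ 2 ≤ N := by linarith
  have nV : (ε ^ 15 * V) ^ 2 ≤ N := by linarith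
  have nP : (ε ^ 16 * P) ^ 2 ≤ N := by linarith
  have hU' : 0 ≤ ε ^ 11 * U := by positivity
  have hS' : 0 ≤ ε ^ 10 * S := by positivity
  have hZ' : 0 ≤ ε ^ 14 * Z := by positivity
  have hV' : 0 ≤ ε ^ 15 * V := by positivity
  have hP' : 0 ≤ ε ^ 16 * P := by positivity
  have k1 := key 1 _ _ (by norm_num) nS nU hS' hU'
  have k2 := key 11 _ _ (by norm_num) nT nU hT hU'
  have k3 := key 8 _ _ (by norm_num) nT nZ hT hZ'
  have k4 := key 7 _ _ (by norm_num) nT nV hT hV'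
  have k5 := key 22 _ _ (by norm_num) nT nT hT hT
  have k6 := key 10 _ _ (by norm_num) nT nS hT hS'
  have k7 := key 20 _ _ (by norm_num) nT nT hT hT
  have k8 := key 6 _ _ (by norm_num) nT nZ hT hZ'
  have k9 := key 14 _ _ (by norm_num) nT nZ hT hZ'
  have k10 := key 1 _ _ (by norm_num) nP nU hP' hU'
  have k11 := key 6 _ _ (by norm_num) nU nU hU' hU'
  have k12 := key 1 _ _ (by norm_num) nZ nV hZ' hV'
  have k13 := key 15 _ _ (by norm_num) nT nV hT hV'
  have k14 := key 3 _ _ (by norm_num) nU nP hU' hP'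
  have k15 := key 8 _ _ (by norm_num) nU nU hU' hU'
  have k16 := key 5 _ _ (by norm_num) nU nP hU' hP'
  have k17 := key 2 _ _ (by norm_num) nV nV hV' hV'
  have hN0 : 0 ≤ N := p1.trans nT
  have hle : ε ^ 32 * (T ^ 2 + U ^ 2 + S ^ 2 + Z ^ 2 + V ^ 2 + P ^ 2) ≤ N := by
    have q : ∀ (i : ℕ) (x : ℝ), i ≤ 16 → ε ^ 32 * x ^ 2 ≤ (ε ^ i * x) ^ 2 := fun i x hi => by
      rw [mul_pow, ← pow_mul]
      exact mul_le_mul_of_nonneg_right (pow_le_pow_of_le_one h0.le h1 (by omega)) (sq_nonneg x)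
    have q0 := q 0 T (by norm_num)
    rw [pow_zero, one_mul] at q0
    have q1 := q 11 U (by norm_num)
    have q2 := q 10 S (by norm_num)
    have q3 := q 14 Z (by norm_num)
    have q4 := q 15 V (by norm_num)
    have q5 := q 16 P (by norm_num)
    clear k1 k2 k3 k4 k5 k6 k7 k8 k9 k10 k11 k12 k13 k14 k15 k16 k17
    linarith
  have hsum := mul_le_mul_of_nonneg_left (add_le_add (add_le_add (add_le_add (add_le_add
    (add_le_add (add_le_add (add_le_add (add_le_add (add_le_add (add_le_add (add_le_add
    (add_le_add (add_le_add (add_le_add (add_le_add (add_le_add k1 k2) k3) k4) k5) k6) k7) k8)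
    k9) k10) k11) k12) k13) k14) k15) k16) k17) hK.le
  have hfin : -(μ * N) + K * (17 * (ε * N)) ≤ -(μ / 2 * N) := by
    have := mul_le_mul_of_nonneg_right h2 hN0
    linarith only [this]
  have hle' := mul_le_mul_of_nonneg_left hle (by positivity : 0 ≤ μ / 2)
  calc _ = -(μ * N) + K * (ε ^ 1 * (ε ^ 10 * S * (ε ^ 11 * U)) + ε ^ 11 * (T * (ε ^ 11 * U)) +
        ε ^ 8 * (T * (ε ^ 14 * Z)) + ε ^ 7 * (T * (ε ^ 15 * V)) + ε ^ 22 * (T * T) +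
        ε ^ 10 * (T * (ε ^ 10 * S)) + ε ^ 20 * (T * T) + ε ^ 6 * (T * (ε ^ 14 * Z)) +
        ε ^ 14 * (T * (ε ^ 14 * Z)) + ε ^ 1 * (ε ^ 16 * P * (ε ^ 11 * U)) +
        ε ^ 6 * (ε ^ 11 * U * (ε ^ 11 * U)) + ε ^ 1 * (ε ^ 14 * Z * (ε ^ 15 * V)) +
        ε ^ 15 * (T * (ε ^ 15 * V)) + ε ^ 3 * (ε ^ 11 * U * (ε ^ 16 * P)) +
        ε ^ 8 * (ε ^ 11 * U * (ε ^ 11 * U)) + ε ^ 5 * (ε ^ 11 * U * (ε ^ 16 * P)) +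
        ε ^ 2 * (ε ^ 15 * V * (ε ^ 15 * V))) := by rw [hN]; ring
    _ ≤ -(μ * N) + K * (17 * (ε * N)) := by
        refine add_le_add le_rfl (hsum.trans_eq ?_)
        ring
    _ ≤ -(μ / 2 * N) := hfin
    _ ≤ _ := by rw [mul_assoc]; exact neg_le_neg hle'

end

end Bresse

namespace Bresse

noncomputable section

/-! ### Algebraic identities for the rotational subsystem

The frequency is `κ = r / h` with `h = (κ² + l²)^(-1/2)`. -/

theorem rp_smul (a b : ℝ) (f g : ℂ) : rp (a • f) (b • g) = a * b * rp f g := by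
  simp [rp]; ring

theorem ip_smul (a b : ℝ) (f g : ℂ) : ip (a • f) (b • g) = a * b * ip f g := by
  simp [ip]; ring

section Identities

variable (r h α m γ ρ₁ ρ₂ k b q : ℝ) (v P u z τ s : ℂ)

/-- All couplings are skew for the energy product, and only the diffusion ακ²τ survives. -/
theorem rot_identity_energy (hm : m ≠ 0) (hρ₁ : ρ₁ ≠ 0) (hρ₂ : ρ₂ ≠ 0) (hh : h ≠ 0) :
    2 * (k * rp ((h⁻¹ : ℝ) * P - u) v + ρ₁ * rp (-((h⁻¹ * k / ρ₁ : ℝ) * v)) P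
      + ρ₂ * rp ((Complex.I * (r / h : ℝ) * b * z + k * v - Complex.I * (r / h : ℝ) * γ * τ)
          / (ρ₂ : ℂ)) u
      + b * rp (Complex.I * (r / h : ℝ) * u) z
      + γ / m * (rp (Complex.I * (r / h : ℝ) * q * s - α * (r / h : ℝ) ^ 2 * τ
          - m * (Complex.I * (r / h : ℝ) * u)) τ + rp (Complex.I * (r / h : ℝ) * q * τ) s)) =
    -(2 * (γ / m * α) * rp ((r / h) • τ) ((r / h) • τ)) := by
  have : (ρ₂ : ℂ) ≠ 0 := by exact_mod_cast hρ₂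
  rw [rp_smul]
  simp only [rp, div_eq_mul_inv, ← Complex.ofReal_inv]
  simp [sq]
  field_simp
  ring

/-- Recovers u: the source mκu in the heat equation, paired with u, has a definite sign. -/
theorem rot_identity₁ (hρ₂ : ρ₂ ≠ 0) (hh : h ≠ 0) :
    r ^ 3 * h * (ip (Complex.I * (r / h : ℝ) * q * s - α * (r / h : ℝ) ^ 2 * τ
          - m * (Complex.I * (r / h : ℝ) * u)) u
      + ip τ ((Complex.I * (r / h : ℝ) * b * z + k * v - Complex.I * (r / h : ℝ) * γ * τ)
          / (ρ₂ : ℂ))) =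
    q * rp (r ^ 2 • s) (r ^ 2 • u) - α * r ^ 2 * ip ((r / h) • τ) (r ^ 2 • u)
      - m * rp (r ^ 2 • u) (r ^ 2 • u) - b / ρ₂ * r * rp ((r / h) • τ) ((r ^ 2 * h) • z)
      + k / ρ₂ * ip ((r / h) • τ) ((r ^ 2 * h ^ 2) • v)
      + γ / ρ₂ * (r ^ 2 * h ^ 2) * rp ((r / h) • τ) ((r / h) • τ) := by
  simp only [rp_smul, ip_smul]
  simp only [rp, ip, div_eq_mul_inv, ← Complex.ofReal_inv]
  simp [sq]
  field_simp
  ring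

/-- Recovers the flux s. In τ + mz the velocity u cancels, leaving the flux and diffusion terms. -/
theorem rot_identity₃ (hh : h ≠ 0) :
    r ^ 3 * h * (ip (Complex.I * (r / h : ℝ) * q * s - α * (r / h : ℝ) ^ 2 * τ) s
      + ip (τ + m * z) (Complex.I * (r / h : ℝ) * q * τ)) =
    q * rp (r ^ 2 • s) (r ^ 2 • s) - α * r ^ 2 * ip ((r / h) • τ) (r ^ 2 • s)
      - q * (r ^ 2 * h ^ 2) * rp ((r / h) • τ) ((r / h) • τ)
      - q * m * r * rp ((r / h) • τ) ((r ^ 2 * h) • z) := by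
  simp only [rp_smul, ip_smul]
  simp only [rp, ip, div_eq_mul_inv]
  simp [sq]
  field_simp
  ring

/-- Recovers z. The derivative of ρ₁P + nρ₂u is free of v, so no difference of wave speeds has to
vanish; the price is the coupling of P with u, absorbed by the extra powers of h. -/
theorem rot_identity₂ (hh : h ≠ 0) :
    r ^ 3 * h ^ 4 * (ip ((h⁻¹ : ℝ) * (Complex.I * (r / h : ℝ) * (b * z - γ * τ))) z
      + ip (ρ₁ * P + (h⁻¹ * ρ₂ : ℝ) * u) (Complex.I * (r / h : ℝ) * u)) =
    b * rp ((r ^ 2 * h) • z) ((r ^ 2 * h) • z)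
      - γ * (r * h ^ 2) * rp ((r / h) • τ) ((r ^ 2 * h) • z)
      - ρ₁ * h * rp ((r ^ 2 * h ^ 2) • P) (r ^ 2 • u)
      - ρ₂ * h ^ 2 * rp (r ^ 2 • u) (r ^ 2 • u) := by
  simp only [rp_smul]
  simp only [rp, ip, div_eq_mul_inv]
  simp
  field_simp
  ring

/-- Recovers v from the momentum equation for u, once z and τ are under control. -/
theorem rot_identity₄ (hρ₂ : ρ₂ ≠ 0) (hh : h ≠ 0) :
    r ^ 4 * h ^ 4 * (rp ((Complex.I * (r / h : ℝ) * b * z + k * v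
        - Complex.I * (r / h : ℝ) * γ * τ) / (ρ₂ : ℂ)) v + rp u ((h⁻¹ : ℝ) * P - u)) =
    k / ρ₂ * rp ((r ^ 2 * h ^ 2) • v) ((r ^ 2 * h ^ 2) • v)
      - b / ρ₂ * r * ip ((r ^ 2 * h) • z) ((r ^ 2 * h ^ 2) • v)
      + γ / ρ₂ * (r ^ 2 * h ^ 2) * ip ((r / h) • τ) ((r ^ 2 * h ^ 2) • v)
      + h * rp (r ^ 2 • u) ((r ^ 2 * h ^ 2) • P) - h ^ 4 * rp (r ^ 2 • u) (r ^ 2 • u) := by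
  simp only [rp_smul, ip_smul]
  simp only [rp, ip, div_eq_mul_inv, ← Complex.ofReal_inv]
  simp
  field_simp
  ring

/-- Recovers P from the strain equation for v, up to |v|² and a cross term with u. -/
theorem rot_identity₅ (hρ₁ : ρ₁ ≠ 0) (hh : h ≠ 0) :
    r ^ 4 * h ^ 5 * (rp ((h⁻¹ : ℝ) * P - u) P + rp v (-((h⁻¹ * k / ρ₁ : ℝ) * v))) =
    rp ((r ^ 2 * h ^ 2) • P) ((r ^ 2 * h ^ 2) • P)
      - h ^ 3 * rp (r ^ 2 • u) ((r ^ 2 * h ^ 2) • P)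
      - k / ρ₁ * rp ((r ^ 2 * h ^ 2) • v) ((r ^ 2 * h ^ 2) • v) := by
  simp only [rp_smul]
  simp only [rp, div_eq_mul_inv]
  simp
  field_simp
  ring

end Identities

/-! ### Decay for the rotational subsystem -/

/-- The equations of the rotational subsystem at frequency `κ`, with `n = (κ² + l²)^(1/2)`. -/
structure RotODE (κ n α m γ ρ₁ ρ₂ k b q : ℝ) (v P u z τ s : ℝ → ℂ) : Prop where
  hv : ∀ t, HasDerivAt v ((n : ℝ) * P t - u t) t
  hP : ∀ t, HasDerivAt P (-((n * k / ρ₁ : ℝ) * v t)) t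
  hu : ∀ t, HasDerivAt u ((Complex.I * (κ : ℝ) * b * z t + k * v t
    - Complex.I * (κ : ℝ) * γ * τ t) / (ρ₂ : ℂ)) t
  hz : ∀ t, HasDerivAt z (Complex.I * (κ : ℝ) * u t) t
  hτ : ∀ t, HasDerivAt τ (Complex.I * (κ : ℝ) * q * s t - α * (κ : ℝ) ^ 2 * τ t
    - m * (Complex.I * (κ : ℝ) * u t)) t
  hs : ∀ t, HasDerivAt s (Complex.I * (κ : ℝ) * q * τ t) t

/-- The energy of the rotational subsystem. -/
def rotEnergy (m γ ρ₁ ρ₂ k b : ℝ) (v P u z τ s : ℂ) : ℝ :=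
  k * ‖v‖ ^ 2 + ρ₁ * ‖P‖ ^ 2 + ρ₂ * ‖u‖ ^ 2 + b * ‖z‖ ^ 2 + γ / m * (‖τ‖ ^ 2 + ‖s‖ ^ 2)

/-- The correction turning the energy of the rotational subsystem into a Lyapunov function. -/
def rotCorrection (r h m ρ₁ ρ₂ ε : ℝ) (v P u z τ s : ℂ) : ℝ :=
  ε ^ 22 * (r ^ 3 * h * ip τ u) - ε ^ 20 * (r ^ 3 * h * ip (τ + m * z) s)
    - ε ^ 28 * (r ^ 3 * h ^ 4 * ip (ρ₁ * P + (h⁻¹ * ρ₂ : ℝ) * u) z)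
    - ε ^ 30 * (r ^ 4 * h ^ 4 * rp u v) - ε ^ 32 * (r ^ 4 * h ^ 5 * rp v P)

theorem RotODE.hasDerivAt {r h α m γ ρ₁ ρ₂ k b q : ℝ} {v P u z τ s : ℝ → ℂ}
    (H : RotODE (r / h) h⁻¹ α m γ ρ₁ ρ₂ k b q v P u z τ s) (ε : ℝ) (hm : m ≠ 0) (hρ₁ : ρ₁ ≠ 0)
    (hρ₂ : ρ₂ ≠ 0) (hh : h ≠ 0) (t : ℝ) :
    HasDerivAt (fun t => rotEnergy m γ ρ₁ ρ₂ k b (v t) (P t) (u t) (z t) (τ t) (s t)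
        + rotCorrection r h m ρ₁ ρ₂ ε (v t) (P t) (u t) (z t) (τ t) (s t))
      (-(2 * (γ / m * α) * rp ((r / h) • τ t) ((r / h) • τ t))
        + (ε ^ 22 * (q * rp (r ^ 2 • s t) (r ^ 2 • u t)
            - α * r ^ 2 * ip ((r / h) • τ t) (r ^ 2 • u t)
            - m * rp (r ^ 2 • u t) (r ^ 2 • u t)
            - b / ρ₂ * r * rp ((r / h) • τ t) ((r ^ 2 * h) • z t)
            + k / ρ₂ * ip ((r / h) • τ t) ((r ^ 2 * h ^ 2) • v t)
            + γ / ρ₂ * (r ^ 2 * h ^ 2) * rp ((r / h) • τ t) ((r / h) • τ t))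
          - ε ^ 20 * (q * rp (r ^ 2 • s t) (r ^ 2 • s t)
            - α * r ^ 2 * ip ((r / h) • τ t) (r ^ 2 • s t)
            - q * (r ^ 2 * h ^ 2) * rp ((r / h) • τ t) ((r / h) • τ t)
            - q * m * r * rp ((r / h) • τ t) ((r ^ 2 * h) • z t))
          - ε ^ 28 * (b * rp ((r ^ 2 * h) • z t) ((r ^ 2 * h) • z t)
            - γ * (r * h ^ 2) * rp ((r / h) • τ t) ((r ^ 2 * h) • z t)
            - ρ₁ * h * rp ((r ^ 2 * h ^ 2) • P t) (r ^ 2 • u t)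
            - ρ₂ * h ^ 2 * rp (r ^ 2 • u t) (r ^ 2 • u t))
          - ε ^ 30 * (k / ρ₂ * rp ((r ^ 2 * h ^ 2) • v t) ((r ^ 2 * h ^ 2) • v t)
            - b / ρ₂ * r * ip ((r ^ 2 * h) • z t) ((r ^ 2 * h ^ 2) • v t)
            + γ / ρ₂ * (r ^ 2 * h ^ 2) * ip ((r / h) • τ t) ((r ^ 2 * h ^ 2) • v t)
            + h * rp (r ^ 2 • u t) ((r ^ 2 * h ^ 2) • P t)
            - h ^ 4 * rp (r ^ 2 • u t) (r ^ 2 • u t))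
          - ε ^ 32 * (rp ((r ^ 2 * h ^ 2) • P t) ((r ^ 2 * h ^ 2) • P t)
            - h ^ 3 * rp (r ^ 2 • u t) ((r ^ 2 * h ^ 2) • P t)
            - k / ρ₁ * rp ((r ^ 2 * h ^ 2) • v t) ((r ^ 2 * h ^ 2) • v t)))) t := by
  have hρ₁' : (ρ₁ : ℂ) ≠ 0 := by exact_mod_cast hρ₁
  have hρ₂' : (ρ₂ : ℂ) ≠ 0 := by exact_mod_cast hρ₂
  have hT : HasDerivAt (fun t => τ t + m * z t)
      (Complex.I * (r / h : ℝ) * q * s t - α * (r / h : ℝ) ^ 2 * τ t) t :=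
    ((H.hτ t).add ((H.hz t).const_mul (m : ℂ))).congr_deriv (by ring)
  have hQ : HasDerivAt (fun t => ρ₁ * P t + (h⁻¹ * ρ₂ : ℝ) * u t)
      ((h⁻¹ : ℝ) * (Complex.I * (r / h : ℝ) * (b * z t - γ * τ t))) t := by
    refine (((H.hP t).const_mul (ρ₁ : ℂ)).add
      ((H.hu t).const_mul ((h⁻¹ * ρ₂ : ℝ) : ℂ))).congr_deriv ?_
    push_cast
    field_simp
    ring
  rw [← rot_identity₁ r h α m γ ρ₂ k b q (v t) (u t) (z t) (τ t) (s t) hρ₂ hh,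
    ← rot_identity₃ r h α m q (z t) (τ t) (s t) hh,
    ← rot_identity₂ r h γ ρ₁ ρ₂ b (P t) (u t) (z t) (τ t) hh,
    ← rot_identity₄ r h γ ρ₂ k b (v t) (P t) (u t) (z t) (τ t) hρ₂ hh,
    ← rot_identity₅ r h ρ₁ k (v t) (P t) (u t) hρ₁ hh,
    ← rot_identity_energy r h α m γ ρ₁ ρ₂ k b q (v t) (P t) (u t) (z t) (τ t) (s t) hm hρ₁ hρ₂ hh]
  simp only [rotEnergy, rotCorrection, ← rp_self]
  refine HasDerivAt.add ?_ ?_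
  · refine ((((((hasDerivAt_rp (H.hv t) (H.hv t)).const_mul k).add
      ((hasDerivAt_rp (H.hP t) (H.hP t)).const_mul ρ₁)).add
      ((hasDerivAt_rp (H.hu t) (H.hu t)).const_mul ρ₂)).add
      ((hasDerivAt_rp (H.hz t) (H.hz t)).const_mul b)).add
      (((hasDerivAt_rp (H.hτ t) (H.hτ t)).add
        (hasDerivAt_rp (H.hs t) (H.hs t))).const_mul (γ / m))).congr_deriv ?_
    have c : ∀ f g, rp f g = rp g f := fun f g => by simp only [rp]; ring
    rw [c (v t), c (P t), c (u t), c (z t), c (τ t), c (s t)]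
    ring
  · exact ((((((hasDerivAt_ip (H.hτ t) (H.hu t)).const_mul (r ^ 3 * h)).const_mul (ε ^ 22)).sub
      (((hasDerivAt_ip hT (H.hs t)).const_mul (r ^ 3 * h)).const_mul (ε ^ 20))).sub
      (((hasDerivAt_ip hQ (H.hz t)).const_mul (r ^ 3 * h ^ 4)).const_mul (ε ^ 28))).sub
      (((hasDerivAt_rp (H.hu t) (H.hv t)).const_mul (r ^ 4 * h ^ 4)).const_mul (ε ^ 30))).sub
      (((hasDerivAt_rp (H.hv t) (H.hP t)).const_mul (r ^ 4 * h ^ 5)).const_mul (ε ^ 32))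

/-- All coefficients in the identities are monomials in r and h. These are uniformly bounded, as |r|
≤ 1 and h ≤ Λ. -/
theorem abs_mul_pow_le {r h Λ : ℝ} (hr : |r| ≤ 1) (hh : 0 < h) (hΛ : h ≤ Λ) (h1 : 1 ≤ Λ)
    {i j : ℕ} {N : ℕ} (hj : j ≤ N) : |r ^ i * h ^ j| ≤ Λ ^ N := by
  rw [abs_mul, abs_pow, abs_pow, abs_of_pos hh]
  calc |r| ^ i * h ^ j ≤ 1 * Λ ^ j := by
        gcongr
        exact pow_le_one₀ (abs_nonneg r) hr
    _ ≤ Λ ^ N := by rw [one_mul]; exact pow_le_pow_right₀ h1 hj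

/-- Dissipation in the scaled variables of the rotational subsystem. -/
theorem exists_rot_dissipation {α m γ ρ₁ ρ₂ k b q Λ : ℝ} (hα : 0 < α) (hm : 0 < m) (hγ : 0 < γ)
    (hρ₁ : 0 < ρ₁) (hρ₂ : 0 < ρ₂) (hk : 0 < k) (hb : 0 < b) (hq : 0 ≤ q) (hΛ : 1 ≤ Λ) :
    ∃ K > 0, ∃ μ > 0, ∀ r h : ℝ, |r| ≤ 1 → 0 < h → h ≤ Λ → ∀ V P U Z T S : ℂ,
      (q = 0 → S = 0) →
      -(2 * (γ / m * α) * rp T T) ≤ -(μ * ‖T‖ ^ 2) ∧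
      q * rp S U - α * r ^ 2 * ip T U - m * rp U U - b / ρ₂ * r * rp T Z + k / ρ₂ * ip T V
          + γ / ρ₂ * (r ^ 2 * h ^ 2) * rp T T ≤
        -(μ * ‖U‖ ^ 2) + K * (‖S‖ * ‖U‖ + ‖T‖ * ‖U‖ + ‖T‖ * ‖Z‖ + ‖T‖ * ‖V‖ + ‖T‖ * ‖T‖) ∧
      -(q * rp S S - α * r ^ 2 * ip T S - q * (r ^ 2 * h ^ 2) * rp T T - q * m * r * rp T Z) ≤
        -(μ * ‖S‖ ^ 2) + K * (‖T‖ * ‖S‖ + ‖T‖ * ‖T‖ + ‖T‖ * ‖Z‖) ∧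
      -(b * rp Z Z - γ * (r * h ^ 2) * rp T Z - ρ₁ * h * rp P U - ρ₂ * h ^ 2 * rp U U) ≤
        -(μ * ‖Z‖ ^ 2) + K * (‖T‖ * ‖Z‖ + ‖P‖ * ‖U‖ + ‖U‖ * ‖U‖) ∧
      -(k / ρ₂ * rp V V - b / ρ₂ * r * ip Z V + γ / ρ₂ * (r ^ 2 * h ^ 2) * ip T V
          + h * rp U P - h ^ 4 * rp U U) ≤
        -(μ * ‖V‖ ^ 2) + K * (‖Z‖ * ‖V‖ + ‖T‖ * ‖V‖ + ‖U‖ * ‖P‖ + ‖U‖ * ‖U‖) ∧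
      -(rp P P - h ^ 3 * rp U P - k / ρ₁ * rp V V) ≤
        -(μ * ‖P‖ ^ 2) + K * (‖U‖ * ‖P‖ + ‖V‖ * ‖V‖) := by
  let G := q + q * m + α + b / ρ₂ + k / ρ₂ + γ / ρ₂ + γ + ρ₁ + ρ₂ + 1 + k / ρ₁
  have g1 : 0 < b / ρ₂ := by positivity
  have g2 : 0 < k / ρ₂ := by positivity
  have g3 : 0 < γ / ρ₂ := by positivity
  have g4 : 0 < k / ρ₁ := by positivity
  have g5 : 0 ≤ q * m := by positivity
  have hG : 0 < G := by positivity
  -- For q = 0 the flux variable vanishes by hypothesis, so any positive number can stand for its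
  -- coefficient.
  let μ := min (2 * (γ / m * α)) (min m (min (if q = 0 then 1 else q) (min b (min (k / ρ₂) 1))))
  have hq' : 0 < if q = 0 then 1 else q := by
    split_ifs with h
    · exact one_pos
    · exact hq.lt_of_ne' h
  have hμ : 0 < μ := by positivity
  have m1 : μ ≤ 2 * (γ / m * α) := min_le_left _ _
  have n1 : μ ≤ min m (min (if q = 0 then 1 else q) (min b (min (k / ρ₂) 1))) := min_le_right _ _
  have m2 : μ ≤ m := n1.trans (min_le_left _ _)
  have n2 := n1.trans (min_le_right _ _)
  have m3 : μ ≤ if q = 0 then 1 else q := n2.trans (min_le_left _ _)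
  have n3 := n2.trans (min_le_right _ _)
  have m4 : μ ≤ b := n3.trans (min_le_left _ _)
  have n4 := n3.trans (min_le_right _ _)
  have m5 : μ ≤ k / ρ₂ := n4.trans (min_le_left _ _)
  have m6 : μ ≤ 1 := n4.trans (min_le_right _ _)
  refine ⟨G * Λ ^ 4, by positivity, μ, hμ, fun r h hr hh hhΛ V P U Z T S hS => ?_⟩
  have bd : ∀ (c : ℝ) (i j : ℕ), 0 ≤ c → c ≤ G → j ≤ 4 → ∀ X Y : ℝ, |X| ≤ Y →
      |c * (r ^ i * h ^ j) * X| ≤ G * Λ ^ 4 * Y := fun c i j hc hcG hj X Y hXY => by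
    rw [abs_mul, abs_mul, abs_of_nonneg hc]
    have := abs_mul_pow_le (i := i) hr hh hhΛ hΛ hj
    gcongr
  have bd' : ∀ (c : ℝ) (i j : ℕ), 0 ≤ c → c ≤ G → j ≤ 4 → ∀ X Y : ℝ, |X| ≤ Y →
      c * (r ^ i * h ^ j) * X ≤ G * Λ ^ 4 * Y ∧ -(c * (r ^ i * h ^ j) * X) ≤ G * Λ ^ 4 * Y :=
    fun c i j hc hcG hj X Y hXY => abs_le'.1 (bd c i j hc hcG hj X Y hXY)
  have sq : ∀ (X : ℂ) (c : ℝ), μ ≤ c → -(c * rp X X) ≤ -(μ * ‖X‖ ^ 2) := fun X c hc => by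
    rw [rp_self]; exact neg_le_neg (by gcongr)
  have hS' : -(q * rp S S) ≤ -(μ * ‖S‖ ^ 2) := by
    by_cases h0 : q = 0
    · rw [hS h0, h0]; simp
    · rw [if_neg h0] at m3
      exact sq S q m3
  have gq : q ≤ G := by simp only [G]; linarith
  have gqm : q * m ≤ G := by simp only [G]; linarith
  have gα : α ≤ G := by simp only [G]; linarith
  have gb : b / ρ₂ ≤ G := by simp only [G]; linarith
  have gk : k / ρ₂ ≤ G := by simp only [G]; linarith
  have gγ : γ / ρ₂ ≤ G := by simp only [G]; linarith
  have gγ' : γ ≤ G := by simp only [G]; linarith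
  have gρ₁ : ρ₁ ≤ G := by simp only [G]; linarith
  have gρ₂ : ρ₂ ≤ G := by simp only [G]; linarith
  have g1' : 1 ≤ G := by simp only [G]; linarith
  have gk' : k / ρ₁ ≤ G := by simp only [G]; linarith
  have z4 : (0 : ℕ) ≤ 4 := by norm_num
  have a := abs_rp_le
  have a' := abs_ip_le
  refine ⟨sq T _ m1, ?_, ?_, ?_, ?_, ?_⟩
  · have e1 := (bd' q 0 0 hq gq z4 _ _ (a S U)).1
    have e2 := (bd' α 2 0 hα.le gα z4 _ _ (a' T U)).2
    have e3 := (bd' (b / ρ₂) 1 0 g1.le gb z4 _ _ (a T Z)).2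
    have e4 := (bd' (k / ρ₂) 0 0 g2.le gk z4 _ _ (a' T V)).1
    have e5 := (bd' (γ / ρ₂) 2 2 g3.le gγ (by norm_num) _ _ (a T T)).1
    have e6 := sq U m m2
    simp only [pow_zero, pow_one, mul_one] at e1 e2 e3 e4 e5
    linarith only [e1, e2, e3, e4, e5, e6]
  · have e2 := (bd' α 2 0 hα.le gα z4 _ _ (a' T S)).1
    have e3 := (bd' q 2 2 hq gq (by norm_num) _ _ (a T T)).1
    have e4 := (bd' (q * m) 1 0 g5 gqm z4 _ _ (a T Z)).1
    simp only [pow_zero, pow_one, mul_one] at e2 e3 e4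
    linarith only [e2, e3, e4, hS']
  · have e2 := (bd' γ 1 2 hγ.le gγ' (by norm_num) _ _ (a T Z)).1
    have e3 := (bd' ρ₁ 0 1 hρ₁.le gρ₁ (by norm_num) _ _ (a P U)).1
    have e4 := (bd' ρ₂ 0 2 hρ₂.le gρ₂ (by norm_num) _ _ (a U U)).1
    have e6 := sq Z b m4
    simp only [pow_zero, pow_one, one_mul] at e2 e3 e4
    linarith only [e2, e3, e4, e6]
  · have e2 := (bd' (b / ρ₂) 1 0 g1.le gb z4 _ _ (a' Z V)).1
    have e3 := (bd' (γ / ρ₂) 2 2 g3.le gγ (by norm_num) _ _ (a' T V)).2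
    have e4 := (bd' 1 0 1 zero_le_one g1' (by norm_num) _ _ (a U P)).2
    have e5 := (bd' 1 0 4 zero_le_one g1' (by norm_num) _ _ (a U U)).1
    have e6 := sq V _ m5
    simp only [pow_zero, pow_one, one_mul, mul_one] at e2 e3 e4 e5
    linarith only [e2, e3, e4, e5, e6]
  · have e2 := (bd' 1 0 3 zero_le_one g1' (by norm_num) _ _ (a U P)).1
    have e3 := (bd' (k / ρ₁) 0 0 g4.le gk' z4 _ _ (a V V)).1
    have e6 := sq P 1 m6
    simp only [pow_zero, one_mul, mul_one] at e2 e3 e6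
    linarith only [e2, e3, e6]

/-- The correction is small compared with the energy. -/
theorem abs_rotCorrection_le {r h m ρ₁ ρ₂ ε Λ : ℝ} (hm : 0 < m) (hρ₁ : 0 < ρ₁) (hρ₂ : 0 < ρ₂)
    (hr : |r| ≤ 1) (hh : 0 < h) (hhΛ : h ≤ Λ) (hΛ : 1 ≤ Λ) (hε : 0 < ε) (hε1 : ε ≤ 1)
    (v P u z τ s : ℂ) :
    |rotCorrection r h m ρ₁ ρ₂ ε v P u z τ s| ≤
      ε * (7 * ((1 + m + ρ₁ + ρ₂) * Λ ^ 5)) *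
        (‖v‖ ^ 2 + ‖P‖ ^ 2 + ‖u‖ ^ 2 + ‖z‖ ^ 2 + ‖τ‖ ^ 2 + ‖s‖ ^ 2) := by
  set G := 1 + m + ρ₁ + ρ₂ with hG
  set N := ‖v‖ ^ 2 + ‖P‖ ^ 2 + ‖u‖ ^ 2 + ‖z‖ ^ 2 + ‖τ‖ ^ 2 + ‖s‖ ^ 2 with hN
  have hG0 : 0 < G := by positivity
  have hN0 : 0 ≤ N := by positivity
  have bd : ∀ (c : ℝ) (e i j : ℕ), 0 ≤ c → c ≤ G → 1 ≤ e → j ≤ 5 → ∀ X : ℝ, |X| ≤ N →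
      |ε ^ e * (c * (r ^ i * h ^ j) * X)| ≤ ε * (G * Λ ^ 5) * N := fun c e i j hc hcG he hj X hX => by
    rw [abs_mul, abs_mul, abs_mul, abs_of_nonneg hc, abs_of_nonneg (pow_nonneg hε.le e)]
    have h1 := abs_mul_pow_le (i := i) hr hh hhΛ hΛ hj
    have h2 : ε ^ e ≤ ε := pow_le_of_le_one hε.le hε1 (by omega)
    calc _ ≤ ε * (G * Λ ^ 5 * N) := by gcongr
      _ = _ := by ring
  have pr : ∀ x y : ℂ, ‖x‖ ^ 2 + ‖y‖ ^ 2 ≤ 2 * N → |rp x y| ≤ N := fun x y h =>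
    (abs_rp_le x y).trans (by nlinarith [sq_nonneg (‖x‖ - ‖y‖)])
  have pi : ∀ x y : ℂ, ‖x‖ ^ 2 + ‖y‖ ^ 2 ≤ 2 * N → |ip x y| ≤ N := fun x y h =>
    (abs_ip_le x y).trans (by nlinarith [sq_nonneg (‖x‖ - ‖y‖)])
  have q1 := sq_nonneg ‖v‖
  have q2 := sq_nonneg ‖P‖
  have q3 := sq_nonneg ‖u‖
  have q4 := sq_nonneg ‖z‖
  have q5 := sq_nonneg ‖τ‖
  have q6 := sq_nonneg ‖s‖
  have e1 := bd 1 22 3 1 zero_le_one (by linarith) (by norm_num) (by norm_num) _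
    (pi τ u (by linarith))
  have e2 := bd 1 20 3 1 zero_le_one (by linarith) (by norm_num) (by norm_num) _
    (pi τ s (by linarith))
  have e3 := bd m 20 3 1 hm.le (by linarith) (by norm_num) (by norm_num) _
    (pi z s (by linarith))
  have e4 := bd ρ₁ 28 3 4 hρ₁.le (by linarith) (by norm_num) (by norm_num) _
    (pi P z (by linarith))
  have e5 := bd ρ₂ 28 3 3 hρ₂.le (by linarith) (by norm_num) (by norm_num) _
    (pi u z (by linarith))
  have e6 := bd 1 30 4 4 zero_le_one (by linarith) (by norm_num) (by norm_num) _
    (pr u v (by linarith))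
  have e7 := bd 1 32 4 5 zero_le_one (by linarith) (by norm_num) (by norm_num) _
    (pr v P (by linarith))
  have hexp : rotCorrection r h m ρ₁ ρ₂ ε v P u z τ s =
      ε ^ 22 * (1 * (r ^ 3 * h ^ 1) * ip τ u) - ε ^ 20 * (1 * (r ^ 3 * h ^ 1) * ip τ s)
      - ε ^ 20 * (m * (r ^ 3 * h ^ 1) * ip z s) - ε ^ 28 * (ρ₁ * (r ^ 3 * h ^ 4) * ip P z)
      - ε ^ 28 * (ρ₂ * (r ^ 3 * h ^ 3) * ip u z) - ε ^ 30 * (1 * (r ^ 4 * h ^ 4) * rp u v)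
      - ε ^ 32 * (1 * (r ^ 4 * h ^ 5) * rp v P) := by
    have a1 : ip (τ + m * z) s = ip τ s + m * ip z s := by simp [ip]; ring
    have a2 : ip (ρ₁ * P + (h⁻¹ * ρ₂ : ℝ) * u) z = ρ₁ * ip P z + h⁻¹ * ρ₂ * ip u z := by
      simp only [ip, Complex.add_re, Complex.add_im, Complex.re_ofReal_mul, Complex.im_ofReal_mul]
      ring
    rw [rotCorrection, a1, a2]
    have : h ^ 4 * h⁻¹ = h ^ 3 := by field_simp
    linear_combination (-(ε ^ 28 * r ^ 3 * ρ₂ * ip u z)) * this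
  rw [hexp]
  rw [abs_le] at *
  constructor <;> linarith only [e1.1, e1.2, e2.1, e2.2, e3.1, e3.2, e4.1, e4.2, e5.1, e5.2, e6.1,
    e6.2, e7.1, e7.2]

theorem mul_norm_sq_le_of_le {h Λ A c : ℝ} {x : ℂ} {i : ℕ} (hh : 0 < h) (hhΛ : h ≤ Λ)
    (hΛ : 1 ≤ Λ) (hi : i ≤ 6) (hc : A ≤ h ^ i * c ^ 2) :
    A * ‖x‖ ^ 2 ≤ Λ ^ 6 * ‖c • x‖ ^ 2 := by
  have hp : h ^ i ≤ Λ ^ 6 := (pow_le_pow_left₀ hh.le hhΛ i).trans (pow_le_pow_right₀ hΛ hi)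
  rw [norm_smul, mul_pow, Real.norm_eq_abs, sq_abs, ← mul_assoc]
  exact mul_le_mul_of_nonneg_right
    (hc.trans (mul_le_mul_of_nonneg_right hp (sq_nonneg c))) (sq_nonneg _)

/-- The weight κ² = r²/h² on τ is the one needing six powers of h, hence the Λ⁶ in the loss of
scaling. -/
theorem pow_mul_pow_le_of_abs_le_one {r h : ℝ} (hr : |r| ≤ 1) (hh : 0 < h) :
    r ^ 4 * h ^ 4 ≤ h ^ 6 * (r / h) ^ 2 := by
  have e : h ^ 6 * (r / h) ^ 2 = r ^ 2 * h ^ 4 := by field_simp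
  have hr2 : r ^ 2 ≤ 1 := by rw [← sq_abs]; exact pow_le_one₀ (abs_nonneg r) hr
  rw [e]
  exact mul_le_mul_of_nonneg_right (by nlinarith [sq_nonneg r]) (by positivity)

/-- The Lyapunov function is the energy plus `rotCorrection`. Among the scaled variables v and P
carry the weight r²h², whose square r⁴h⁴ = κ⁴/n⁸ is the decay rate. -/
theorem rot_decay {α m γ ρ₁ ρ₂ k b q Λ : ℝ} (hα : 0 < α) (hm : 0 < m) (hγ : 0 < γ)
    (hρ₁ : 0 < ρ₁) (hρ₂ : 0 < ρ₂) (hk : 0 < k) (hb : 0 < b) (hq : 0 ≤ q) (hΛ : 1 ≤ Λ) :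
    ∃ c > 0, ∀ κ n : ℝ, 0 < n → |κ| ≤ n → n⁻¹ ≤ Λ → ∀ v P u z τ s : ℝ → ℂ,
      RotODE κ n α m γ ρ₁ ρ₂ k b q v P u z τ s → (q = 0 → ∀ t, s t = 0) → ∀ t, 0 ≤ t →
      rotEnergy m γ ρ₁ ρ₂ k b (v t) (P t) (u t) (z t) (τ t) (s t) ≤
        3 * Real.exp (-(c * (κ ^ 4 / n ^ 8) * t)) *
          rotEnergy m γ ρ₁ ρ₂ k b (v 0) (P 0) (u 0) (z 0) (τ 0) (s 0) := by
  obtain ⟨K, hK, μ, hμ, hdis⟩ := exists_rot_dissipation hα hm hγ hρ₁ hρ₂ hk hb hq hΛ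
  have hγm : 0 < γ / m := by positivity
  let e₀ := min k (min ρ₁ (min ρ₂ (min b (γ / m))))
  have he₀ : 0 < e₀ := by positivity
  have a1 : e₀ ≤ k := min_le_left _ _
  have b1 : e₀ ≤ min ρ₁ (min ρ₂ (min b (γ / m))) := min_le_right _ _
  have a2 : e₀ ≤ ρ₁ := b1.trans (min_le_left _ _)
  have b2 := b1.trans (min_le_right _ _)
  have a3 : e₀ ≤ ρ₂ := b2.trans (min_le_left _ _)
  have b3 := b2.trans (min_le_right _ _)
  have a4 : e₀ ≤ b := b3.trans (min_le_left _ _)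
  have a5 : e₀ ≤ γ / m := b3.trans (min_le_right _ _)
  let e₁ := k + ρ₁ + ρ₂ + b + γ / m
  have he₁ : 0 < e₁ := by positivity
  -- 14 = 2 · 7: the correction has seven terms and must stay below half the energy.
  obtain ⟨ε, hε, hε₀, hε1, hsmall⟩ := exists_small_rotational hK hμ
    (ε₀ := e₀ / (14 * ((1 + m + ρ₁ + ρ₂) * Λ ^ 5))) (by positivity)
  rw [le_div_iff₀ (by positivity)] at hε₀
  -- The successive factors come from the hierarchy, from undoing the scaling (`Λ ^ 6`), from
  -- comparing the sum of squares with the energy (`e₁`), and from the half lost in `energy_decay`.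
  refine ⟨μ / 2 * ε ^ 32 / Λ ^ 6 / e₁ / 2, by positivity, ?_⟩
  intro κ n hn hκn hnΛ v P u z τ s H hs t ht
  obtain ⟨h, rfl⟩ : ∃ h, n = h⁻¹ := ⟨n⁻¹, by simp⟩
  have hh : 0 < h := inv_pos.1 hn
  obtain ⟨r, rfl⟩ : ∃ r, κ = r / h := ⟨κ * h, by field_simp⟩
  have hr : |r| ≤ 1 := by
    rw [abs_div, abs_of_pos hh, div_le_iff₀ hh, inv_mul_cancel₀ hh.ne'] at hκn
    exact hκn
  rw [inv_inv] at hnΛ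
  let N : ℝ → ℝ := fun t =>
    ‖v t‖ ^ 2 + ‖P t‖ ^ 2 + ‖u t‖ ^ 2 + ‖z t‖ ^ 2 + ‖τ t‖ ^ 2 + ‖s t‖ ^ 2
  let E : ℝ → ℝ := fun t => rotEnergy m γ ρ₁ ρ₂ k b (v t) (P t) (u t) (z t) (τ t) (s t)
  have hN0 : ∀ t, 0 ≤ N t := fun t => by simp only [N]; positivity
  have hE0 : ∀ t, e₀ * N t ≤ E t := fun t => by
    simp only [N, E, rotEnergy, mul_add]
    have := fun (x : ℝ) (c : ℝ) (hc : e₀ ≤ c) => mul_le_mul_of_nonneg_right hc (sq_nonneg x)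
    linarith [this ‖v t‖ _ a1, this ‖P t‖ _ a2, this ‖u t‖ _ a3, this ‖z t‖ _ a4,
      this ‖τ t‖ _ a5, this ‖s t‖ _ a5]
  have hE1 : ∀ t, E t ≤ e₁ * N t := fun t => by
    have := fun (x : ℝ) (c : ℝ) (hc : c ≤ e₁) => mul_le_mul_of_nonneg_right hc (sq_nonneg x)
    simp only [N, E, rotEnergy, mul_add]
    linarith [this ‖v t‖ k (by simp only [e₁]; linarith),
      this ‖P t‖ ρ₁ (by simp only [e₁]; linarith), this ‖u t‖ ρ₂ (by simp only [e₁]; linarith),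
      this ‖z t‖ b (by simp only [e₁]; linarith),
      this ‖τ t‖ (γ / m) (by simp only [e₁]; linarith),
      this ‖s t‖ (γ / m) (by simp only [e₁]; linarith)]
  have hmain := energy_decay (E := E) (μ := μ / 2 * ε ^ 32 / Λ ^ 6 / e₁) (r := r ^ 4 * h ^ 4)
    (by positivity) (fun t => H.hasDerivAt ε hm.ne' hρ₁.ne' hρ₂.ne' hh.ne' t) (fun t => ?_)
    (fun t => ?_) ht
  · have e : (r / h) ^ 4 / h⁻¹ ^ 8 = r ^ 4 * h ^ 4 := by field_simp
    rw [e]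
    exact hmain
  · simp only [E, add_sub_cancel_left]
    refine (abs_rotCorrection_le hm hρ₁ hρ₂ hr hh hnΛ hΛ hε hε1 _ _ _ _ _ _).trans ?_
    have h1 := mul_le_mul_of_nonneg_right hε₀ (hN0 t)
    have h2 := hE0 t
    change ε * (7 * ((1 + m + ρ₁ + ρ₂) * Λ ^ 5)) * N t ≤ E t / 2
    linarith
  · obtain ⟨d0, d1, d3, d2, d4, d5⟩ := hdis r h hr hh hnΛ ((r ^ 2 * h ^ 2) • v t)
      ((r ^ 2 * h ^ 2) • P t) (r ^ 2 • u t) ((r ^ 2 * h) • z t) ((r / h) • τ t) (r ^ 2 • s t)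
      (fun h0 => by rw [hs h0, smul_zero])
    have hs' := hsmall ‖(r / h) • τ t‖ ‖r ^ 2 • u t‖ ‖r ^ 2 • s t‖ ‖(r ^ 2 * h) • z t‖
      ‖(r ^ 2 * h ^ 2) • v t‖ ‖(r ^ 2 * h ^ 2) • P t‖ (norm_nonneg _) (norm_nonneg _)
      (norm_nonneg _) (norm_nonneg _) (norm_nonneg _) (norm_nonneg _)
    have d1' := mul_le_mul_of_nonneg_left d1 (pow_nonneg hε.le 22)
    have d2' := mul_le_mul_of_nonneg_left d2 (pow_nonneg hε.le 28)
    have d3' := mul_le_mul_of_nonneg_left d3 (pow_nonneg hε.le 20)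
    have d4' := mul_le_mul_of_nonneg_left d4 (pow_nonneg hε.le 30)
    have d5' := mul_le_mul_of_nonneg_left d5 (pow_nonneg hε.le 32)
    have hlow : r ^ 4 * h ^ 4 * N t ≤ Λ ^ 6 * (‖(r / h) • τ t‖ ^ 2 + ‖r ^ 2 • u t‖ ^ 2 +
        ‖r ^ 2 • s t‖ ^ 2 + ‖(r ^ 2 * h) • z t‖ ^ 2 + ‖(r ^ 2 * h ^ 2) • v t‖ ^ 2 +
        ‖(r ^ 2 * h ^ 2) • P t‖ ^ 2) := by
      have w := fun (x : ℂ) (c : ℝ) (i : ℕ) => mul_norm_sq_le_of_le (x := x) (c := c) (i := i)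
        (A := r ^ 4 * h ^ 4) hh hnΛ hΛ
      have w1 := w (τ t) (r / h) 6 le_rfl (pow_mul_pow_le_of_abs_le_one hr hh)
      have w2 := w (u t) (r ^ 2) 4 (by norm_num) (le_of_eq (by ring))
      have w3 := w (s t) (r ^ 2) 4 (by norm_num) (le_of_eq (by ring))
      have w4 := w (z t) (r ^ 2 * h) 2 (by norm_num) (le_of_eq (by ring))
      have w5 := w (v t) (r ^ 2 * h ^ 2) 0 (by norm_num) (le_of_eq (by ring))
      have w6 := w (P t) (r ^ 2 * h ^ 2) 0 (by norm_num) (le_of_eq (by ring))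
      simp only [N]
      linarith only [w1, w2, w3, w4, w5, w6]
    have hfin : μ / 2 * ε ^ 32 / Λ ^ 6 / e₁ * (r ^ 4 * h ^ 4) * E t ≤
        μ / 2 * ε ^ 32 * (‖(r / h) • τ t‖ ^ 2 + ‖r ^ 2 • u t‖ ^ 2 +
        ‖r ^ 2 • s t‖ ^ 2 + ‖(r ^ 2 * h) • z t‖ ^ 2 + ‖(r ^ 2 * h ^ 2) • v t‖ ^ 2 +
        ‖(r ^ 2 * h ^ 2) • P t‖ ^ 2) := by
      have h1 := mul_le_mul_of_nonneg_left (hE1 t)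
        (show 0 ≤ μ / 2 * ε ^ 32 / Λ ^ 6 / e₁ * (r ^ 4 * h ^ 4) by positivity)
      have h2 := mul_le_mul_of_nonneg_left hlow
        (show 0 ≤ μ / 2 * ε ^ 32 / Λ ^ 6 by positivity)
      have e1 : μ / 2 * ε ^ 32 / Λ ^ 6 / e₁ * (r ^ 4 * h ^ 4) * (e₁ * N t) =
          μ / 2 * ε ^ 32 / Λ ^ 6 * (r ^ 4 * h ^ 4 * N t) := by field_simp
      rw [e1] at h1
      refine h1.trans (h2.trans_eq ?_)
      rw [← mul_assoc]
      congr 1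
      field_simp
    linarith only [d0, d1', d2', d3', d4', d5', hs', hfin]

/-! ### Decay for the axial subsystem -/

/-- The equations of the axial subsystem at frequency `κ`, with `n = (κ² + l²)^(1/2)`. -/
structure AxialODE (κ n α m γ ρ₁ k₀ q : ℝ) (η W τ s : ℝ → ℂ) : Prop where
  hη : ∀ t, HasDerivAt η ((n : ℝ) * W t) t
  hW : ∀ t, HasDerivAt W ((n : ℝ) * (γ * τ t - k₀ * η t) / (ρ₁ : ℂ)) t
  hτ : ∀ t, HasDerivAt τ (Complex.I * (κ : ℝ) * q * s t - α * (κ : ℝ) ^ 2 * τ t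
    - m * ((n : ℝ) * W t)) t
  hs : ∀ t, HasDerivAt s (Complex.I * (κ : ℝ) * q * τ t) t

/-- The energy of the axial subsystem. -/
def axialEnergy (m γ ρ₁ k₀ : ℝ) (η W τ s : ℂ) : ℝ :=
  k₀ * ‖η‖ ^ 2 + ρ₁ * ‖W‖ ^ 2 + γ / m * (‖τ‖ ^ 2 + ‖s‖ ^ 2)

/-- The correction turning the energy of the axial subsystem into a Lyapunov function. -/
def axialCorrection (r h m ε : ℝ) (η W τ s : ℂ) : ℝ :=
  ε ^ 10 * (r ^ 2 * h * rp τ W) + ε ^ 12 * (r ^ 2 * h * rp W η)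
    - ε ^ 8 * (r ^ 3 * h * ip (τ + m * η) s)

section Identities

variable (r h α m γ ρ₁ k₀ q : ℝ) (η W τ s : ℂ)

theorem axial_identity_energy (hm : m ≠ 0) (hρ₁ : ρ₁ ≠ 0) (hh : h ≠ 0) :
    2 * (k₀ * rp ((h⁻¹ : ℝ) * W) η
      + ρ₁ * rp ((h⁻¹ : ℝ) * (γ * τ - k₀ * η) / (ρ₁ : ℂ)) W
      + γ / m * (rp (Complex.I * (r / h : ℝ) * q * s - α * (r / h : ℝ) ^ 2 * τ
          - m * ((h⁻¹ : ℝ) * W)) τ + rp (Complex.I * (r / h : ℝ) * q * τ) s)) =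
    -(2 * (γ / m * α) * rp ((r / h) • τ) ((r / h) • τ)) := by
  have : (ρ₁ : ℂ) ≠ 0 := by exact_mod_cast hρ₁
  rw [rp_smul]
  simp only [rp, div_eq_mul_inv, ← Complex.ofReal_inv]
  simp [sq]
  field_simp
  ring

/-- Recovers W from its appearance as a source in the heat equation. -/
theorem axial_identity₁ (hρ₁ : ρ₁ ≠ 0) (hh : h ≠ 0) :
    r ^ 2 * h * (rp (Complex.I * (r / h : ℝ) * q * s - α * (r / h : ℝ) ^ 2 * τ
          - m * ((h⁻¹ : ℝ) * W)) W
      + rp τ ((h⁻¹ : ℝ) * (γ * τ - k₀ * η) / (ρ₁ : ℂ))) =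
    -(q * ip (r ^ 2 • s) (r • W)) - α * r ^ 2 * rp ((r / h) • τ) (r • W)
      - m * rp (r • W) (r • W) + γ / ρ₁ * h ^ 2 * rp ((r / h) • τ) ((r / h) • τ)
      - k₀ / ρ₁ * h * rp ((r / h) • τ) (r • η) := by
  simp only [rp_smul, ip_smul]
  simp only [rp, ip, div_eq_mul_inv, ← Complex.ofReal_inv]
  simp [sq]
  field_simp
  ring

/-- Equipartition: recovers the strain η at the cost of |W|², which is already controlled. -/
theorem axial_identity₂ (hρ₁ : ρ₁ ≠ 0) (hh : h ≠ 0) :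
    r ^ 2 * h * (rp ((h⁻¹ : ℝ) * (γ * τ - k₀ * η) / (ρ₁ : ℂ)) η + rp W ((h⁻¹ : ℝ) * W)) =
    γ / ρ₁ * h * rp ((r / h) • τ) (r • η) - k₀ / ρ₁ * rp (r • η) (r • η)
      + rp (r • W) (r • W) := by
  simp only [rp_smul]
  simp only [rp, div_eq_mul_inv, ← Complex.ofReal_inv]
  simp
  field_simp
  ring

/-- Recovers the flux; W cancels in τ + mη. -/
theorem axial_identity₃ (hh : h ≠ 0) :
    r ^ 3 * h * (ip (Complex.I * (r / h : ℝ) * q * s - α * (r / h : ℝ) ^ 2 * τ) s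
      + ip (τ + m * η) (Complex.I * (r / h : ℝ) * q * τ)) =
    q * rp (r ^ 2 • s) (r ^ 2 • s) - α * r ^ 2 * ip ((r / h) • τ) (r ^ 2 • s)
      - q * (r ^ 2 * h ^ 2) * rp ((r / h) • τ) ((r / h) • τ)
      - q * m * (r ^ 2 * h) * rp ((r / h) • τ) (r • η) := by
  simp only [rp_smul, ip_smul]
  simp only [rp, ip, div_eq_mul_inv]
  simp [sq]
  field_simp
  ring

end Identities

theorem AxialODE.hasDerivAt {r h α m γ ρ₁ k₀ q : ℝ} {η W τ s : ℝ → ℂ}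
    (H : AxialODE (r / h) h⁻¹ α m γ ρ₁ k₀ q η W τ s) (ε : ℝ) (hm : m ≠ 0) (hρ₁ : ρ₁ ≠ 0)
    (hh : h ≠ 0) (t : ℝ) :
    HasDerivAt (fun t => axialEnergy m γ ρ₁ k₀ (η t) (W t) (τ t) (s t)
        + axialCorrection r h m ε (η t) (W t) (τ t) (s t))
      (-(2 * (γ / m * α) * rp ((r / h) • τ t) ((r / h) • τ t))
        + (ε ^ 10 * (-(q * ip (r ^ 2 • s t) (r • W t))
            - α * r ^ 2 * rp ((r / h) • τ t) (r • W t)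
            - m * rp (r • W t) (r • W t)
            + γ / ρ₁ * h ^ 2 * rp ((r / h) • τ t) ((r / h) • τ t)
            - k₀ / ρ₁ * h * rp ((r / h) • τ t) (r • η t))
          + ε ^ 12 * (γ / ρ₁ * h * rp ((r / h) • τ t) (r • η t)
            - k₀ / ρ₁ * rp (r • η t) (r • η t) + rp (r • W t) (r • W t))
          - ε ^ 8 * (q * rp (r ^ 2 • s t) (r ^ 2 • s t)
            - α * r ^ 2 * ip ((r / h) • τ t) (r ^ 2 • s t)
            - q * (r ^ 2 * h ^ 2) * rp ((r / h) • τ t) ((r / h) • τ t)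
            - q * m * (r ^ 2 * h) * rp ((r / h) • τ t) (r • η t)))) t := by
  have hT : HasDerivAt (fun t => τ t + m * η t)
      (Complex.I * (r / h : ℝ) * q * s t - α * (r / h : ℝ) ^ 2 * τ t) t :=
    ((H.hτ t).add ((H.hη t).const_mul (m : ℂ))).congr_deriv (by ring)
  rw [← axial_identity₁ r h α m γ ρ₁ k₀ q (η t) (W t) (τ t) (s t) hρ₁ hh,
    ← axial_identity₃ r h α m q (η t) (τ t) (s t) hh,
    ← axial_identity₂ r h γ ρ₁ k₀ (η t) (W t) (τ t) hρ₁ hh,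
    ← axial_identity_energy r h α m γ ρ₁ k₀ q (η t) (W t) (τ t) (s t) hm hρ₁ hh]
  simp only [axialEnergy, axialCorrection, ← rp_self]
  refine HasDerivAt.add ?_ ?_
  · refine ((((hasDerivAt_rp (H.hη t) (H.hη t)).const_mul k₀).add
      ((hasDerivAt_rp (H.hW t) (H.hW t)).const_mul ρ₁)).add
      (((hasDerivAt_rp (H.hτ t) (H.hτ t)).add
        (hasDerivAt_rp (H.hs t) (H.hs t))).const_mul (γ / m))).congr_deriv ?_
    have c : ∀ f g, rp f g = rp g f := fun f g => by simp only [rp]; ring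
    rw [c (η t), c (W t), c (τ t), c (s t)]
    ring
  · exact ((((hasDerivAt_rp (H.hτ t) (H.hW t)).const_mul (r ^ 2 * h)).const_mul (ε ^ 10)).add
      (((hasDerivAt_rp (H.hW t) (H.hη t)).const_mul (r ^ 2 * h)).const_mul (ε ^ 12))).sub
      (((hasDerivAt_ip hT (H.hs t)).const_mul (r ^ 3 * h)).const_mul (ε ^ 8))

/-- The coupling hierarchy for the axial subsystem. -/
theorem exists_small_axial {K μ : ℝ} (hK : 0 < K) (hμ : 0 < μ) {ε₀ : ℝ} (hε₀ : 0 < ε₀) :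
    ∃ ε > 0, ε ≤ ε₀ ∧ ε ≤ 1 ∧ ∀ T W S H : ℝ, 0 ≤ T → 0 ≤ W → 0 ≤ S → 0 ≤ H →
      -(μ * T ^ 2) + ε ^ 10 * (-(μ * W ^ 2) + K * (S * W + T * W + T * T + T * H))
        + ε ^ 8 * (-(μ * S ^ 2) + K * (T * S + T * T + T * H))
        + ε ^ 12 * (-(μ * H ^ 2) + K * (W * W + T * H)) ≤
      -(μ / 2 * ε ^ 12 * (T ^ 2 + W ^ 2 + S ^ 2 + H ^ 2)) := by
  -- 18 = 2 · 9, for the nine cross terms.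
  refine ⟨min (min ε₀ 1) (μ / (18 * K)), by positivity, (min_le_left _ _).trans (min_le_left _ _),
    (min_le_left _ _).trans (min_le_right _ _), ?_⟩
  have h0 : 0 < min (min ε₀ 1) (μ / (18 * K)) := by positivity
  have h1 : min (min ε₀ 1) (μ / (18 * K)) ≤ 1 := (min_le_left _ _).trans (min_le_right _ _)
  have h2 : min (min ε₀ 1) (μ / (18 * K)) ≤ μ / (18 * K) := min_le_right _ _
  generalize min (min ε₀ 1) (μ / (18 * K)) = ε at h0 h1 h2
  rw [le_div_iff₀ (by positivity)] at h2
  intro T W S H hT hW hS hH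
  have hpow : ∀ i, 1 ≤ i → ε ^ i ≤ ε := fun i hi => pow_le_of_le_one h0.le h1 (by omega)
  let N := T ^ 2 + (ε ^ 5 * W) ^ 2 + (ε ^ 4 * S) ^ 2 + (ε ^ 6 * H) ^ 2
  have hN : N = T ^ 2 + (ε ^ 5 * W) ^ 2 + (ε ^ 4 * S) ^ 2 + (ε ^ 6 * H) ^ 2 := rfl
  have key : ∀ (i : ℕ) (x y : ℝ), 1 ≤ i → x ^ 2 ≤ N → y ^ 2 ≤ N → 0 ≤ x → 0 ≤ y →
      ε ^ i * (x * y) ≤ ε * N := fun i x y hi hx2 hy2 hx hy =>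
    mul_le_mul (hpow i hi) (by nlinarith [sq_nonneg (x - y)]) (by positivity) h0.le
  have p1 := sq_nonneg T
  have p2 := sq_nonneg (ε ^ 5 * W)
  have p3 := sq_nonneg (ε ^ 4 * S)
  have p4 := sq_nonneg (ε ^ 6 * H)
  have nT : T ^ 2 ≤ N := by linarith
  have nW : (ε ^ 5 * W) ^ 2 ≤ N := by linarith
  have nS : (ε ^ 4 * S) ^ 2 ≤ N := by linarith
  have nH : (ε ^ 6 * H) ^ 2 ≤ N := by linarith
  have hW' : 0 ≤ ε ^ 5 * W := by positivity
  have hS' : 0 ≤ ε ^ 4 * S := by positivity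
  have hH' : 0 ≤ ε ^ 6 * H := by positivity
  have hN0 : 0 ≤ N := p1.trans nT
  have hle : ε ^ 12 * (T ^ 2 + W ^ 2 + S ^ 2 + H ^ 2) ≤ N := by
    have q : ∀ (i : ℕ) (x : ℝ), i ≤ 6 → ε ^ 12 * x ^ 2 ≤ (ε ^ i * x) ^ 2 := fun i x hi => by
      rw [mul_pow, ← pow_mul]
      exact mul_le_mul_of_nonneg_right (pow_le_pow_of_le_one h0.le h1 (by omega)) (sq_nonneg x)
    have q0 := q 0 T (by norm_num)
    rw [pow_zero, one_mul] at q0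
    linarith [q 5 W (by norm_num), q 4 S (by norm_num), q 6 H (by norm_num)]
  have k1 := key 1 _ _ (by norm_num) nS nW hS' hW'
  have k2 := key 5 _ _ (by norm_num) nT nW hT hW'
  have k3 := key 10 _ _ (by norm_num) nT nT hT hT
  have k4 := key 4 _ _ (by norm_num) nT nH hT hH'
  have k5 := key 4 _ _ (by norm_num) nT nS hT hS'
  have k6 := key 8 _ _ (by norm_num) nT nT hT hT
  have k7 := key 2 _ _ (by norm_num) nT nH hT hH'
  have k8 := key 2 _ _ (by norm_num) nW nW hW' hW'
  have k9 := key 6 _ _ (by norm_num) nT nH hT hH'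
  have hsum := mul_le_mul_of_nonneg_left (add_le_add (add_le_add (add_le_add (add_le_add
    (add_le_add (add_le_add (add_le_add (add_le_add k1 k2) k3) k4) k5) k6) k7) k8) k9) hK.le
  have hfin : -(μ * N) + K * (9 * (ε * N)) ≤ -(μ / 2 * N) := by
    have := mul_le_mul_of_nonneg_right h2 hN0
    linarith only [this]
  have hle' := mul_le_mul_of_nonneg_left hle (by positivity : 0 ≤ μ / 2)
  calc _ = -(μ * N) + K * (ε ^ 1 * (ε ^ 4 * S * (ε ^ 5 * W)) + ε ^ 5 * (T * (ε ^ 5 * W)) +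
        ε ^ 10 * (T * T) + ε ^ 4 * (T * (ε ^ 6 * H)) + ε ^ 4 * (T * (ε ^ 4 * S)) +
        ε ^ 8 * (T * T) + ε ^ 2 * (T * (ε ^ 6 * H)) + ε ^ 2 * (ε ^ 5 * W * (ε ^ 5 * W)) +
        ε ^ 6 * (T * (ε ^ 6 * H))) := by rw [hN]; ring
    _ ≤ -(μ * N) + K * (9 * (ε * N)) := by
        refine add_le_add le_rfl (hsum.trans_eq ?_)
        ring
    _ ≤ -(μ / 2 * N) := hfin
    _ ≤ _ := by rw [mul_assoc]; exact neg_le_neg hle'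

/-- Dissipation in the scaled variables of the axial subsystem. -/
theorem exists_axial_dissipation {α m γ ρ₁ k₀ q Λ : ℝ} (hα : 0 < α) (hm : 0 < m) (hγ : 0 < γ)
    (hρ₁ : 0 < ρ₁) (hk : 0 < k₀) (hq : 0 ≤ q) (hΛ : 1 ≤ Λ) :
    ∃ K > 0, ∃ μ > 0, ∀ r h : ℝ, |r| ≤ 1 → 0 < h → h ≤ Λ → ∀ H W T S : ℂ,
      (q = 0 → S = 0) →
      -(2 * (γ / m * α) * rp T T) ≤ -(μ * ‖T‖ ^ 2) ∧
      -(q * ip S W) - α * r ^ 2 * rp T W - m * rp W W + γ / ρ₁ * h ^ 2 * rp T T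
          - k₀ / ρ₁ * h * rp T H ≤
        -(μ * ‖W‖ ^ 2) + K * (‖S‖ * ‖W‖ + ‖T‖ * ‖W‖ + ‖T‖ * ‖T‖ + ‖T‖ * ‖H‖) ∧
      -(q * rp S S - α * r ^ 2 * ip T S - q * (r ^ 2 * h ^ 2) * rp T T
          - q * m * (r ^ 2 * h) * rp T H) ≤
        -(μ * ‖S‖ ^ 2) + K * (‖T‖ * ‖S‖ + ‖T‖ * ‖T‖ + ‖T‖ * ‖H‖) ∧
      γ / ρ₁ * h * rp T H - k₀ / ρ₁ * rp H H + rp W W ≤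
        -(μ * ‖H‖ ^ 2) + K * (‖W‖ * ‖W‖ + ‖T‖ * ‖H‖) := by
  let G := q + q * m + α + γ / ρ₁ + k₀ / ρ₁ + 1
  have g1 : 0 < γ / ρ₁ := by positivity
  have g2 : 0 < k₀ / ρ₁ := by positivity
  have g5 : 0 ≤ q * m := by positivity
  have hG : 0 < G := by positivity
  let μ := min (2 * (γ / m * α)) (min m (min (if q = 0 then 1 else q) (k₀ / ρ₁)))
  have hq' : 0 < if q = 0 then 1 else q := by
    split_ifs with h
    · exact one_pos
    · exact hq.lt_of_ne' h
  have hμ : 0 < μ := by positivity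
  have m1 : μ ≤ 2 * (γ / m * α) := min_le_left _ _
  have n1 : μ ≤ min m (min (if q = 0 then 1 else q) (k₀ / ρ₁)) := min_le_right _ _
  have m2 : μ ≤ m := n1.trans (min_le_left _ _)
  have n2 := n1.trans (min_le_right _ _)
  have m3 : μ ≤ if q = 0 then 1 else q := n2.trans (min_le_left _ _)
  have m4 : μ ≤ k₀ / ρ₁ := n2.trans (min_le_right _ _)
  refine ⟨G * Λ ^ 4, by positivity, μ, hμ, fun r h hr hh hhΛ H W T S hS => ?_⟩
  have bd : ∀ (c : ℝ) (i j : ℕ), 0 ≤ c → c ≤ G → j ≤ 4 → ∀ X Y : ℝ, |X| ≤ Y →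
      |c * (r ^ i * h ^ j) * X| ≤ G * Λ ^ 4 * Y := fun c i j hc hcG hj X Y hXY => by
    rw [abs_mul, abs_mul, abs_of_nonneg hc]
    have := abs_mul_pow_le (i := i) hr hh hhΛ hΛ hj
    gcongr
  have bd' : ∀ (c : ℝ) (i j : ℕ), 0 ≤ c → c ≤ G → j ≤ 4 → ∀ X Y : ℝ, |X| ≤ Y →
      c * (r ^ i * h ^ j) * X ≤ G * Λ ^ 4 * Y ∧ -(c * (r ^ i * h ^ j) * X) ≤ G * Λ ^ 4 * Y :=
    fun c i j hc hcG hj X Y hXY => abs_le'.1 (bd c i j hc hcG hj X Y hXY)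
  have sq : ∀ (X : ℂ) (c : ℝ), μ ≤ c → -(c * rp X X) ≤ -(μ * ‖X‖ ^ 2) := fun X c hc => by
    rw [rp_self]; exact neg_le_neg (by gcongr)
  have hS' : -(q * rp S S) ≤ -(μ * ‖S‖ ^ 2) := by
    by_cases h0 : q = 0
    · rw [hS h0, h0]; simp
    · rw [if_neg h0] at m3
      exact sq S q m3
  have gq : q ≤ G := by simp only [G]; linarith
  have gqm : q * m ≤ G := by simp only [G]; linarith
  have gα : α ≤ G := by simp only [G]; linarith
  have gγ : γ / ρ₁ ≤ G := by simp only [G]; linarith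
  have gk : k₀ / ρ₁ ≤ G := by simp only [G]; linarith
  have g1' : 1 ≤ G := by simp only [G]; linarith
  have z4 : (0 : ℕ) ≤ 4 := by norm_num
  have a := abs_rp_le
  have a' := abs_ip_le
  refine ⟨sq T _ m1, ?_, ?_, ?_⟩
  · have e1 := (bd' q 0 0 hq gq z4 _ _ (a' S W)).2
    have e2 := (bd' α 2 0 hα.le gα z4 _ _ (a T W)).2
    have e3 := (bd' (γ / ρ₁) 0 2 g1.le gγ (by norm_num) _ _ (a T T)).1
    have e4 := (bd' (k₀ / ρ₁) 0 1 g2.le gk (by norm_num) _ _ (a T H)).2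
    have e6 := sq W m m2
    simp only [pow_zero, pow_one, mul_one, one_mul] at e1 e2 e3 e4
    linarith only [e1, e2, e3, e4, e6]
  · have e2 := (bd' α 2 0 hα.le gα z4 _ _ (a' T S)).1
    have e3 := (bd' q 2 2 hq gq (by norm_num) _ _ (a T T)).1
    have e4 := (bd' (q * m) 2 1 g5 gqm (by norm_num) _ _ (a T H)).1
    simp only [pow_zero, pow_one, mul_one] at e2 e3 e4
    linarith only [e2, e3, e4, hS']
  · have e2 := (bd' (γ / ρ₁) 0 1 g1.le gγ (by norm_num) _ _ (a T H)).1
    have e3 := (bd' 1 0 0 zero_le_one g1' z4 _ _ (a W W)).1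
    have e6 := sq H _ m4
    simp only [pow_zero, pow_one, one_mul, mul_one] at e2 e3
    linarith only [e2, e3, e6]

theorem abs_axialCorrection_le {r h m ε Λ : ℝ} (hm : 0 < m)
    (hr : |r| ≤ 1) (hh : 0 < h) (hhΛ : h ≤ Λ) (hΛ : 1 ≤ Λ) (hε : 0 < ε) (hε1 : ε ≤ 1)
    (η W τ s : ℂ) :
    |axialCorrection r h m ε η W τ s| ≤
      ε * (4 * ((1 + m) * Λ)) * (‖η‖ ^ 2 + ‖W‖ ^ 2 + ‖τ‖ ^ 2 + ‖s‖ ^ 2) := by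
  set G := 1 + m with hG
  set N := ‖η‖ ^ 2 + ‖W‖ ^ 2 + ‖τ‖ ^ 2 + ‖s‖ ^ 2 with hN
  have hG0 : 0 < G := by positivity
  have hN0 : 0 ≤ N := by positivity
  have bd : ∀ (c : ℝ) (e i : ℕ), 0 ≤ c → c ≤ G → 1 ≤ e → ∀ X : ℝ, |X| ≤ N →
      |ε ^ e * (c * (r ^ i * h ^ 1) * X)| ≤ ε * (G * Λ) * N := fun c e i hc hcG he X hX => by
    rw [abs_mul, abs_mul, abs_mul, abs_of_nonneg hc, abs_of_nonneg (pow_nonneg hε.le e)]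
    have h1 := abs_mul_pow_le (i := i) hr hh hhΛ hΛ (le_refl 1)
    rw [pow_one Λ] at h1
    have h2 : ε ^ e ≤ ε := pow_le_of_le_one hε.le hε1 (by omega)
    calc _ ≤ ε * (G * Λ * N) := by gcongr
      _ = _ := by ring
  have pr : ∀ x y : ℂ, ‖x‖ ^ 2 + ‖y‖ ^ 2 ≤ 2 * N → |rp x y| ≤ N := fun x y h =>
    (abs_rp_le x y).trans (by nlinarith [sq_nonneg (‖x‖ - ‖y‖)])
  have pi : ∀ x y : ℂ, ‖x‖ ^ 2 + ‖y‖ ^ 2 ≤ 2 * N → |ip x y| ≤ N := fun x y h =>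
    (abs_ip_le x y).trans (by nlinarith [sq_nonneg (‖x‖ - ‖y‖)])
  have q1 := sq_nonneg ‖η‖
  have q2 := sq_nonneg ‖W‖
  have q3 := sq_nonneg ‖τ‖
  have q4 := sq_nonneg ‖s‖
  have e1 := bd 1 10 2 zero_le_one (by linarith) (by norm_num) _ (pr τ W (by linarith))
  have e2 := bd 1 12 2 zero_le_one (by linarith) (by norm_num) _ (pr W η (by linarith))
  have e3 := bd 1 8 3 zero_le_one (by linarith) (by norm_num) _ (pi τ s (by linarith))
  have e4 := bd m 8 3 hm.le (by linarith) (by norm_num) _ (pi η s (by linarith))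
  have hexp : axialCorrection r h m ε η W τ s =
      ε ^ 10 * (1 * (r ^ 2 * h ^ 1) * rp τ W) + ε ^ 12 * (1 * (r ^ 2 * h ^ 1) * rp W η)
      - ε ^ 8 * (1 * (r ^ 3 * h ^ 1) * ip τ s) - ε ^ 8 * (m * (r ^ 3 * h ^ 1) * ip η s) := by
    have a1 : ip (τ + m * η) s = ip τ s + m * ip η s := by simp [ip]; ring
    rw [axialCorrection, a1]
    ring
  rw [hexp]
  rw [abs_le] at *
  constructor <;> linarith only [e1.1, e1.2, e2.1, e2.2, e3.1, e3.2, e4.1, e4.2]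

/-- Here W and η are controlled with weight r and s with r², so the dissipation dominates a multiple
of r⁴ times the energy. The smaller rate r⁴h⁴ is kept to match the rotational block. -/
theorem axial_decay {α m γ ρ₁ k₀ q Λ : ℝ} (hα : 0 < α) (hm : 0 < m) (hγ : 0 < γ)
    (hρ₁ : 0 < ρ₁) (hk : 0 < k₀) (hq : 0 ≤ q) (hΛ : 1 ≤ Λ) :
    ∃ c > 0, ∀ κ n : ℝ, 0 < n → |κ| ≤ n → n⁻¹ ≤ Λ → ∀ η W τ s : ℝ → ℂ,
      AxialODE κ n α m γ ρ₁ k₀ q η W τ s → (q = 0 → ∀ t, s t = 0) → ∀ t, 0 ≤ t →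
      axialEnergy m γ ρ₁ k₀ (η t) (W t) (τ t) (s t) ≤
        3 * Real.exp (-(c * (κ ^ 4 / n ^ 8) * t)) *
          axialEnergy m γ ρ₁ k₀ (η 0) (W 0) (τ 0) (s 0) := by
  obtain ⟨K, hK, μ, hμ, hdis⟩ := exists_axial_dissipation hα hm hγ hρ₁ hk hq hΛ
  have hγm : 0 < γ / m := by positivity
  let e₀ := min k₀ (min ρ₁ (γ / m))
  have he₀ : 0 < e₀ := by positivity
  have a1 : e₀ ≤ k₀ := min_le_left _ _
  have b1 : e₀ ≤ min ρ₁ (γ / m) := min_le_right _ _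
  have a2 : e₀ ≤ ρ₁ := b1.trans (min_le_left _ _)
  have a5 : e₀ ≤ γ / m := b1.trans (min_le_right _ _)
  let e₁ := k₀ + ρ₁ + γ / m
  have he₁ : 0 < e₁ := by positivity
  obtain ⟨ε, hε, hε₀, hε1, hsmall⟩ := exists_small_axial hK hμ
    (ε₀ := e₀ / (8 * ((1 + m) * Λ))) (by positivity)
  rw [le_div_iff₀ (by positivity)] at hε₀
  refine ⟨μ / 2 * ε ^ 12 / Λ ^ 6 / e₁ / 2, by positivity, ?_⟩
  intro κ n hn hκn hnΛ η W τ s H hs t ht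
  obtain ⟨h, rfl⟩ : ∃ h, n = h⁻¹ := ⟨n⁻¹, by simp⟩
  have hh : 0 < h := inv_pos.1 hn
  obtain ⟨r, rfl⟩ : ∃ r, κ = r / h := ⟨κ * h, by field_simp⟩
  have hr : |r| ≤ 1 := by
    rw [abs_div, abs_of_pos hh, div_le_iff₀ hh, inv_mul_cancel₀ hh.ne'] at hκn
    exact hκn
  rw [inv_inv] at hnΛ
  let N : ℝ → ℝ := fun t => ‖η t‖ ^ 2 + ‖W t‖ ^ 2 + ‖τ t‖ ^ 2 + ‖s t‖ ^ 2
  let E : ℝ → ℝ := fun t => axialEnergy m γ ρ₁ k₀ (η t) (W t) (τ t) (s t)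
  have hN0 : ∀ t, 0 ≤ N t := fun t => by simp only [N]; positivity
  have hE0 : ∀ t, e₀ * N t ≤ E t := fun t => by
    simp only [N, E, axialEnergy, mul_add]
    have := fun (x : ℝ) (c : ℝ) (hc : e₀ ≤ c) => mul_le_mul_of_nonneg_right hc (sq_nonneg x)
    linarith [this ‖η t‖ _ a1, this ‖W t‖ _ a2, this ‖τ t‖ _ a5, this ‖s t‖ _ a5]
  have hE1 : ∀ t, E t ≤ e₁ * N t := fun t => by
    have := fun (x : ℝ) (c : ℝ) (hc : c ≤ e₁) => mul_le_mul_of_nonneg_right hc (sq_nonneg x)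
    simp only [N, E, axialEnergy, mul_add]
    linarith [this ‖η t‖ k₀ (by simp only [e₁]; linarith),
      this ‖W t‖ ρ₁ (by simp only [e₁]; linarith),
      this ‖τ t‖ (γ / m) (by simp only [e₁]; linarith),
      this ‖s t‖ (γ / m) (by simp only [e₁]; linarith)]
  have hmain := energy_decay (E := E) (μ := μ / 2 * ε ^ 12 / Λ ^ 6 / e₁) (r := r ^ 4 * h ^ 4)
    (by positivity) (fun t => H.hasDerivAt ε hm.ne' hρ₁.ne' hh.ne' t) (fun t => ?_)
    (fun t => ?_) ht
  · have e : (r / h) ^ 4 / h⁻¹ ^ 8 = r ^ 4 * h ^ 4 := by field_simp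
    rw [e]
    exact hmain
  · simp only [E, add_sub_cancel_left]
    refine (abs_axialCorrection_le hm hr hh hnΛ hΛ hε hε1 _ _ _ _).trans ?_
    have h1 := mul_le_mul_of_nonneg_right hε₀ (hN0 t)
    have h2 := hE0 t
    change ε * (4 * ((1 + m) * Λ)) * N t ≤ E t / 2
    linarith
  · obtain ⟨d0, d1, d3, d2⟩ := hdis r h hr hh hnΛ (r • η t) (r • W t) ((r / h) • τ t) (r ^ 2 • s t)
      (fun h0 => by rw [hs h0, smul_zero])
    have hs' := hsmall ‖(r / h) • τ t‖ ‖r • W t‖ ‖r ^ 2 • s t‖ ‖r • η t‖ (norm_nonneg _)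
      (norm_nonneg _) (norm_nonneg _) (norm_nonneg _)
    have d1' := mul_le_mul_of_nonneg_left d1 (pow_nonneg hε.le 10)
    have d2' := mul_le_mul_of_nonneg_left d2 (pow_nonneg hε.le 12)
    have d3' := mul_le_mul_of_nonneg_left d3 (pow_nonneg hε.le 8)
    have hlow : r ^ 4 * h ^ 4 * N t ≤ Λ ^ 6 * (‖(r / h) • τ t‖ ^ 2 + ‖r • W t‖ ^ 2 +
        ‖r ^ 2 • s t‖ ^ 2 + ‖r • η t‖ ^ 2) := by
      have w := fun (x : ℂ) (c : ℝ) (i : ℕ) => mul_norm_sq_le_of_le (x := x) (c := c) (i := i)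
        (A := r ^ 4 * h ^ 4) hh hnΛ hΛ
      have h1 := pow_mul_pow_le_of_abs_le_one hr hh
      have h2 : r ^ 4 * h ^ 4 ≤ h ^ 4 * r ^ 2 := h1.trans_eq (by field_simp)
      have w1 := w (τ t) (r / h) 6 le_rfl h1
      have w2 := w (W t) r 4 (by norm_num) h2
      have w3 := w (s t) (r ^ 2) 4 (by norm_num) (le_of_eq (by ring))
      have w4 := w (η t) r 4 (by norm_num) h2
      simp only [N]
      linarith only [w1, w2, w3, w4]
    have hfin : μ / 2 * ε ^ 12 / Λ ^ 6 / e₁ * (r ^ 4 * h ^ 4) * E t ≤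
        μ / 2 * ε ^ 12 * (‖(r / h) • τ t‖ ^ 2 + ‖r • W t‖ ^ 2 +
        ‖r ^ 2 • s t‖ ^ 2 + ‖r • η t‖ ^ 2) := by
      have h1 := mul_le_mul_of_nonneg_left (hE1 t)
        (show 0 ≤ μ / 2 * ε ^ 12 / Λ ^ 6 / e₁ * (r ^ 4 * h ^ 4) by positivity)
      have h2 := mul_le_mul_of_nonneg_left hlow
        (show 0 ≤ μ / 2 * ε ^ 12 / Λ ^ 6 by positivity)
      have e1 : μ / 2 * ε ^ 12 / Λ ^ 6 / e₁ * (r ^ 4 * h ^ 4) * (e₁ * N t) =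
          μ / 2 * ε ^ 12 / Λ ^ 6 * (r ^ 4 * h ^ 4 * N t) := by field_simp
      rw [e1] at h1
      refine h1.trans (h2.trans_eq ?_)
      rw [← mul_assoc]
      congr 1
      field_simp
    linarith only [d0, d1', d2', d3', hs', hfin]

/-! ### The Bresse system on the Fourier side -/

/-- The Fourier transform of the Bresse system at frequency `κ`; `α₁, α₂` are the diffusivities and
`q₁, q₂` the couplings to the thermal fluxes `s₁, s₂`. -/
structure FourierODE (c : Coeffs) (α₁ α₂ q₁ q₂ κ : ℝ)
    (u₁ u₂ u₃ τ₁ s₁ τ₂ s₂ z v η : ℝ → ℂ) : Prop where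
  hu₁ : ∀ t, HasDerivAt u₁ ((Complex.I * κ * c.k * v t + c.k₀ * c.l * η t
    - c.l * c.γ * τ₁ t) / (c.ρ₁ : ℂ)) t
  hu₂ : ∀ t, HasDerivAt u₂ ((Complex.I * κ * c.b * z t + c.k * v t
    - Complex.I * κ * c.γ * τ₂ t) / (c.ρ₂ : ℂ)) t
  hu₃ : ∀ t, HasDerivAt u₃ ((Complex.I * κ * c.k₀ * η t + c.k * c.l * v t
    - Complex.I * κ * c.γ * τ₁ t) / (c.ρ₁ : ℂ)) t
  hτ₁ : ∀ t, HasDerivAt τ₁ (Complex.I * κ * q₁ * s₁ t - α₁ * κ ^ 2 * τ₁ t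
    - c.m₁ * (Complex.I * κ * u₃ t - c.l * u₁ t)) t
  hs₁ : ∀ t, HasDerivAt s₁ (Complex.I * κ * q₁ * τ₁ t) t
  hτ₂ : ∀ t, HasDerivAt τ₂ (Complex.I * κ * q₂ * s₂ t - α₂ * κ ^ 2 * τ₂ t
    - c.m₂ * (Complex.I * κ * u₂ t)) t
  hs₂ : ∀ t, HasDerivAt s₂ (Complex.I * κ * q₂ * τ₂ t) t
  hz : ∀ t, HasDerivAt z (Complex.I * κ * u₂ t) t
  hv : ∀ t, HasDerivAt v (Complex.I * κ * u₁ t - u₂ t - c.l * u₃ t) t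
  hη : ∀ t, HasDerivAt η (Complex.I * κ * u₃ t - c.l * u₁ t) t

/-- The energy density on the Fourier side. -/
def fourierEnergy (c : Coeffs) (u₁ u₂ u₃ τ₁ s₁ τ₂ s₂ z v η : ℂ) : ℝ :=
  c.ρ₁ * ‖u₁‖ ^ 2 + c.ρ₂ * ‖u₂‖ ^ 2 + c.ρ₁ * ‖u₃‖ ^ 2 + c.γ / c.m₁ * (‖τ₁‖ ^ 2 + ‖s₁‖ ^ 2)
    + c.γ / c.m₂ * (‖τ₂‖ ^ 2 + ‖s₂‖ ^ 2) + c.b * ‖z‖ ^ 2 + c.k * ‖v‖ ^ 2 + c.k₀ * ‖η‖ ^ 2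

/-! ### Splitting the Fourier system into two blocks -/

section Decoupling

variable {c : Coeffs} {α₁ α₂ q₁ q₂ κ n : ℝ} {u₁ u₂ u₃ τ₁ s₁ τ₂ s₂ z v η : ℝ → ℂ}

/-- In the combination iκu₃ - lu₁ the shear forces cancel, while the axial and thermal forces add up
to the factor κ² + l² = n². -/
theorem FourierODE.axial (H : FourierODE c α₁ α₂ q₁ q₂ κ u₁ u₂ u₃ τ₁ s₁ τ₂ s₂ z v η)
    (hn : 0 < n) (hκ : n ^ 2 = κ ^ 2 + c.l ^ 2) :
    AxialODE κ n α₁ c.m₁ c.γ c.ρ₁ c.k₀ q₁ η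
      (fun t => (Complex.I * κ * u₃ t - c.l * u₁ t) / (n : ℂ)) τ₁ s₁ := by
  have hn' : (n : ℂ) ≠ 0 := by exact_mod_cast hn.ne'
  have hρ : (c.ρ₁ : ℂ) ≠ 0 := by exact_mod_cast c.ρ₁_pos.ne'
  have hκ' : (n : ℂ) ^ 2 = κ ^ 2 + c.l ^ 2 := by exact_mod_cast hκ
  refine ⟨fun t => ?_, fun t => ?_, fun t => ?_, H.hs₁⟩
  · rw [mul_div_cancel₀ _ hn']
    exact H.hη t
  · refine ((((H.hu₃ t).const_mul (Complex.I * κ)).sub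
      ((H.hu₁ t).const_mul (c.l : ℂ))).div_const (n : ℂ)).congr_deriv ?_
    field_simp
    linear_combination (norm := (ring_nf; simp only [Complex.I_sq]; ring))
      (c.k₀ * η t - c.γ * τ₁ t) * hκ'
  · rw [mul_div_cancel₀ _ hn']
    exact H.hτ₁ t

/-- In the combination iκu₁ - lu₃ the axial and thermal forces cancel, and the shear force acquires
the factor n². -/
theorem FourierODE.rot (H : FourierODE c α₁ α₂ q₁ q₂ κ u₁ u₂ u₃ τ₁ s₁ τ₂ s₂ z v η)
    (hn : 0 < n) (hκ : n ^ 2 = κ ^ 2 + c.l ^ 2) :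
    RotODE κ n α₂ c.m₂ c.γ c.ρ₁ c.ρ₂ c.k c.b q₂ v
      (fun t => (Complex.I * κ * u₁ t - c.l * u₃ t) / (n : ℂ)) u₂ z τ₂ s₂ := by
  have hn' : (n : ℂ) ≠ 0 := by exact_mod_cast hn.ne'
  have hρ : (c.ρ₁ : ℂ) ≠ 0 := by exact_mod_cast c.ρ₁_pos.ne'
  have hκ' : (n : ℂ) ^ 2 = κ ^ 2 + c.l ^ 2 := by exact_mod_cast hκ
  refine ⟨fun t => ?_, fun t => ?_, H.hu₂, H.hz, H.hτ₂, H.hs₂⟩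
  · rw [mul_div_cancel₀ _ hn']
    exact (H.hv t).congr_deriv (by ring)
  · refine ((((H.hu₁ t).const_mul (Complex.I * κ)).sub
      ((H.hu₃ t).const_mul (c.l : ℂ))).div_const (n : ℂ)).congr_deriv ?_
    push_cast
    field_simp
    linear_combination (norm := (ring_nf; simp only [Complex.I_sq]; ring))
      (c.k * v t) * hκ'

/-- The change of velocities is unitary: the cross terms are the real part of i times a real number.
The energies of the blocks therefore add up exactly. -/
theorem fourierEnergy_eq (hn : 0 < n) (hκ : n ^ 2 = κ ^ 2 + c.l ^ 2)
    (u₁ u₂ u₃ τ₁ s₁ τ₂ s₂ z v η : ℂ) :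
    fourierEnergy c u₁ u₂ u₃ τ₁ s₁ τ₂ s₂ z v η =
      axialEnergy c.m₁ c.γ c.ρ₁ c.k₀ η ((Complex.I * κ * u₃ - c.l * u₁) / (n : ℂ)) τ₁ s₁ +
      rotEnergy c.m₂ c.γ c.ρ₁ c.ρ₂ c.k c.b v ((Complex.I * κ * u₁ - c.l * u₃) / (n : ℂ)) u₂ z
        τ₂ s₂ := by
  have h : ‖(Complex.I * κ * u₃ - c.l * u₁) / (n : ℂ)‖ ^ 2 +
      ‖(Complex.I * κ * u₁ - c.l * u₃) / (n : ℂ)‖ ^ 2 = ‖u₁‖ ^ 2 + ‖u₃‖ ^ 2 := by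
    rw [norm_div, norm_div, div_pow, div_pow, Complex.norm_real, Real.norm_eq_abs, sq_abs,
      ← add_div, div_eq_iff (by positivity), hκ]
    simp only [← rp_self, rp]
    simp
    ring
  rw [fourierEnergy, axialEnergy, rotEnergy]
  linear_combination (-c.ρ₁) * h

end Decoupling

theorem rate_le {l : ℝ} {ξ κ n : ℝ} (hn : 0 < n) (hκ : κ = 2 * Real.pi * ξ)
    (hn2 : n ^ 2 = κ ^ 2 + l ^ 2) :
    rate ξ / (4 * Real.pi ^ 2 + l ^ 2) ^ 4 ≤ κ ^ 4 / n ^ 8 := by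
  have hπ := Real.two_le_pi
  have h1 : n ^ 2 ≤ (4 * Real.pi ^ 2 + l ^ 2) * (1 + ξ ^ 2) := by
    rw [hn2, hκ]
    nlinarith [sq_nonneg (l * ξ), sq_nonneg Real.pi]
  have h2 : n ^ 8 ≤ (4 * Real.pi ^ 2 + l ^ 2) ^ 4 * (1 + ξ ^ 2) ^ 4 := by
    rw [← mul_pow, show n ^ 8 = (n ^ 2) ^ 4 by ring]
    gcongr
  have h3 : ξ ^ 4 ≤ κ ^ 4 := by
    rw [hκ, mul_pow]
    exact le_mul_of_one_le_left (by positivity) (one_le_pow₀ (by linarith))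
  rw [rate, div_div, mul_comm ((1 + ξ ^ 2) ^ 4)]
  gcongr

/-- Exponential decay at each frequency, for all values of the coefficients. -/
theorem exists_fourier_decay (c : Coeffs) {α₁ α₂ q₁ q₂ : ℝ} (hα₁ : 0 < α₁) (hα₂ : 0 < α₂)
    (hq₁ : 0 ≤ q₁) (hq₂ : 0 ≤ q₂) :
    ∃ C > 0, ∀ ξ : ℝ, ∀ u₁ u₂ u₃ τ₁ s₁ τ₂ s₂ z v η : ℝ → ℂ,
      FourierODE c α₁ α₂ q₁ q₂ (2 * Real.pi * ξ) u₁ u₂ u₃ τ₁ s₁ τ₂ s₂ z v η →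
      (q₁ = 0 → ∀ t, s₁ t = 0) → (q₂ = 0 → ∀ t, s₂ t = 0) → ∀ t, 0 ≤ t →
      fourierEnergy c (u₁ t) (u₂ t) (u₃ t) (τ₁ t) (s₁ t) (τ₂ t) (s₂ t) (z t) (v t) (η t) ≤
        3 * Real.exp (-(C * rate ξ * t)) *
          fourierEnergy c (u₁ 0) (u₂ 0) (u₃ 0) (τ₁ 0) (s₁ 0) (τ₂ 0) (s₂ 0) (z 0) (v 0) (η 0) := by
  have hl := c.l_pos
  -- n ≥ l bounds h = 1/n uniformly in the frequency; this is where positivity of `l` enters.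
  have hΛ : 1 ≤ max 1 c.l⁻¹ := le_max_left _ _
  obtain ⟨c₁, hc₁, h₁⟩ := axial_decay hα₁ c.m₁_pos c.γ_pos c.ρ₁_pos c.k₀_pos hq₁ hΛ
  obtain ⟨c₂, hc₂, h₂⟩ := rot_decay hα₂ c.m₂_pos c.γ_pos c.ρ₁_pos c.ρ₂_pos c.k_pos c.b_pos hq₂ hΛ
  have hM : 0 < (4 * Real.pi ^ 2 + c.l ^ 2) ^ 4 := by positivity
  refine ⟨min c₁ c₂ / (4 * Real.pi ^ 2 + c.l ^ 2) ^ 4, by positivity, ?_⟩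
  intro ξ u₁ u₂ u₃ τ₁ s₁ τ₂ s₂ z v η H hs₁ hs₂ t ht
  set κ := 2 * Real.pi * ξ with hκ
  set n := √(κ ^ 2 + c.l ^ 2) with hndef
  have hn : 0 < n := by positivity
  have hn2 : n ^ 2 = κ ^ 2 + c.l ^ 2 := Real.sq_sqrt (by positivity)
  have hκn : |κ| ≤ n := Real.abs_le_sqrt (by linarith [sq_nonneg c.l])
  have hln : c.l ≤ n := Real.le_sqrt_of_sq_le (by linarith [sq_nonneg κ])
  have hnΛ : n⁻¹ ≤ max 1 c.l⁻¹ := (inv_anti₀ hl hln).trans (le_max_right _ _)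
  have e₁ := h₁ κ n hn hκn hnΛ _ _ _ _ (H.axial hn hn2) hs₁ t ht
  have e₂ := h₂ κ n hn hκn hnΛ _ _ _ _ _ _ (H.rot hn hn2) hs₂ t ht
  have hr := rate_le hn hκ hn2
  have hr0 := rate_nonneg ξ
  have hexp : ∀ c', min c₁ c₂ ≤ c' → Real.exp (-(c' * (κ ^ 4 / n ^ 8) * t)) ≤
      Real.exp (-(min c₁ c₂ / (4 * Real.pi ^ 2 + c.l ^ 2) ^ 4 * rate ξ * t)) := fun c' hc' => by
    have h0 : 0 < min c₁ c₂ := by positivity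
    refine Real.exp_le_exp.2 (neg_le_neg ?_)
    rw [div_mul_eq_mul_div, mul_div_assoc]
    gcongr
    exact h0.le.trans hc'
  have hγm₁ : 0 ≤ c.γ / c.m₁ := (div_pos c.γ_pos c.m₁_pos).le
  have hγm₂ : 0 ≤ c.γ / c.m₂ := (div_pos c.γ_pos c.m₂_pos).le
  have p₁ := c.ρ₁_pos.le
  have p₂ := c.ρ₂_pos.le
  have p₃ := c.k_pos.le
  have p₄ := c.k₀_pos.le
  have p₅ := c.b_pos.le
  rw [fourierEnergy_eq hn hn2, fourierEnergy_eq hn hn2, mul_add]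
  refine add_le_add (e₁.trans ?_) (e₂.trans ?_)
  · have := hexp c₁ (min_le_left _ _)
    refine mul_le_mul_of_nonneg_right (by gcongr) ?_
    unfold axialEnergy
    positivity
  · have := hexp c₂ (min_le_right _ _)
    refine mul_le_mul_of_nonneg_right (by gcongr) ?_
    unfold rotEnergy
    positivity

/-! ### Rescaled systems -/

variable {d : ℕ}

/-- The system satisfied by the rescaled unknowns `w a * f a`. -/
def Pencil.rescale (A : Pencil d) (w : Fin d → ℝ) : Pencil d where
  A₀ a b := w a * A.A₀ a b / w b
  A₁ a b := w a * A.A₁ a b / w b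
  A₂ a b := w a * A.A₂ a b / w b

theorem Pencil.rescale_symbol (A : Pencil d) (w : Fin d → ℝ) (ξ : ℝ) (a b : Fin d) :
    (A.rescale w).symbol ξ a b = w a * A.symbol ξ a b / w b := by
  simp only [Pencil.symbol, Pencil.rescale]
  push_cast
  ring

theorem Pencil.isWeakSolution_rescale {A : Pencil d} {w : Fin d → ℝ} (hw : ∀ a, w a ≠ 0)
    {f : Fin d → ℝ → ℝ → ℝ} {V : ℝ → ℝ → EuclideanSpace ℝ (Fin d)}
    (hV : ∀ a t x, V t x a = w a * f a t x)
    (H : ∀ (a : Fin d) (χ : ℝ → ℝ), IsTest χ → ∀ t : ℝ, 0 ≤ t →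
      HasDerivWithinAt (fun τ => ∫ x, f a τ x * χ x)
        (∑ b, (A.A₀ a b * (∫ x, f b t x * χ x) - A.A₁ a b * (∫ x, f b t x * deriv χ x)
          + A.A₂ a b * (∫ x, f b t x * iteratedDeriv 2 χ x))) (Ici 0) t) :
    (A.rescale w).IsWeakSolution V := by
  intro a χ hχ t ht
  simp only [hV, mul_assoc, integral_const_mul]
  refine ((H a χ hχ t ht).const_mul (w a)).congr_deriv ?_
  rw [Finset.mul_sum]
  refine Finset.sum_congr rfl fun b _ => ?_
  have := hw b
  simp only [Pencil.rescale]
  field_simp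

theorem exp_zero_smul_matAct (M : Fin d → Fin d → ℂ) (x : Fin d → ℂ) :
    NormedSpace.exp ((0 : ℝ) • matAct M) x = x := by
  have h : (0 : ℝ) • matAct M = 0 := by ext; simp
  rw [h, NormedSpace.exp_zero]
  rfl

/-- The components of a solution at a given frequency, in the original unknowns. -/
theorem Pencil.hasDerivAt_rescale (A : Pencil d) {w : Fin d → ℝ} (hw : ∀ a, w a ≠ 0) (ξ : ℝ)
    (x : Fin d → ℂ) (a : Fin d) (t : ℝ) :
    HasDerivAt (fun t : ℝ => NormedSpace.exp (t • matAct ((A.rescale w).symbol ξ)) x a / (w a : ℂ))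
      (∑ b, A.symbol ξ a b *
        (NormedSpace.exp (t • matAct ((A.rescale w).symbol ξ)) x b / (w b : ℂ))) t := by
  set T := matAct ((A.rescale w).symbol ξ) with hT
  have h1 : HasDerivAt (fun s : ℝ => NormedSpace.exp (s • T) x)
      (T (NormedSpace.exp (t • T) x)) t :=
    (((ContinuousLinearMap.apply ℂ (Fin d → ℂ) x).restrictScalars
      ℝ).hasFDerivAt.comp_hasDerivAt t (hasDerivAt_exp_smul_const' T t))
  refine ((hasDerivAt_pi.1 h1 a).div_const (w a : ℂ)).congr_deriv ?_
  have hwa : (w a : ℂ) ≠ 0 := by exact_mod_cast hw a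
  rw [div_eq_iff hwa]
  generalize NormedSpace.exp (t • T) x = y
  rw [hT, matAct_apply, Finset.sum_mul]
  refine Finset.sum_congr rfl fun b _ => ?_
  rw [Pencil.rescale_symbol]
  ring

/-! ### The two systems -/

/-- The system of Type I for `(φt, ψt, ωt, θ₁, θ₂, ψx, φx - ψ - lω, ωx - lφ)`. -/
def pencilI (c : Coeffs) : Pencil 8 where
  A₀ := ![![0, 0, 0, -(c.l * c.γ / c.ρ₁), 0, 0, 0, c.k₀ * c.l / c.ρ₁],
    ![0, 0, 0, 0, 0, 0, c.k / c.ρ₂, 0],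
    ![0, 0, 0, 0, 0, 0, c.k * c.l / c.ρ₁, 0],
    ![c.m₁ * c.l, 0, 0, 0, 0, 0, 0, 0],
    ![0, 0, 0, 0, 0, 0, 0, 0],
    ![0, 0, 0, 0, 0, 0, 0, 0],
    ![0, -1, -c.l, 0, 0, 0, 0, 0],
    ![-c.l, 0, 0, 0, 0, 0, 0, 0]]
  A₁ := ![![0, 0, 0, 0, 0, 0, c.k / c.ρ₁, 0],
    ![0, 0, 0, 0, -(c.γ / c.ρ₂), c.b / c.ρ₂, 0, 0],
    ![0, 0, 0, -(c.γ / c.ρ₁), 0, 0, 0, c.k₀ / c.ρ₁],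
    ![0, 0, -c.m₁, 0, 0, 0, 0, 0],
    ![0, -c.m₂, 0, 0, 0, 0, 0, 0],
    ![0, 1, 0, 0, 0, 0, 0, 0],
    ![1, 0, 0, 0, 0, 0, 0, 0],
    ![0, 0, 1, 0, 0, 0, 0, 0]]
  A₂ := ![![0, 0, 0, 0, 0, 0, 0, 0],
    ![0, 0, 0, 0, 0, 0, 0, 0],
    ![0, 0, 0, 0, 0, 0, 0, 0],
    ![0, 0, 0, c.k₁, 0, 0, 0, 0],
    ![0, 0, 0, 0, c.k₂, 0, 0, 0],
    ![0, 0, 0, 0, 0, 0, 0, 0],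
    ![0, 0, 0, 0, 0, 0, 0, 0],
    ![0, 0, 0, 0, 0, 0, 0, 0]]

/-- The weights in the vector solution of Type I. -/
def weightI (c : Coeffs) : Fin 8 → ℝ :=
  ![√c.ρ₁, √c.ρ₂, √c.ρ₁, √(c.γ / c.m₁), √(c.γ / c.m₂), √c.b, √c.k, √c.k₀]

theorem weightI_ne (c : Coeffs) (a : Fin 8) : weightI c a ≠ 0 := by
  have h := fun (x : ℝ) (hx : 0 < x) => (Real.sqrt_pos.2 hx).ne'
  fin_cases a
  exacts [h _ c.ρ₁_pos, h _ c.ρ₂_pos, h _ c.ρ₁_pos, h _ (div_pos c.γ_pos c.m₁_pos),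
    h _ (div_pos c.γ_pos c.m₂_pos), h _ c.b_pos, h _ c.k_pos, h _ c.k₀_pos]

/-- The system of Type III for
`(φt, ψt, ωt, θ₁t, θ₁x, θ₂t, θ₂x, ψx, φx - ψ - lω, ωx - lφ)`. -/
def pencilIII (c : Coeffs) : Pencil 10 where
  A₀ := ![![0, 0, 0, -(c.l * c.γ / c.ρ₁), 0, 0, 0, 0, 0, c.k₀ * c.l / c.ρ₁],
    ![0, 0, 0, 0, 0, 0, 0, 0, c.k / c.ρ₂, 0],
    ![0, 0, 0, 0, 0, 0, 0, 0, c.k * c.l / c.ρ₁, 0],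
    ![c.m₁ * c.l, 0, 0, 0, 0, 0, 0, 0, 0, 0],
    ![0, 0, 0, 0, 0, 0, 0, 0, 0, 0],
    ![0, 0, 0, 0, 0, 0, 0, 0, 0, 0],
    ![0, 0, 0, 0, 0, 0, 0, 0, 0, 0],
    ![0, 0, 0, 0, 0, 0, 0, 0, 0, 0],
    ![0, -1, -c.l, 0, 0, 0, 0, 0, 0, 0],
    ![-c.l, 0, 0, 0, 0, 0, 0, 0, 0, 0]]
  A₁ := ![![0, 0, 0, 0, 0, 0, 0, 0, c.k / c.ρ₁, 0],
    ![0, 0, 0, 0, 0, -(c.γ / c.ρ₂), 0, c.b / c.ρ₂, 0, 0],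
    ![0, 0, 0, -(c.γ / c.ρ₁), 0, 0, 0, 0, 0, c.k₀ / c.ρ₁],
    ![0, 0, -c.m₁, 0, c.k₁, 0, 0, 0, 0, 0],
    ![0, 0, 0, 1, 0, 0, 0, 0, 0, 0],
    ![0, -c.m₂, 0, 0, 0, 0, c.k₂, 0, 0, 0],
    ![0, 0, 0, 0, 0, 1, 0, 0, 0, 0],
    ![0, 1, 0, 0, 0, 0, 0, 0, 0, 0],
    ![1, 0, 0, 0, 0, 0, 0, 0, 0, 0],
    ![0, 0, 1, 0, 0, 0, 0, 0, 0, 0]]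
  A₂ := ![![0, 0, 0, 0, 0, 0, 0, 0, 0, 0],
    ![0, 0, 0, 0, 0, 0, 0, 0, 0, 0],
    ![0, 0, 0, 0, 0, 0, 0, 0, 0, 0],
    ![0, 0, 0, c.α₁, 0, 0, 0, 0, 0, 0],
    ![0, 0, 0, 0, 0, 0, 0, 0, 0, 0],
    ![0, 0, 0, 0, 0, c.α₂, 0, 0, 0, 0],
    ![0, 0, 0, 0, 0, 0, 0, 0, 0, 0],
    ![0, 0, 0, 0, 0, 0, 0, 0, 0, 0],
    ![0, 0, 0, 0, 0, 0, 0, 0, 0, 0],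
    ![0, 0, 0, 0, 0, 0, 0, 0, 0, 0]]

/-- The weights in the vector solution of Type III. -/
def weightIII (c : Coeffs) : Fin 10 → ℝ :=
  ![√c.ρ₁, √c.ρ₂, √c.ρ₁, √(c.γ / c.m₁), √(c.k₁ * c.γ / c.m₁), √(c.γ / c.m₂),
    √(c.k₂ * c.γ / c.m₂), √c.b, √c.k, √c.k₀]

theorem weightIII_ne (c : Coeffs) (a : Fin 10) : weightIII c a ≠ 0 := by
  have h := fun (x : ℝ) (hx : 0 < x) => (Real.sqrt_pos.2 hx).ne'
  fin_cases a
  exacts [h _ c.ρ₁_pos, h _ c.ρ₂_pos, h _ c.ρ₁_pos, h _ (div_pos c.γ_pos c.m₁_pos),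
    h _ (div_pos (mul_pos c.k₁_pos c.γ_pos) c.m₁_pos), h _ (div_pos c.γ_pos c.m₂_pos),
    h _ (div_pos (mul_pos c.k₂_pos c.γ_pos) c.m₂_pos), h _ c.b_pos, h _ c.k_pos, h _ c.k₀_pos]

theorem mul_norm_div_sqrt_sq {a : ℝ} (ha : 0 < a) (x : ℂ) :
    a * ‖x / (√a : ℂ)‖ ^ 2 = ‖x‖ ^ 2 := by
  rw [norm_div, div_pow, Complex.norm_real, Real.norm_eq_abs, sq_abs, Real.sq_sqrt ha.le]
  field_simp

/-- Type I is the Fourier system with zero fluxes and diffusivities k₁, k₂. The weights in the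
vector solution turn the energy into the Euclidean length. -/
theorem exists_symbolBound_I (c : Coeffs) :
    ∃ C > 0, ((pencilI c).rescale (weightI c)).SymbolBound 3 C := by
  obtain ⟨C, hC, h⟩ := exists_fourier_decay c (q₁ := 0) (q₂ := 0) c.k₁_pos c.k₂_pos le_rfl le_rfl
  refine ⟨C, hC, fun ξ t ht x => ?_⟩
  have hd := (pencilI c).hasDerivAt_rescale (weightI_ne c) ξ x
  set X : ℝ → Fin 8 → ℂ := fun t =>
    NormedSpace.exp (t • matAct (((pencilI c).rescale (weightI c)).symbol ξ)) x with hX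
  have hρ₁ : (c.ρ₁ : ℂ) ≠ 0 := by exact_mod_cast c.ρ₁_pos.ne'
  have hρ₂ : (c.ρ₂ : ℂ) ≠ 0 := by exact_mod_cast c.ρ₂_pos.ne'
  let f : Fin 8 → ℝ → ℂ := fun a t => X t a / (weightI c a : ℂ)
  have hd' : ∀ a t, HasDerivAt (f a) (∑ b, (pencilI c).symbol ξ a b * f b t) t := hd
  have hI : Complex.I ^ 2 = -1 := Complex.I_sq
  have ode : FourierODE c c.k₁ c.k₂ 0 0 (2 * Real.pi * ξ) (f 0) (f 1) (f 2) (f 3) (fun _ => 0)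
      (f 4) (fun _ => 0) (f 5) (f 6) (f 7) := by
    constructor <;> intro t
    · refine (hd' 0 t).congr_deriv ?_
      simp [Fin.sum_univ_eight, Pencil.symbol, pencilI, dsym]
      field_simp
      ring
    · refine (hd' 1 t).congr_deriv ?_
      simp [Fin.sum_univ_eight, Pencil.symbol, pencilI, dsym]
      field_simp
      ring
    · refine (hd' 2 t).congr_deriv ?_
      simp [Fin.sum_univ_eight, Pencil.symbol, pencilI, dsym]
      field_simp
      ring
    · refine (hd' 3 t).congr_deriv ?_
      simp [Fin.sum_univ_eight, Pencil.symbol, pencilI, dsym]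
      linear_combination (4 * c.k₁ * Real.pi ^ 2 * ξ ^ 2 * f 3 t) * hI
    · simpa using hasDerivAt_const t (0 : ℂ)
    · refine (hd' 4 t).congr_deriv ?_
      simp [Fin.sum_univ_eight, Pencil.symbol, pencilI, dsym]
      linear_combination (4 * c.k₂ * Real.pi ^ 2 * ξ ^ 2 * f 4 t) * hI
    · simpa using hasDerivAt_const t (0 : ℂ)
    · refine (hd' 5 t).congr_deriv ?_
      simp [Fin.sum_univ_eight, Pencil.symbol, pencilI, dsym]
      exact Or.inl (by ring)
    · refine (hd' 6 t).congr_deriv ?_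
      simp [Fin.sum_univ_eight, Pencil.symbol, pencilI, dsym]
      ring
    · refine (hd' 7 t).congr_deriv ?_
      simp [Fin.sum_univ_eight, Pencil.symbol, pencilI, dsym]
      ring
  have hE : ∀ t, fourierEnergy c (f 0 t) (f 1 t) (f 2 t) (f 3 t) 0 (f 4 t) 0 (f 5 t) (f 6 t)
      (f 7 t) = ∑ a, ‖X t a‖ ^ 2 := fun t => by
    have e0 := mul_norm_div_sqrt_sq c.ρ₁_pos (X t 0)
    have e1 := mul_norm_div_sqrt_sq c.ρ₂_pos (X t 1)
    have e2 := mul_norm_div_sqrt_sq c.ρ₁_pos (X t 2)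
    have e3 := mul_norm_div_sqrt_sq (div_pos c.γ_pos c.m₁_pos) (X t 3)
    have e4 := mul_norm_div_sqrt_sq (div_pos c.γ_pos c.m₂_pos) (X t 4)
    have e5 := mul_norm_div_sqrt_sq c.b_pos (X t 5)
    have e6 := mul_norm_div_sqrt_sq c.k_pos (X t 6)
    have e7 := mul_norm_div_sqrt_sq c.k₀_pos (X t 7)
    rw [Fin.sum_univ_eight, ← e0, ← e1, ← e2, ← e3, ← e4, ← e5, ← e6, ← e7, fourierEnergy,
      norm_zero]
    simp only [f, weightI]
    simp
  have := h ξ _ _ _ _ _ _ _ _ _ _ ode (fun _ _ => rfl) (fun _ _ => rfl) t ht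
  rw [hE, hE] at this
  simpa only [hX, exp_zero_smul_matAct] using this

/-- Type III is the Fourier system with diffusivities α₁, α₂ and fluxes √k₁ θ₁ₓ, √k₂ θ₂ₓ; the square
roots make the coupling of temperature rate and flux skew. -/
theorem exists_symbolBound_III (c : Coeffs) :
    ∃ C > 0, ((pencilIII c).rescale (weightIII c)).SymbolBound 3 C := by
  obtain ⟨C, hC, h⟩ := exists_fourier_decay c (q₁ := √c.k₁) (q₂ := √c.k₂) c.α₁_pos c.α₂_pos
    (Real.sqrt_nonneg _) (Real.sqrt_nonneg _)
  refine ⟨C, hC, fun ξ t ht x => ?_⟩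
  have hd := (pencilIII c).hasDerivAt_rescale (weightIII_ne c) ξ x
  set X : ℝ → Fin 10 → ℂ := fun t =>
    NormedSpace.exp (t • matAct (((pencilIII c).rescale (weightIII c)).symbol ξ)) x with hX
  have hρ₁ : (c.ρ₁ : ℂ) ≠ 0 := by exact_mod_cast c.ρ₁_pos.ne'
  have hρ₂ : (c.ρ₂ : ℂ) ≠ 0 := by exact_mod_cast c.ρ₂_pos.ne'
  have hk₁ : (√c.k₁ : ℂ) ^ 2 = c.k₁ := by exact_mod_cast Real.sq_sqrt c.k₁_pos.le
  have hk₂ : (√c.k₂ : ℂ) ^ 2 = c.k₂ := by exact_mod_cast Real.sq_sqrt c.k₂_pos.le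
  let f : Fin 10 → ℝ → ℂ := fun a t => X t a / (weightIII c a : ℂ)
  have hd' : ∀ a t, HasDerivAt (f a) (∑ b, (pencilIII c).symbol ξ a b * f b t) t := hd
  have hI : Complex.I ^ 2 = -1 := Complex.I_sq
  have ode : FourierODE c c.α₁ c.α₂ √c.k₁ √c.k₂ (2 * Real.pi * ξ) (f 0) (f 1) (f 2) (f 3)
      (fun t => √c.k₁ * f 4 t) (f 5) (fun t => √c.k₂ * f 6 t) (f 7) (f 8) (f 9) := by
    constructor <;> intro t
    · refine (hd' 0 t).congr_deriv ?_
      simp [Fin.sum_univ_castSucc, Pencil.symbol, pencilIII, dsym]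
      field_simp
      ring
    · refine (hd' 1 t).congr_deriv ?_
      simp [Fin.sum_univ_castSucc, Pencil.symbol, pencilIII, dsym]
      field_simp
      ring
    · refine (hd' 2 t).congr_deriv ?_
      simp [Fin.sum_univ_castSucc, Pencil.symbol, pencilIII, dsym]
      field_simp
      ring
    · refine (hd' 3 t).congr_deriv ?_
      simp [Fin.sum_univ_castSucc, Pencil.symbol, pencilIII, dsym]
      linear_combination (4 * c.α₁ * Real.pi ^ 2 * ξ ^ 2 * f 3 t) * hI
        - (Complex.I * 2 * Real.pi * ξ * f 4 t) * hk₁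
    · refine ((hd' 4 t).const_mul (√c.k₁ : ℂ)).congr_deriv ?_
      simp [Fin.sum_univ_castSucc, Pencil.symbol, pencilIII, dsym]
      ring
    · refine (hd' 5 t).congr_deriv ?_
      simp [Fin.sum_univ_castSucc, Pencil.symbol, pencilIII, dsym]
      linear_combination (4 * c.α₂ * Real.pi ^ 2 * ξ ^ 2 * f 5 t) * hI
        - (Complex.I * 2 * Real.pi * ξ * f 6 t) * hk₂
    · refine ((hd' 6 t).const_mul (√c.k₂ : ℂ)).congr_deriv ?_
      simp [Fin.sum_univ_castSucc, Pencil.symbol, pencilIII, dsym]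
      ring
    · refine (hd' 7 t).congr_deriv ?_
      simp [Fin.sum_univ_castSucc, Pencil.symbol, pencilIII, dsym]
      exact Or.inl (by ring)
    · refine (hd' 8 t).congr_deriv ?_
      simp [Fin.sum_univ_castSucc, Pencil.symbol, pencilIII, dsym]
      ring
    · refine (hd' 9 t).congr_deriv ?_
      simp [Fin.sum_univ_castSucc, Pencil.symbol, pencilIII, dsym]
      ring
  have hE : ∀ t, fourierEnergy c (f 0 t) (f 1 t) (f 2 t) (f 3 t) (√c.k₁ * f 4 t) (f 5 t)
      (√c.k₂ * f 6 t) (f 7 t) (f 8 t) (f 9 t) = ∑ a, ‖X t a‖ ^ 2 := fun t => by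
    have e0 := mul_norm_div_sqrt_sq c.ρ₁_pos (X t 0)
    have e1 := mul_norm_div_sqrt_sq c.ρ₂_pos (X t 1)
    have e2 := mul_norm_div_sqrt_sq c.ρ₁_pos (X t 2)
    have e3 := mul_norm_div_sqrt_sq (div_pos c.γ_pos c.m₁_pos) (X t 3)
    have e4 := mul_norm_div_sqrt_sq (div_pos (mul_pos c.k₁_pos c.γ_pos) c.m₁_pos) (X t 4)
    have e5 := mul_norm_div_sqrt_sq (div_pos c.γ_pos c.m₂_pos) (X t 5)
    have e6 := mul_norm_div_sqrt_sq (div_pos (mul_pos c.k₂_pos c.γ_pos) c.m₂_pos) (X t 6)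
    have e7 := mul_norm_div_sqrt_sq c.b_pos (X t 7)
    have e8 := mul_norm_div_sqrt_sq c.k_pos (X t 8)
    have e9 := mul_norm_div_sqrt_sq c.k₀_pos (X t 9)
    have hs : ∑ a, ‖X t a‖ ^ 2 = ‖X t 0‖ ^ 2 + ‖X t 1‖ ^ 2 + ‖X t 2‖ ^ 2 + ‖X t 3‖ ^ 2
        + ‖X t 4‖ ^ 2 + ‖X t 5‖ ^ 2 + ‖X t 6‖ ^ 2 + ‖X t 7‖ ^ 2 + ‖X t 8‖ ^ 2 + ‖X t 9‖ ^ 2 := by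
      simp [Fin.sum_univ_castSucc]
    have n1 : ∀ (k : ℝ) (x : ℂ), 0 < k → ‖√k * x‖ ^ 2 = k * ‖x‖ ^ 2 := fun k x hk => by
      rw [norm_mul, mul_pow, Complex.norm_real, Real.norm_eq_abs, sq_abs, Real.sq_sqrt hk.le]
    rw [hs, ← e0, ← e1, ← e2, ← e3, ← e4, ← e5, ← e6, ← e7, ← e8, ← e9, fourierEnergy,
      n1 _ _ c.k₁_pos, n1 _ _ c.k₂_pos]
    simp only [f, weightIII]
    simp
    ring
  have := h ξ _ _ _ _ _ _ _ _ _ _ ode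
    (fun h => absurd h (Real.sqrt_pos.2 c.k₁_pos).ne')
    (fun h => absurd h (Real.sqrt_pos.2 c.k₂_pos).ne') t ht
  rw [hE, hE] at this
  simpa only [hX, exp_zero_smul_matAct] using this

/-! ### Weak solutions as solutions of the first-order systems -/

theorem integral_eq_lin {F G H L : ℝ → ℝ} (a b c : ℝ) (hF : Integrable F) (hG : Integrable G)
    (hH : Integrable H) (hL : ∀ x, L x = a * F x + b * G x + c * H x) :
    ∫ x, L x = a * (∫ x, F x) + b * (∫ x, G x) + c * (∫ x, H x) := by
  have hFG : Integrable (fun x => a * F x + b * G x) := (hF.const_mul a).add (hG.const_mul b)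
  rw [integral_congr_ae (.of_forall hL), integral_add hFG (hH.const_mul c),
    integral_add (hF.const_mul a) (hG.const_mul b), integral_const_mul, integral_const_mul,
    integral_const_mul]

theorem IsTest.integrable_mul {χ : ℝ → ℝ} (h : IsTest χ) {f : ℝ → ℝ}
    (hf : LocallyIntegrable f volume) : Integrable (fun x => f x * χ x) := by
  simpa only [smul_eq_mul, mul_comm] using h.integrable_smul hf

theorem HasWeakSpaceDeriv.integral_mul {f g : ℝ → ℝ → ℝ} (h : HasWeakSpaceDeriv f g) {t : ℝ}
    (ht : 0 ≤ t) {χ : ℝ → ℝ} (hχ : IsTest χ) :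
    ∫ x, g t x * χ x = -∫ x, f t x * deriv χ x := by
  have := (h t ht).2.2 χ hχ
  simp only [iteratedDeriv_one, smul_eq_mul, pow_one, mul_comm (deriv χ _), mul_comm (χ _)] at this
  linarith

theorem HasWeakTimeDeriv.hasDerivWithinAt {f g : ℝ → ℝ → ℝ} (h : HasWeakTimeDeriv f g)
    {χ : ℝ → ℝ} (hχ : IsTest χ) {t : ℝ} (ht : 0 ≤ t) :
    HasDerivWithinAt (fun τ => ∫ x, f τ x * χ x) (∫ x, g t x * χ x) (Ici 0) t := by
  simpa using h χ hχ t ht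

/-- The mixed derivative `f_xt`, tested. -/
theorem HasWeakSpaceDeriv.hasDerivWithinAt {f fx ft : ℝ → ℝ → ℝ} (h : HasWeakSpaceDeriv f fx)
    (h' : HasWeakTimeDeriv f ft) {χ : ℝ → ℝ} (hχ : IsTest χ) {t : ℝ} (ht : 0 ≤ t) :
    HasDerivWithinAt (fun τ => ∫ x, fx τ x * χ x) (-∫ x, ft t x * deriv χ x) (Ici 0) t :=
  (h'.hasDerivWithinAt hχ.deriv ht).neg.congr (fun _ hτ => h.integral_mul hτ hχ)
    (h.integral_mul ht hχ)

theorem WeakEvol.hasDerivWithinAt_of_const_mul {a : ℝ} (ha : 0 < a) {g f₀ f₁ : ℝ → ℝ → ℝ}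
    (h : WeakEvol (fun t x => a * g t x) f₀ f₁ 0) {χ : ℝ → ℝ} (hχ : IsTest χ) {t : ℝ}
    (ht : 0 ≤ t) :
    HasDerivWithinAt (fun τ => ∫ x, g τ x * χ x)
      ((∫ x, (f₀ t x * χ x - f₁ t x * deriv χ x)) / a) (Ici 0) t := by
  have h1 := (h χ hχ t ht).div_const a
  simp only [mul_assoc, integral_const_mul, Pi.zero_apply, zero_mul, add_zero] at h1
  simpa only [mul_div_cancel_left₀ _ ha.ne'] using h1

/-- A heat equation with the time derivative of `w` as a source. -/
theorem WeakEvol.hasDerivWithinAt_heat {m : ℝ} {g w f₂ : ℝ → ℝ → ℝ}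
    (h : WeakEvol (fun t x => g t x + m * w t x) 0 0 f₂)
    (hg : ∀ t, 0 ≤ t → LocallyIntegrable (g t) volume)
    (hw : ∀ t, 0 ≤ t → LocallyIntegrable (w t) volume) {χ : ℝ → ℝ} (hχ : IsTest χ) {t : ℝ}
    (ht : 0 ≤ t) {D : ℝ}
    (hD : HasDerivWithinAt (fun τ => ∫ x, w τ x * χ x) D (Ici 0) t) :
    HasDerivWithinAt (fun τ => ∫ x, g τ x * χ x)
      ((∫ x, f₂ t x * iteratedDeriv 2 χ x) - m * D) (Ici 0) t := by
  have h1 := (h χ hχ t ht).sub (hD.const_mul m)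
  simp only [Pi.zero_apply, zero_mul, sub_self, zero_add] at h1
  have e : ∀ τ ∈ Ici (0 : ℝ), ∫ x, g τ x * χ x =
      (∫ x, (g τ x + m * w τ x) * χ x) - m * ∫ x, w τ x * χ x := fun τ hτ => by
    rw [integral_eq_lin (L := fun x => (g τ x + m * w τ x) * χ x) 1 m 0
      (hχ.integrable_mul (hg τ hτ)) (hχ.integrable_mul (hw τ hτ))
      (hχ.integrable_mul (hw τ hτ)) fun x => by ring]
    ring
  exact h1.congr e (e t ht)

/-! ### Kinematic identities and equations of motion in tested form -/

section Motion

variable {c : Coeffs} {u : Motion} {χ : ℝ → ℝ} {t : ℝ}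

theorem Motion.Compatible.locallyIntegrable_shear (h : u.Compatible) (ht : 0 ≤ t) :
    LocallyIntegrable (u.shear c t) volume :=
  ((h.φ_space t ht).2.1.sub (h.ψ_space t ht).1).sub ((h.ω_space t ht).1.smul c.l)

theorem Motion.Compatible.locallyIntegrable_axial (h : u.Compatible) (ht : 0 ≤ t) :
    LocallyIntegrable (u.axial c t) volume :=
  (h.ω_space t ht).2.1.sub ((h.φ_space t ht).1.smul c.l)

theorem Motion.Compatible.hasDerivWithinAt_shear (h : u.Compatible) (hχ : IsTest χ)
    (ht : 0 ≤ t) :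
    HasDerivWithinAt (fun τ => ∫ x, u.shear c τ x * χ x)
      (-(∫ x, u.φt t x * deriv χ x) - (∫ x, u.ψt t x * χ x) - c.l * ∫ x, u.ωt t x * χ x)
      (Ici 0) t := by
  have e : ∀ τ ∈ Ici (0 : ℝ), ∫ x, u.shear c τ x * χ x =
      (∫ x, u.φx τ x * χ x) - (∫ x, u.ψ τ x * χ x) - c.l * ∫ x, u.ω τ x * χ x := fun τ hτ => by
    rw [integral_eq_lin 1 (-1) (-c.l) (hχ.integrable_mul (h.φ_space τ hτ).2.1)
      (hχ.integrable_mul (h.ψ_space τ hτ).1) (hχ.integrable_mul (h.ω_space τ hτ).1)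
      fun x => by simp only [Motion.shear]; ring]
    ring
  exact (((h.φ_space.hasDerivWithinAt h.φ_time hχ ht).sub (h.ψ_time.hasDerivWithinAt hχ ht)).sub
    ((h.ω_time.hasDerivWithinAt hχ ht).const_mul c.l)).congr e (e t ht)

theorem Motion.Compatible.hasDerivWithinAt_axial (h : u.Compatible) (hχ : IsTest χ)
    (ht : 0 ≤ t) :
    HasDerivWithinAt (fun τ => ∫ x, u.axial c τ x * χ x)
      (-(∫ x, u.ωt t x * deriv χ x) - c.l * ∫ x, u.φt t x * χ x) (Ici 0) t := by
  have e : ∀ τ ∈ Ici (0 : ℝ), ∫ x, u.axial c τ x * χ x =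
      (∫ x, u.ωx τ x * χ x) - c.l * ∫ x, u.φ τ x * χ x := fun τ hτ => by
    rw [integral_eq_lin 1 (-c.l) 0 (hχ.integrable_mul (h.ω_space τ hτ).2.1)
      (hχ.integrable_mul (h.φ_space τ hτ).1) (hχ.integrable_mul (h.φ_space τ hτ).1)
      fun x => by simp only [Motion.axial]; ring]
    ring
  exact ((h.ω_space.hasDerivWithinAt h.ω_time hχ ht).sub
    ((h.φ_time.hasDerivWithinAt hχ ht).const_mul c.l)).congr e (e t ht)

variable {T₁ T₂ : ℝ → ℝ → ℝ}

theorem Motion.Equations.hasDerivWithinAt_vertical (H : u.Equations c T₁ T₂) (h : u.Compatible)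
    (hT : LocallyIntegrable (T₁ t) volume) (hχ : IsTest χ) (ht : 0 ≤ t) :
    HasDerivWithinAt (fun τ => ∫ x, u.φt τ x * χ x)
      ((c.k₀ * c.l * (∫ x, u.axial c t x * χ x) - c.l * c.γ * (∫ x, T₁ t x * χ x)
        - c.k * ∫ x, u.shear c t x * deriv χ x) / c.ρ₁) (Ici 0) t := by
  refine (H.vertical.hasDerivWithinAt_of_const_mul c.ρ₁_pos hχ ht).congr_deriv ?_
  rw [integral_eq_lin (c.k₀ * c.l) (-(c.l * c.γ)) (-c.k)
    (hχ.integrable_mul (h.locallyIntegrable_axial ht)) (hχ.integrable_mul hT)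
    (hχ.deriv.integrable_mul (h.locallyIntegrable_shear ht)) fun x => by ring]
  ring

theorem Motion.Equations.hasDerivWithinAt_rotation (H : u.Equations c T₁ T₂) (h : u.Compatible)
    (hT : LocallyIntegrable (T₂ t) volume) (hχ : IsTest χ) (ht : 0 ≤ t) :
    HasDerivWithinAt (fun τ => ∫ x, u.ψt τ x * χ x)
      ((c.k * (∫ x, u.shear c t x * χ x) - c.b * (∫ x, u.ψx t x * deriv χ x)
        + c.γ * ∫ x, T₂ t x * deriv χ x) / c.ρ₂) (Ici 0) t := by
  refine (H.rotation.hasDerivWithinAt_of_const_mul c.ρ₂_pos hχ ht).congr_deriv ?_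
  rw [integral_eq_lin c.k (-c.b) c.γ
    (hχ.integrable_mul (h.locallyIntegrable_shear ht))
    (hχ.deriv.integrable_mul (h.ψ_space t ht).2.1) (hχ.deriv.integrable_mul hT) fun x => by ring]
  ring

theorem Motion.Equations.hasDerivWithinAt_longitudinal (H : u.Equations c T₁ T₂)
    (h : u.Compatible) (hT : LocallyIntegrable (T₁ t) volume) (hχ : IsTest χ) (ht : 0 ≤ t) :
    HasDerivWithinAt (fun τ => ∫ x, u.ωt τ x * χ x)
      ((c.k * c.l * (∫ x, u.shear c t x * χ x) - c.k₀ * (∫ x, u.axial c t x * deriv χ x)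
        + c.γ * ∫ x, T₁ t x * deriv χ x) / c.ρ₁) (Ici 0) t := by
  refine (H.longitudinal.hasDerivWithinAt_of_const_mul c.ρ₁_pos hχ ht).congr_deriv ?_
  rw [integral_eq_lin (c.k * c.l) (-c.k₀) c.γ
    (hχ.integrable_mul (h.locallyIntegrable_shear ht))
    (hχ.deriv.integrable_mul (h.locallyIntegrable_axial ht)) (hχ.deriv.integrable_mul hT)
    fun x => by ring]
  ring

end Motion

theorem locallyIntegrable_of_memLp_mul {a : ℝ} (ha : a ≠ 0) {f : ℝ → ℝ}
    (h : MemLp (fun x => a * f x) 2 volume) : LocallyIntegrable f volume := by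
  have := h.const_mul a⁻¹
  simp only [inv_mul_cancel_left₀ ha] at this
  exact this.locallyIntegrable one_le_two

theorem IsSolutionI.isWeakSolution {c : Coeffs} {u : Motion} {θ₁ θ₂ : ℝ → ℝ → ℝ}
    (h : IsSolutionI c u θ₁ θ₂) :
    ((pencilI c).rescale (weightI c)).IsWeakSolution (V₁ c u θ₁ θ₂) := by
  have hθ₁ : ∀ t, 0 ≤ t → LocallyIntegrable (θ₁ t) volume := fun t ht =>
    locallyIntegrable_of_memLp_mul (weightI_ne c 3) (memLp_apply (h.continuous_L2.1 t ht) 3)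
  have hθ₂ : ∀ t, 0 ≤ t → LocallyIntegrable (θ₂ t) volume := fun t ht =>
    locallyIntegrable_of_memLp_mul (weightI_ne c 4) (memLp_apply (h.continuous_L2.1 t ht) 4)
  have hC := h.compatible
  refine Pencil.isWeakSolution_rescale (weightI_ne c)
    (f := ![u.φt, u.ψt, u.ωt, θ₁, θ₂, u.ψx, u.shear c, u.axial c]) (fun a t x => ?_)
    fun a χ hχ t ht => ?_
  · fin_cases a <;> rfl
  · have hax := hC.hasDerivWithinAt_axial (c := c) hχ ht
    have hψx := hC.ψ_space.hasDerivWithinAt hC.ψ_time hχ ht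
    fin_cases a
    · refine (h.motion.hasDerivWithinAt_vertical hC (hθ₁ t ht) hχ ht).congr_deriv ?_
      simp [Fin.sum_univ_eight, pencilI]
      ring
    · refine (h.motion.hasDerivWithinAt_rotation hC (hθ₂ t ht) hχ ht).congr_deriv ?_
      simp [Fin.sum_univ_eight, pencilI]
      ring
    · refine (h.motion.hasDerivWithinAt_longitudinal hC (hθ₁ t ht) hχ ht).congr_deriv ?_
      simp [Fin.sum_univ_eight, pencilI]
      ring
    · refine (h.heat₁.hasDerivWithinAt_heat hθ₁ (fun t ht => hC.locallyIntegrable_axial ht) hχ ht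
        hax).congr_deriv ?_
      simp [Fin.sum_univ_eight, pencilI, mul_assoc, integral_const_mul]
      ring
    · refine (h.heat₂.hasDerivWithinAt_heat hθ₂ (fun t ht => (hC.ψ_space t ht).2.1) hχ ht
        hψx).congr_deriv ?_
      simp [Fin.sum_univ_eight, pencilI, mul_assoc, integral_const_mul]
      ring
    · refine hψx.congr_deriv ?_
      simp [Fin.sum_univ_eight, pencilI]
    · refine (hC.hasDerivWithinAt_shear (c := c) hχ ht).congr_deriv ?_
      simp [Fin.sum_univ_eight, pencilI]
      ring
    · refine hax.congr_deriv ?_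
      simp [Fin.sum_univ_eight, pencilI]
      ring

/-- One integration by parts replaces θ, which is not a component of the vector solution, by θₓ,
which is. -/
theorem HasWeakSpaceDeriv.integral_heat {f fx g : ℝ → ℝ → ℝ} (h : HasWeakSpaceDeriv f fx)
    {t : ℝ} (ht : 0 ≤ t) (hg : LocallyIntegrable (g t) volume) {χ : ℝ → ℝ} (hχ : IsTest χ)
    (k α : ℝ) :
    ∫ x, (k * f t x + α * g t x) * iteratedDeriv 2 χ x =
      -(k * ∫ x, fx t x * deriv χ x) + α * ∫ x, g t x * iteratedDeriv 2 χ x := by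
  have h1 := (hχ.iteratedDeriv 2).integrable_mul (h t ht).1
  have h2 := (hχ.iteratedDeriv 2).integrable_mul hg
  rw [integral_eq_lin k α 0 h1 h2 h2 fun x => by ring, h.integral_mul ht hχ.deriv,
    iteratedDeriv_succ, iteratedDeriv_one]
  ring

theorem IsSolutionIII.isWeakSolution {c : Coeffs} {u : Motion} {θ : Thermal}
    (h : IsSolutionIII c u θ) :
    ((pencilIII c).rescale (weightIII c)).IsWeakSolution (V₂ c u θ) := by
  have hθ₁ : ∀ t, 0 ≤ t → LocallyIntegrable (θ.θ₁t t) volume := fun t ht =>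
    locallyIntegrable_of_memLp_mul (weightIII_ne c 3) (memLp_apply (h.continuous_L2.1 t ht) 3)
  have hθ₂ : ∀ t, 0 ≤ t → LocallyIntegrable (θ.θ₂t t) volume := fun t ht =>
    locallyIntegrable_of_memLp_mul (weightIII_ne c 5) (memLp_apply (h.continuous_L2.1 t ht) 5)
  have hC := h.compatible
  have hD := h.thermal_compatible
  refine Pencil.isWeakSolution_rescale (weightIII_ne c)
    (f := ![u.φt, u.ψt, u.ωt, θ.θ₁t, θ.θ₁x, θ.θ₂t, θ.θ₂x, u.ψx, u.shear c, u.axial c])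
    (fun a t x => ?_) fun a χ hχ t ht => ?_
  · fin_cases a <;> rfl
  · have hax := hC.hasDerivWithinAt_axial (c := c) hχ ht
    have hψx := hC.ψ_space.hasDerivWithinAt hC.ψ_time hχ ht
    fin_cases a
    · refine (h.motion.hasDerivWithinAt_vertical hC (hθ₁ t ht) hχ ht).congr_deriv ?_
      simp [Fin.sum_univ_castSucc, pencilIII]
      ring
    · refine (h.motion.hasDerivWithinAt_rotation hC (hθ₂ t ht) hχ ht).congr_deriv ?_
      simp [Fin.sum_univ_castSucc, pencilIII]
      ring
    · refine (h.motion.hasDerivWithinAt_longitudinal hC (hθ₁ t ht) hχ ht).congr_deriv ?_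
      simp [Fin.sum_univ_castSucc, pencilIII]
      ring
    · refine (h.heat₁.hasDerivWithinAt_heat hθ₁ (fun t ht => hC.locallyIntegrable_axial ht) hχ ht
        hax).congr_deriv ?_
      rw [hD.θ₁_space.integral_heat ht (hθ₁ t ht) hχ]
      simp [Fin.sum_univ_castSucc, pencilIII]
      ring
    · refine (hD.θ₁_space.hasDerivWithinAt hD.θ₁_time hχ ht).congr_deriv ?_
      simp [Fin.sum_univ_castSucc, pencilIII]
    · refine (h.heat₂.hasDerivWithinAt_heat hθ₂ (fun t ht => (hC.ψ_space t ht).2.1) hχ ht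
        hψx).congr_deriv ?_
      rw [hD.θ₂_space.integral_heat ht (hθ₂ t ht) hχ]
      simp [Fin.sum_univ_castSucc, pencilIII]
      ring
    · refine (hD.θ₂_space.hasDerivWithinAt hD.θ₂_time hχ ht).congr_deriv ?_
      simp [Fin.sum_univ_castSucc, pencilIII]
    · refine hψx.congr_deriv ?_
      simp [Fin.sum_univ_castSucc, pencilIII]
    · refine (hC.hasDerivWithinAt_shear (c := c) hχ ht).congr_deriv ?_
      simp [Fin.sum_univ_castSucc, pencilIII]
      ring
    · refine hax.congr_deriv ?_
      simp [Fin.sum_univ_castSucc, pencilIII]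
      ring

end

end Bresse

/-! ### Assembly for both systems and both speed regimes -/

theorem theorem1p1 (c : Bresse.Coeffs) (s : ℕ) :
    ∃ C₁ : ℝ, 0 < C₁ ∧ ∃ C₂ : ℝ, 0 < C₂ ∧
      (∀ (u : Bresse.Motion) (θ₁ θ₂ : ℝ → ℝ → ℝ), Bresse.IsSolutionI c u θ₁ θ₂ →
        Bresse.MemHs s (Bresse.V₁ c u θ₁ θ₂ 0) →
        MemLp (Bresse.V₁ c u θ₁ θ₂ 0) 1 volume →
          (c.EqualSpeeds → Bresse.DecayEstimate s C₁ C₂ 4 (Bresse.V₁ c u θ₁ θ₂)) ∧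
          (¬ c.EqualSpeeds → Bresse.DecayEstimate s C₁ C₂ 6 (Bresse.V₁ c u θ₁ θ₂))) ∧
      (∀ (u : Bresse.Motion) (h : Bresse.Thermal), Bresse.IsSolutionIII c u h →
        Bresse.MemHs s (Bresse.V₂ c u h 0) →
        MemLp (Bresse.V₂ c u h 0) 1 volume →
          (c.EqualSpeeds → Bresse.DecayEstimate s C₁ C₂ 4 (Bresse.V₂ c u h)) ∧
          (¬ c.EqualSpeeds → Bresse.DecayEstimate s C₁ C₂ 6 (Bresse.V₂ c u h))) := by
  obtain ⟨C, hC, hI⟩ := Bresse.exists_symbolBound_I c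
  obtain ⟨C', hC', hIII⟩ := Bresse.exists_symbolBound_III c
  obtain ⟨A₁, hA₁, A₂, hA₂, hA⟩ := Bresse.decay_of_symbolBound hI three_pos hC s
  obtain ⟨B₁, hB₁, B₂, hB₂, hB⟩ := Bresse.decay_of_symbolBound hIII three_pos hC' s
  have h2 : 0 < max A₂ B₂ := lt_max_of_lt_left hA₂
  refine ⟨max A₁ B₁, lt_max_of_lt_left hA₁, max A₂ B₂, h2, fun u θ₁ θ₂ h h0 h1 => ?_,
    fun u θ h h0 h1 => ?_⟩
  · have := hA _ h.continuous_L2 h.isWeakSolution h0 h1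
    -- The speed hypothesis is not needed: the estimate with 4 holds in either case and is weakened
    -- to 6 when the speeds differ.
    exact ⟨fun _ => this.mono (le_max_left _ _) (le_max_left _ _) h2.le four_pos le_rfl,
      fun _ => this.mono (le_max_left _ _) (le_max_left _ _) h2.le four_pos (by norm_num)⟩
  · have := hB _ h.continuous_L2 h.isWeakSolution h0 h1
    exact ⟨fun _ => this.mono (le_max_right _ _) (le_max_right _ _) h2.le four_pos le_rfl,
      fun _ => this.mono (le_max_right _ _) (le_max_right _ _) h2.le four_pos (by norm_num)⟩
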